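/- Let $4\mid n$, $4\mid \ell$, $1\le \ell\le n$. An instance of the fixed weight subset sum problem consists of $n$, $\ell$ and positive integers $a_1,\dots,a_n$ and $t$; a solution is a bit vector $x\in\{0,1\}^n$ with $\sum_i x_i=\ell$ and $\sum_i a_ix_i=t$. Let $b$ be the bit length of the largest of the numbers $n,\ell,t,a_1,\dots,a_n$. Algorithms are programs (one fixed program for all instances) of a random access machine with addition, subtraction, halving, read-only input, write-only output and, in the randomized case, fair coin tosses; time is counted in bit operations (logarithmic cost) and space in bits of work memory. For a function $g$ of $(n,\ell)$, a quantity is $\tilde O(g)$ if there are $c,N\in\mathbb N$ such that it is at most $g\cdot(\log_2(3+g))^c$ for all $n\ge N$, all $\ell$ as above and all $a_1,\dots,a_n,t$ under consideration. Put $$T=\binom{n/4}{\ell/4}^2,\qquad S=\binom{n/4}{\ell/4}.$$ 1. There is a deterministic algorithm that halts on every instance, outputs a solution if there is one and outputs nothing otherwise, and uses at most $b\cdot\tilde O\bigl(n^3\binom{n/4}{\ell/4}^2\bigr)$ bit operations and at most $b\cdot\tilde O\bigl(\binom{n/4}{\ell/4}\bigr)$ bits of space. 2. There is a randomized algorithm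 that never halts with a wrong answer (that is, whenever it halts, its output is a solution if there is one and nothing otherwise), that on every instance with a solution halts with probability one after an expected number of at most $b\cdot\tilde O\bigl(\ell^{3/2}\binom{n/4}{\ell/4}^2\bigr)$ bit operations, and that on every instance and for every outcome of its coin tosses uses at most $b\cdot\tilde O\bigl(\binom{n/4}{\ell/4}\bigr)$ bits of space. 3. The exponential terms $T$ of the time and $S$ of the space lie on the curve $T\cdot S^2=\binom n\ell$ up to a polynomial factor: there is a constant $K>0$ such that for all $n,\ell$ as above $$T\cdot S^2\;\le\;\binom n\ell\;\le\;K\,\ell^{3/2}\,T\cdot S^2 .$$ -/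

import Mathlib

open MeasureTheory
open scoped ENNReal

noncomputable section

namespace RAM

/-- Programs of a random access machine with logarithmic (bit) cost. The machine has registers
holding natural numbers, work arrays with random access (the `k`-th array is addressed by the
content of a register; a program mentions only finitely many registers and arrays), a read-only
input array, and a write-only output list of bits. In the constructors `d` is a destination
register and `r`, `s` are source registers. -/
inductive Cmd : Type
  | skip : Cmd
  /-- `d := v` -/
  | const (d v : ℕ) : Cmd
  /-- `d := r + s` -/
  | add (d r s : ℕ) : Cmd
  /-- `d := r - s`, truncated at `0` -/
  | sub (d r s : ℕ) : Cmd
  /-- `d := ⌊r / 2⌋` -/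
  | half (d r : ℕ) : Cmd
  /-- `d := array k [r]` -/
  | load (d k r : ℕ) : Cmd
  /-- `array k [r] := s` -/
  | store (k r s : ℕ) : Cmd
  /-- `d := input [r]` -/
  | input (d r : ℕ) : Cmd
  /-- `d := ` a fair coin toss (`0` or `1`) -/
  | flip (d : ℕ) : Cmd
  /-- append to the output the bit that tells whether `r` is nonzero -/
  | output (r : ℕ) : Cmd
  /-- sequential composition -/
  | seq (p q : Cmd) : Cmd
  /-- if `r ≠ 0` then `p` else `q` -/
  | ifnz (r : ℕ) (p q : Cmd) : Cmd
  /-- while `r ≠ 0` do `p` -/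
  | whilenz (r : ℕ) (p : Cmd) : Cmd

/-- A program is deterministic if it has no coin tosses. -/
def Cmd.Deterministic : Cmd → Prop
  | .flip _ => False
  | .seq p q => p.Deterministic ∧ q.Deterministic
  | .ifnz _ p q => p.Deterministic ∧ q.Deterministic
  | .whilenz _ p => p.Deterministic
  | _ => True

/-- A configuration: the commands still to be executed (a stack whose height is bounded by the
nesting depth of the program), the registers, the cells of the work arrays (array, address), and
the output so far. Registers and cells that were never written hold `0`. -/
structure Config where
  code : List Cmd
  reg : ℕ →₀ ℕ
  mem : ℕ × ℕ →₀ ℕ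
  out : List Bool

/-- The machine has halted when no command is left. -/
def Config.Halted (σ : Config) : Prop := σ.code = []

/-- One step of the machine on the input array `inp`; `coin` is the result of the coin toss if
the step is a coin toss, and is ignored otherwise. -/
def step (inp : ℕ → ℕ) (coin : Bool) (σ : Config) : Config :=
  match σ.code with
  | [] => σ
  | .skip :: K => { σ with code := K }
  | .const d v :: K => { σ with code := K, reg := σ.reg.update d v }
  | .add d r s :: K => { σ with code := K, reg := σ.reg.update d (σ.reg r + σ.reg s) }
  | .sub d r s :: K => { σ with code := K, reg := σ.reg.update d (σ.reg r - σ.reg s) }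
  | .half d r :: K => { σ with code := K, reg := σ.reg.update d (σ.reg r / 2) }
  | .load d k r :: K => { σ with code := K, reg := σ.reg.update d (σ.mem (k, σ.reg r)) }
  | .store k r s :: K => { σ with code := K, mem := σ.mem.update (k, σ.reg r) (σ.reg s) }
  | .input d r :: K => { σ with code := K, reg := σ.reg.update d (inp (σ.reg r)) }
  | .flip d :: K => { σ with code := K, reg := σ.reg.update d coin.toNat }
  | .output r :: K => { σ with code := K, out := σ.out ++ [decide (σ.reg r ≠ 0)] }
  | .seq p q :: K => { σ with code := p :: q :: K }
  | .ifnz r p q :: K => { σ with code := (if σ.reg r ≠ 0 then p else q) :: K }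
  | .whilenz r p :: K =>
      { σ with code := if σ.reg r ≠ 0 then p :: .whilenz r p :: K else K }

/-- The number of bit operations charged for the next step: one plus the bit lengths of all
operands and addresses involved (logarithmic cost). A halted machine does nothing. -/
def cost (inp : ℕ → ℕ) (σ : Config) : ℕ :=
  match σ.code with
  | [] => 0
  | .skip :: _ => 1
  | .const _ v :: _ => 1 + v.size
  | .add _ r s :: _ => 1 + (σ.reg r).size + (σ.reg s).size
  | .sub _ r s :: _ => 1 + (σ.reg r).size + (σ.reg s).size
  | .half _ r :: _ => 1 + (σ.reg r).size
  | .load _ k r :: _ => 1 + (σ.reg r).size + (σ.mem (k, σ.reg r)).size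
  | .store _ r s :: _ => 1 + (σ.reg r).size + (σ.reg s).size
  | .input _ r :: _ => 1 + (σ.reg r).size + (inp (σ.reg r)).size
  | .flip _ :: _ => 1
  | .output r :: _ => 1 + (σ.reg r).size
  | .seq _ _ :: _ => 1
  | .ifnz r _ _ :: _ => 1 + (σ.reg r).size
  | .whilenz r _ :: _ => 1 + (σ.reg r).size

/-- The number of bits of work space occupied by a configuration: the bit lengths of all nonzero
registers, and the bit lengths of the addresses and contents of all nonzero memory cells. -/
def Config.space (σ : Config) : ℕ :=
  (σ.reg.sum fun _ v => v.size) + σ.mem.sum fun c v => c.2.size + v.size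

/-- The initial configuration of a program. -/
def init (P : Cmd) : Config := ⟨[P], 0, 0, []⟩

/-- The configuration after `τ` steps of `P` on input `inp`, where `ω τ` is the coin that is
available at step `τ`. -/
def run (P : Cmd) (inp : ℕ → ℕ) (ω : ℕ → Bool) : ℕ → Config
  | 0 => init P
  | τ + 1 => step inp (ω τ) (run P inp ω τ)

/-- The total number of bit operations of a run; it is infinite if the run does not halt. -/
def time (P : Cmd) (inp : ℕ → ℕ) (ω : ℕ → Bool) : ℝ≥0∞ :=
  ∑' τ, (cost inp (run P inp ω τ) : ℝ≥0∞)

/-- The work space of a run: the supremum of the space of all its configurations. -/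
def space (P : Cmd) (inp : ℕ → ℕ) (ω : ℕ → Bool) : ℝ≥0∞ :=
  ⨆ τ, ((run P inp ω τ).space : ℝ≥0∞)

/-- The law of an infinite sequence of independent fair coins. -/
def coinMeasure : Measure (ℕ → Bool) :=
  Measure.infinitePi fun _ : ℕ => (PMF.uniformOfFintype Bool).toMeasure

/-- The expected number of bit operations. -/
def expectedTime (P : Cmd) (inp : ℕ → ℕ) : ℝ≥0∞ :=
  ∫⁻ ω, time P inp ω ∂coinMeasure

end RAM

/-- An instance of the fixed weight subset sum problem: positive integers `a₁, …, aₙ`, a positive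
target `t` and a weight `1 ≤ ℓ ≤ n`. -/
structure SubsetSumInstance where
  n : ℕ
  ℓ : ℕ
  t : ℕ
  a : Fin n → ℕ
  weight_pos : 0 < ℓ
  weight_le : ℓ ≤ n
  target_pos : 0 < t
  a_pos : ∀ i, 0 < a i

namespace SubsetSumInstance

/-- `x` is a bit vector of Hamming weight `ℓ` with `∑ aᵢ xᵢ = t`. -/
def IsSolution (I : SubsetSumInstance) (x : Fin I.n → Bool) : Prop :=
  (∑ i, (x i).toNat) = I.ℓ ∧ (∑ i, I.a i * (x i).toNat) = I.t

def Solvable (I : SubsetSumInstance) : Prop := ∃ x, I.IsSolution x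

/-- Length and weight are divisible by four. -/
def FourDivides (I : SubsetSumInstance) : Prop := 4 ∣ I.n ∧ 4 ∣ I.ℓ

/-- The input array `n, ℓ, t, a₁, …, aₙ` (followed by zeros). -/
def encode (I : SubsetSumInstance) : ℕ → ℕ
  | 0 => I.n
  | 1 => I.ℓ
  | 2 => I.t
  | i + 3 => if h : i < I.n then I.a ⟨i, h⟩ else 0

/-- The bit length of the largest of the numbers `n, ℓ, t, a₁, …, aₙ`. -/
def bitLength (I : SubsetSumInstance) : ℕ :=
  (max (max I.n I.ℓ) (max I.t (Finset.univ.sup I.a))).size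

/-- The answer to an instance: the bits of a solution, or nothing if there is no solution. -/
def IsAnswer (I : SubsetSumInstance) (out : List Bool) : Prop :=
  (∃ x, I.IsSolution x ∧ out = List.ofFn x) ∨ (¬ I.Solvable ∧ out = [])

end SubsetSumInstance

/-- On the instances in `D`, the quantity `f` (bit operations or bits) is at most `b` times
a quantity that is `Õ(g)`, where `b` is the bit length of the numbers in the instance: there are
`c` and `N` with `f ≤ b · g · (log₂ (3 + g))ᶜ` on all instances of length `n ≥ N`. -/
def IsSoftO (D : Set SubsetSumInstance) (f : SubsetSumInstance → ℝ≥0∞)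
    (g : SubsetSumInstance → ℝ) : Prop :=
  ∃ c N : ℕ, ∀ I ∈ D, N ≤ I.n →
    f I ≤ ENNReal.ofReal (I.bitLength * (g I * (Real.logb 2 (3 + g I)) ^ c))

/-- The exponential term `T` of the time. -/
def timeTerm (n ℓ : ℕ) : ℝ := ((n / 4).choose (ℓ / 4) : ℝ) ^ 2

/-- The exponential term `S` of the space. -/
def spaceTerm (n ℓ : ℕ) : ℝ := ((n / 4).choose (ℓ / 4) : ℝ)

end

/-! Put N = n/4, w = ℓ/4 and S = C(N, w). A single program without coin tosses serves for both
algorithmic claims: its time is b · S² · polylog(S), with an extra factor n only if ℓ = n, which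
lies below both time bounds.

Suppose the 4N positions are divided into four parts of size N on each of which a solution has
weight w. Then each part has S candidate subsets, and the four-list method of Schroeppel and Shamir
applies. The subset sums of each part are listed; a tournament tree with S leaves enumerates the
pair sums of two lists in order; and a scan of two such enumerations in opposite directions finds
four entries with total t. This takes O(S² log S) steps and stores O(S) numbers (`wp_mergeCmd`,
`wp_attemptCmd`).

It remains to find such a partition among polylog(S) candidates; polynomially many in n would be too
many when ℓ is small. The positions are grouped in fours, and every part takes one element of each
group. Groups on which the solution is constant are irrelevant. The number of mixed groups is at
most 4 min(w, N - w), and 2 ^ min(w, N - w) ≤ S, so it is O(log S). By counting primes, some modulus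
q of size polylog(S) separates the mixed groups (`exists_separating`). Let the division of a group
depend only on its residue modulo q, through thresholds. Raising a threshold by one affects at most
one mixed group and changes the weight of a part by at most one, so a discrete intermediate value
argument balances first two halves and then the quarters of each (`exists_balanced`). All quadruples
(q, k, k₀, k₁) are tried.

The program is verified in a weakest precondition calculus that counts steps and bounds values and
addresses; `run_of_wp` turns such a specification into bit costs. The case ℓ = n, where S = 1, is
decided directly.

For the tradeoff, S⁴ ≤ C(4N, 4w) is one term of Vandermonde's identity, used twice, and the reverse
bound follows from Stirling-like estimates of (4m)! against 256^m · m!⁴. -/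

noncomputable section

namespace RAM

-- A weakest precondition calculus with step counts for the machine.

infixr:50 " ;; " => Cmd.seq

/-- A configuration without its code, with memory as functions; `time` counts the steps. -/
structure St where
  reg : ℕ → ℕ
  mem : ℕ → ℕ → ℕ
  out : List Bool
  time : ℕ

def St.tick (s : St) : St := { s with time := s.time + 1 }

@[simp] theorem St.tick_reg (s : St) : s.tick.reg = s.reg := rfl
@[simp] theorem St.tick_mem (s : St) : s.tick.mem = s.mem := rfl
@[simp] theorem St.tick_out (s : St) : s.tick.out = s.out := rfl
@[simp] theorem St.tick_time (s : St) : s.tick.time = s.time + 1 := rfl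

/-- Weakest preconditions for total correctness of coin-free programs on the input `inp`, with the
additional obligations that no value exceeds `V` and no address of a written cell exceeds `D`. -/
def wp (inp : ℕ → ℕ) (V D : ℕ) : Cmd → (St → Prop) → St → Prop
  | .skip, Q, s => Q s.tick
  | .const d v, Q, s => v ≤ V ∧ Q ⟨Function.update s.reg d v, s.mem, s.out, s.time + 1⟩
  | .add d r x, Q, s => s.reg r + s.reg x ≤ V ∧
      Q ⟨Function.update s.reg d (s.reg r + s.reg x), s.mem, s.out, s.time + 1⟩
  -- Subtraction and halving do not exceed an operand and a load returns a stored value, so these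
  -- commands create no obligation about `V`.
  | .sub d r x, Q, s =>
      Q ⟨Function.update s.reg d (s.reg r - s.reg x), s.mem, s.out, s.time + 1⟩
  | .half d r, Q, s => Q ⟨Function.update s.reg d (s.reg r / 2), s.mem, s.out, s.time + 1⟩
  | .load d k r, Q, s =>
      Q ⟨Function.update s.reg d (s.mem k (s.reg r)), s.mem, s.out, s.time + 1⟩
  | .store k r x, Q, s => s.reg r ≤ D ∧
      Q ⟨s.reg, Function.update s.mem k (Function.update (s.mem k) (s.reg r) (s.reg x)), s.out,
        s.time + 1⟩
  | .input d r, Q, s => inp (s.reg r) ≤ V ∧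
      Q ⟨Function.update s.reg d (inp (s.reg r)), s.mem, s.out, s.time + 1⟩
  | .flip _, _, _ => False
  | .output r, Q, s => Q ⟨s.reg, s.mem, s.out ++ [decide (s.reg r ≠ 0)], s.time + 1⟩
  | .seq p q, Q, s => wp inp V D p (wp inp V D q Q) s.tick
  | .ifnz r p q, Q, s => if s.reg r ≠ 0 then wp inp V D p Q s.tick else wp inp V D q Q s.tick
  -- `m` is fuel: the recursor unrolls the loop, with `False` when the fuel runs out, so its
  -- existence expresses termination.
  | .whilenz r p, Q, s => ∃ m : ℕ, Nat.rec (motive := fun _ => St → Prop) (fun _ => False)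
      (fun _ X s => if s.reg r ≠ 0 then wp inp V D p X s.tick else Q s.tick) m s

section
variable {inp : ℕ → ℕ} {V D : ℕ} {Q : St → Prop} {s : St}

@[simp] theorem wp_skip : wp inp V D .skip Q s ↔ Q s.tick := Iff.rfl
@[simp] theorem wp_const {d v : ℕ} : wp inp V D (.const d v) Q s ↔
    v ≤ V ∧ Q ⟨Function.update s.reg d v, s.mem, s.out, s.time + 1⟩ := Iff.rfl
@[simp] theorem wp_add {d r x : ℕ} : wp inp V D (.add d r x) Q s ↔ s.reg r + s.reg x ≤ V ∧
    Q ⟨Function.update s.reg d (s.reg r + s.reg x), s.mem, s.out, s.time + 1⟩ := Iff.rfl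
@[simp] theorem wp_sub {d r x : ℕ} : wp inp V D (.sub d r x) Q s ↔
    Q ⟨Function.update s.reg d (s.reg r - s.reg x), s.mem, s.out, s.time + 1⟩ := Iff.rfl
@[simp] theorem wp_half {d r : ℕ} : wp inp V D (.half d r) Q s ↔
    Q ⟨Function.update s.reg d (s.reg r / 2), s.mem, s.out, s.time + 1⟩ := Iff.rfl
@[simp] theorem wp_load {d k r : ℕ} : wp inp V D (.load d k r) Q s ↔
    Q ⟨Function.update s.reg d (s.mem k (s.reg r)), s.mem, s.out, s.time + 1⟩ := Iff.rfl
@[simp] theorem wp_store {k r x : ℕ} : wp inp V D (.store k r x) Q s ↔ s.reg r ≤ D ∧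
    Q ⟨s.reg, Function.update s.mem k (Function.update (s.mem k) (s.reg r) (s.reg x)), s.out,
      s.time + 1⟩ := Iff.rfl
@[simp] theorem wp_input {d r : ℕ} : wp inp V D (.input d r) Q s ↔ inp (s.reg r) ≤ V ∧
    Q ⟨Function.update s.reg d (inp (s.reg r)), s.mem, s.out, s.time + 1⟩ := Iff.rfl
@[simp] theorem wp_output {r : ℕ} : wp inp V D (.output r) Q s ↔
    Q ⟨s.reg, s.mem, s.out ++ [decide (s.reg r ≠ 0)], s.time + 1⟩ := Iff.rfl
@[simp] theorem wp_seq {p q : Cmd} : wp inp V D (p ;; q) Q s ↔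
    wp inp V D p (wp inp V D q Q) s.tick := Iff.rfl
@[simp] theorem wp_ifnz {r : ℕ} {p q : Cmd} : wp inp V D (.ifnz r p q) Q s ↔
    if s.reg r ≠ 0 then wp inp V D p Q s.tick else wp inp V D q Q s.tick := Iff.rfl

end

/-- The registers that a program writes. -/
def Cmd.writes : Cmd → ℕ → Bool
  | .const d _, r => r == d
  | .add d _ _, r => r == d
  | .sub d _ _, r => r == d
  | .half d _, r => r == d
  | .load d _ _, r => r == d
  | .input d _, r => r == d
  | .flip d, r => r == d
  | .seq p q, r => p.writes r || q.writes r
  | .ifnz _ p q, r => p.writes r || q.writes r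
  | .whilenz _ p, r => p.writes r
  | _, _ => false

/-- The arrays that a program writes. -/
def Cmd.stores : Cmd → ℕ → Bool
  | .store k _ _, a => a == k
  | .seq p q, a => p.stores a || q.stores a
  | .ifnz _ p q, a => p.stores a || q.stores a
  | .whilenz _ p, a => p.stores a
  | _, _ => false

/-- Whether a program mentions the output. -/
def Cmd.outputs : Cmd → Bool
  | .output _ => true
  | .seq p q => p.outputs || q.outputs
  | .ifnz _ p q => p.outputs || q.outputs
  | .whilenz _ p => p.outputs
  | _ => false

/-- A program without coin tosses that writes only registers below `R` and arrays below `A`. -/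
def Cmd.within (R A : ℕ) : Cmd → Bool
  | .skip => true
  | .const d _ => decide (d < R)
  | .add d _ _ => decide (d < R)
  | .sub d _ _ => decide (d < R)
  | .half d _ => decide (d < R)
  | .load d _ _ => decide (d < R)
  | .store k _ _ => decide (k < A)
  | .input d _ => decide (d < R)
  | .flip _ => false
  | .output _ => true
  | .seq p q => p.within R A && q.within R A
  | .ifnz _ p q => p.within R A && q.within R A
  | .whilenz _ p => p.within R A

theorem Cmd.within.deterministic {R A : ℕ} : ∀ {p : Cmd}, p.within R A = true → p.Deterministic
  | .skip, _ => trivial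
  | .const _ _, _ => trivial
  | .add _ _ _, _ => trivial
  | .sub _ _ _, _ => trivial
  | .half _ _, _ => trivial
  | .load _ _ _, _ => trivial
  | .store _ _ _, _ => trivial
  | .input _ _, _ => trivial
  | .output _, _ => trivial
  | .seq _ _, h => by
      simp only [within, Bool.and_eq_true] at h
      exact ⟨deterministic h.1, deterministic h.2⟩
  | .ifnz _ _ _, h => by
      simp only [within, Bool.and_eq_true] at h
      exact ⟨deterministic h.1, deterministic h.2⟩
  | .whilenz _ p, h => deterministic (p := p) h

/-- `s'` differs from `s` only where `p` writes. -/
structure Frame (p : Cmd) (s s' : St) : Prop where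
  reg : ∀ r, p.writes r = false → s'.reg r = s.reg r
  mem : ∀ k, p.stores k = false → s'.mem k = s.mem k
  out : p.outputs = false → s'.out = s.out

theorem Frame.refl (p : Cmd) (s : St) : Frame p s s := ⟨fun _ _ => rfl, fun _ _ => rfl, fun _ => rfl⟩

theorem Frame.tick {p : Cmd} {s s' : St} (h : Frame p s s') : Frame p s s'.tick :=
  ⟨h.reg, h.mem, h.out⟩

theorem Frame.of_tick {p : Cmd} {s s' : St} (h : Frame p s.tick s') : Frame p s s' :=
  ⟨h.reg, h.mem, h.out⟩

theorem Frame.trans {p : Cmd} {s₁ s₂ s₃ : St} (h : Frame p s₁ s₂) (h' : Frame p s₂ s₃) :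
    Frame p s₁ s₃ :=
  ⟨fun r hr => (h'.reg r hr).trans (h.reg r hr), fun k hk => (h'.mem k hk).trans (h.mem k hk),
    fun ho => (h'.out ho).trans (h.out ho)⟩

theorem Frame.mono {p q : Cmd} {s s' : St} (h : Frame p s s')
    (hw : ∀ r, q.writes r = false → p.writes r = false)
    (hs : ∀ r, q.stores r = false → p.stores r = false)
    (ho : q.outputs = false → p.outputs = false) : Frame q s s' :=
  ⟨fun r hr => h.reg r (hw r hr), fun r hr => h.mem r (hs r hr), fun h' => h.out (ho h')⟩

section
variable {inp : ℕ → ℕ} {V D : ℕ}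

theorem wp_mono {p : Cmd} {Q Q' : St → Prop} {s : St} (h : wp inp V D p Q s)
    (hQ : ∀ s', Q s' → Q' s') : wp inp V D p Q' s := by
  induction p generalizing Q Q' s with
  | skip => exact hQ _ h
  | const | add | store | input => exact ⟨h.1, hQ _ h.2⟩
  | sub | half | load | output => exact hQ _ h
  | flip => exact h
  | seq p q ihp ihq => exact ihp h fun s' h' => ihq h' hQ
  | ifnz r p q ihp ihq =>
    simp only [wp] at h ⊢
    split_ifs at h ⊢
    · exact ihp h hQ
    · exact ihq h hQ
  | whilenz r p ih =>
    obtain ⟨m, hm⟩ := h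
    refine ⟨m, ?_⟩
    induction m generalizing s with
    | zero => exact hm
    | succ m ihm =>
      simp only at hm ⊢
      split_ifs at hm ⊢
      · exact ih hm fun s' h' => ihm h'
      · exact hQ _ hm

/-- Adds to any specification the syntactic fact that everything not written is unchanged, so that
specifications need mention only what a program alters. -/
theorem wp_frame {p : Cmd} {Q : St → Prop} {s : St} (h : wp inp V D p Q s) :
    wp inp V D p (fun s' => Q s' ∧ Frame p s s') s := by
  induction p generalizing Q s with
  | skip => exact ⟨h, (Frame.refl _ _).tick⟩
  | const | add | input =>
    refine ⟨h.1, h.2, ?_, ?_, ?_⟩ <;> intros <;> simp_all [Cmd.writes]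
  | sub | half | load =>
    refine ⟨h, ?_, ?_, ?_⟩ <;> intros <;> simp_all [Cmd.writes]
  | store =>
    refine ⟨h.1, h.2, ?_, ?_, ?_⟩ <;> intros <;> simp_all [Cmd.stores]
  | output =>
    refine ⟨h, ?_, ?_, ?_⟩ <;> intros <;> simp_all [Cmd.outputs]
  | flip => exact h
  | seq p q ihp ihq =>
    change wp inp V D p (wp inp V D q _) s.tick
    refine wp_mono (ihp h) fun s' h' => wp_mono (ihq h'.1) fun s'' h'' => ⟨h''.1, ?_⟩
    refine Frame.trans (h'.2.of_tick.mono ?_ ?_ ?_) (h''.2.mono ?_ ?_ ?_) <;>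
      simp_all [Cmd.writes, Cmd.stores, Cmd.outputs]
  | ifnz r p q ihp ihq =>
    simp only [wp] at h ⊢
    split_ifs at h ⊢
    · refine wp_mono (ihp h) fun s' h' => ⟨h'.1, h'.2.of_tick.mono ?_ ?_ ?_⟩ <;>
        simp_all [Cmd.writes, Cmd.stores, Cmd.outputs]
    · refine wp_mono (ihq h) fun s' h' => ⟨h'.1, h'.2.of_tick.mono ?_ ?_ ?_⟩ <;>
        simp_all [Cmd.writes, Cmd.stores, Cmd.outputs]
  | whilenz r p ih =>
    obtain ⟨m, hm⟩ := h
    refine ⟨m, ?_⟩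
    have key : ∀ s', Frame (.whilenz r p) s s' →
        Nat.rec (motive := fun _ => St → Prop) (fun _ => False)
          (fun _ X s => if s.reg r ≠ 0 then wp inp V D p X s.tick else Q s.tick) m s' →
        Nat.rec (motive := fun _ => St → Prop) (fun _ => False)
          (fun _ X s' => if s'.reg r ≠ 0 then wp inp V D p X s'.tick
            else Q s'.tick ∧ Frame (.whilenz r p) s s'.tick) m s' := by
      clear hm
      induction m with
      | zero => exact fun _ _ h => h
      | succ m ihm =>
        intro s' hF hm
        simp only at hm ⊢
        split_ifs at hm ⊢
        · refine wp_mono (ih hm) fun s'' h' => ihm s'' (hF.trans ?_) h'.1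
          exact h'.2.of_tick.mono (fun _ h => h) (fun _ h => h) fun h => h
        · exact ⟨hm, hF.tick⟩
    exact key s (Frame.refl _ _) hm

/-- Total correctness of a loop: `I` is an invariant, and `μ` decreases by at least one in every
iteration, each of which takes at most `c` steps. -/
theorem wp_while {r : ℕ} {p : Cmd} {Q : St → Prop} {s : St} (I : St → Prop) (μ : St → ℕ) (c : ℕ)
    (h0 : I s)
    (hstep : ∀ s', I s' → Frame p s s' → s'.reg r ≠ 0 →
      wp inp V D p (fun s'' => I s'' ∧ μ s'' < μ s' ∧ s''.time ≤ s'.time + c) s'.tick)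
    (hend : ∀ s', I s' → Frame p s s' → s'.reg r = 0 → s'.time ≤ s.time + μ s * c → Q s'.tick) :
    wp inp V D (.whilenz r p) Q s := by
  -- The potential time + μ · c never increases along the loop; this yields the time bound at the
  -- exit.
  have key : ∀ m s', μ s' < m → I s' → Frame p s s' → s'.time + μ s' * c ≤ s.time + μ s * c →
      Nat.rec (motive := fun _ => St → Prop) (fun _ => False)
      (fun _ X s => if s.reg r ≠ 0 then wp inp V D p X s.tick else Q s.tick) m s' := by
    intro m
    induction m with
    | zero => intro s' h; omega
    | succ m ihm =>
      intro s' hμ hI hF ht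
      simp only
      split_ifs with hr
      · refine wp_mono (wp_frame (hstep s' hI hF hr)) fun s'' h'' => ?_
        obtain ⟨⟨hI', hμ', ht'⟩, hF'⟩ := h''
        refine ihm s'' (by omega) hI' (hF.trans hF'.of_tick) ?_
        have : (μ s'' + 1) * c ≤ μ s' * c := Nat.mul_le_mul_right c hμ'
        rw [Nat.add_mul] at this
        omega
      · exact hend s' hI hF (by simpa using hr) (by omega)
  exact ⟨μ s + 1, key _ s (Nat.lt_succ_self _) h0 (Frame.refl _ _) le_rfl⟩

/-- Sequential composition through an intermediate specification. -/
theorem wp_then {p : Cmd} {Q R : St → Prop} {s : St} (h : wp inp V D p R s)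
    (hQ : ∀ s', R s' → Frame p s s' → Q s') : wp inp V D p Q s :=
  wp_mono (wp_frame h) fun s' h' => hQ s' h'.1 h'.2

end

/-- All values are at most `V`, at most the registers below `R` and the cells at addresses up to
`D` of the arrays below `A` are in use. -/
structure Config.Fits (R A V D : ℕ) (σ : Config) : Prop where
  reg_le : ∀ r, σ.reg r ≤ V
  reg_lt : ∀ r, σ.reg r ≠ 0 → r < R
  mem_le : ∀ c, σ.mem c ≤ V
  mem_lt : ∀ c, σ.mem c ≠ 0 → c.1 < A ∧ c.2 ≤ D

/-- After `s.time` steps the machine is in the state `s` with the code `K` left, and so far all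
configurations were small. -/
structure At (P : Cmd) (inp : ℕ → ℕ) (ω : ℕ → Bool) (R A V D : ℕ) (K : List Cmd) (s : St) :
    Prop where
  code : (run P inp ω s.time).code = K
  reg : ∀ r, (run P inp ω s.time).reg r = s.reg r
  mem : ∀ k a, (run P inp ω s.time).mem (k, a) = s.mem k a
  out : (run P inp ω s.time).out = s.out
  fits : ∀ τ ≤ s.time, (run P inp ω τ).Fits R A V D

section
variable {P : Cmd} {inp : ℕ → ℕ} {ω : ℕ → Bool} {R A V D : ℕ} {K : List Cmd}

theorem At.step {s s' : St} {c : Cmd} {K' : List Cmd} (h : At P inp ω R A V D (c :: K) s)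
    (ht : s'.time = s.time + 1)
    (hstep : ∀ σ : Config, σ.code = c :: K → (∀ r, σ.reg r = s.reg r) →
      (∀ k a, σ.mem (k, a) = s.mem k a) → σ.out = s.out → σ.Fits R A V D → ∀ b,
      (step inp b σ).code = K' ∧ (∀ r, (step inp b σ).reg r = s'.reg r) ∧
      (∀ k a, (step inp b σ).mem (k, a) = s'.mem k a) ∧ (step inp b σ).out = s'.out ∧
      (step inp b σ).Fits R A V D) : At P inp ω R A V D K' s' := by
  obtain ⟨h1, h2, h3, h4, h5⟩ := hstep _ h.code h.reg h.mem h.out (h.fits _ le_rfl) (ω s.time)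
  constructor
  · rw [ht]; exact h1
  · rw [ht]; exact h2
  · rw [ht]; exact h3
  · rw [ht]; exact h4
  · intro τ hτ
    rcases Nat.lt_or_ge s.time τ with h' | h'
    · obtain rfl : τ = s.time + 1 := by omega
      exact h5
    · exact h.fits τ h'

theorem Config.Fits.set_reg {σ : Config} (h : σ.Fits R A V D) {d v : ℕ} (hd : d < R) (hv : v ≤ V)
    (K : List Cmd) : Config.Fits R A V D { σ with code := K, reg := σ.reg.update d v } := by
  refine ⟨fun r => ?_, fun r => ?_, h.mem_le, h.mem_lt⟩
  · have := h.reg_le r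
    simp only [Finsupp.coe_update, Function.update_apply]
    split_ifs <;> assumption
  · have := h.reg_lt r
    simp only [Finsupp.coe_update, Function.update_apply]
    split_ifs with h'
    · exact fun _ => h' ▸ hd
    · exact this

/-- Each command is simulated by one machine step, and a loop by an inner induction on its fuel. The
obligations on values and addresses are exactly what preserves `Fits` in all intermediate
configurations. -/
theorem wp_sound (p : Cmd) (hp : p.within R A = true) {Q : St → Prop} {s : St}
    (h : wp inp V D p Q s) (hs : At P inp ω R A V D (p :: K) s) :
    ∃ s', Q s' ∧ At P inp ω R A V D K s' := by
  induction p generalizing Q s K with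
  | skip =>
    exact ⟨_, h, hs.step rfl fun σ h1 h2 h3 h4 h5 b => by
      simp only [RAM.step, h1]; exact ⟨trivial, h2, h3, h4, h5.1, h5.2, h5.3, h5.4⟩⟩
  | const d v | add d r x | input d r =>
    have hp' : d < R := by simpa [Cmd.within] using hp
    refine ⟨_, h.2, hs.step rfl fun σ h1 h2 h3 h4 h5 b => ?_⟩
    simp only [step, h1]
    refine ⟨trivial, fun r => ?_, h3, h4, h5.set_reg hp' ?_ K⟩
    · simp [Function.update_apply, h2]
    · simpa only [h2] using h.1
  | sub d r x =>
    have hp' : d < R := by simpa [Cmd.within] using hp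
    refine ⟨_, h, hs.step rfl fun σ h1 h2 h3 h4 h5 b => ?_⟩
    simp only [step, h1]
    refine ⟨trivial, fun r => ?_, h3, h4, h5.set_reg hp' ?_ K⟩
    · simp [Function.update_apply, h2]
    · exact (Nat.sub_le _ _).trans (h5.reg_le _)
  | half d r =>
    have hp' : d < R := by simpa [Cmd.within] using hp
    refine ⟨_, h, hs.step rfl fun σ h1 h2 h3 h4 h5 b => ?_⟩
    simp only [step, h1]
    refine ⟨trivial, fun r => ?_, h3, h4, h5.set_reg hp' ?_ K⟩
    · simp [Function.update_apply, h2]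
    · exact (Nat.div_le_self _ _).trans (h5.reg_le _)
  | load d k r =>
    have hp' : d < R := by simpa [Cmd.within] using hp
    refine ⟨_, h, hs.step rfl fun σ h1 h2 h3 h4 h5 b => ?_⟩
    simp only [step, h1]
    refine ⟨trivial, fun r => ?_, h3, h4, h5.set_reg hp' (h5.mem_le _) K⟩
    simp [Function.update_apply, h2, h3]
  | store k r x =>
    have hp' : k < A := by simpa [Cmd.within] using hp
    refine ⟨_, h.2, hs.step rfl fun σ h1 h2 h3 h4 h5 b => ?_⟩
    simp only [step, h1]
    refine ⟨trivial, h2, fun k' a => ?_, h4, h5.reg_le, h5.reg_lt, fun c => ?_, fun c => ?_⟩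
    · simp only [Finsupp.coe_update, Function.update_apply, h2, Prod.mk.injEq]
      by_cases hk : k' = k
      · subst hk; by_cases ha : a = s.reg r <;> simp [ha, h3]
      · simp [hk, h3]
    · have := h5.mem_le c
      simp only [Finsupp.coe_update, Function.update_apply]
      split_ifs
      · exact h5.reg_le _
      · exact this
    · have := h5.mem_lt c
      simp only [Finsupp.coe_update, Function.update_apply]
      split_ifs with h'
      · intro _; rw [h']; exact ⟨hp', by rw [h2]; exact h.1⟩
      · exact this
  | output r =>
    refine ⟨_, h, hs.step rfl fun σ h1 h2 h3 h4 h5 b => ?_⟩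
    simp only [step, h1]
    exact ⟨trivial, h2, h3, by simp [h4, h2], h5.1, h5.2, h5.3, h5.4⟩
  | flip => exact h.elim
  | seq p q ihp ihq =>
    simp only [Cmd.within, Bool.and_eq_true] at hp
    have hs' : At P inp ω R A V D (p :: q :: K) s.tick :=
      hs.step rfl fun σ h1 h2 h3 h4 h5 b => by
        simp only [RAM.step, h1]; exact ⟨trivial, h2, h3, h4, h5.1, h5.2, h5.3, h5.4⟩
    obtain ⟨s', hQ, hs''⟩ := ihp hp.1 h hs'
    exact ihq hp.2 hQ hs''
  | ifnz r p q ihp ihq =>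
    simp only [Cmd.within, Bool.and_eq_true] at hp
    have hs' : At P inp ω R A V D ((if s.reg r ≠ 0 then p else q) :: K) s.tick :=
      hs.step rfl fun σ h1 h2 h3 h4 h5 b => by
        rw [RAM.step, h1]; simp only [h2 r]; exact ⟨trivial, h2, h3, h4, h5.1, h5.2, h5.3, h5.4⟩
    simp only [wp] at h
    split_ifs at h hs' with hr
    · exact ihp hp.1 h hs'
    · exact ihq hp.2 h hs'
  | whilenz r p ih =>
    obtain ⟨m, hm⟩ := h
    induction m generalizing s with
    | zero => exact hm.elim
    | succ m ihm =>
      have hs' : At P inp ω R A V D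
          (if s.reg r ≠ 0 then p :: .whilenz r p :: K else K) s.tick :=
        hs.step rfl fun σ h1 h2 h3 h4 h5 b => by
          rw [RAM.step, h1]; simp only [h2 r]; exact ⟨trivial, h2, h3, h4, h5.1, h5.2, h5.3, h5.4⟩
      simp only at hm
      split_ifs at hm hs' with hr
      · obtain ⟨s', hQ, hs''⟩ := ih hp hm hs'
        exact ihm hs'' hQ
      · exact ⟨_, hm, hs'⟩

/-- The state in which a program starts. -/
def St.start : St := ⟨fun _ => 0, fun _ _ => 0, [], 0⟩

theorem run_of_halted {τ : ℕ} (h : (run P inp ω τ).code = []) {τ' : ℕ} (hτ : τ ≤ τ') :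
    run P inp ω τ' = run P inp ω τ := by
  induction hτ with
  | refl => rfl
  | step _ ih => rw [run, ih, step, h]

/-- The operand of `const` or `input` need not be in a register yet; its size is read off the
successor configuration, which therefore has to fit as well. -/
theorem cost_le_of_fits {σ : Config} (h : σ.Fits R A V D) {b : Bool}
    (h' : (step inp b σ).Fits R A V D) : cost inp σ ≤ 1 + 2 * V.size := by
  have hr : ∀ r, (σ.reg r).size ≤ V.size := fun r => Nat.size_le_size (h.reg_le r)
  have hm : ∀ c, (σ.mem c).size ≤ V.size := fun r => Nat.size_le_size (h.mem_le r)
  have hs : ∀ r, ((step inp b σ).reg r).size ≤ V.size := fun r => Nat.size_le_size (h'.reg_le r)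
  obtain ⟨code, reg, mem, out⟩ := σ
  rcases code with _ | ⟨c, K⟩
  · simp [cost]
  cases c with
  | skip | flip | seq => simp [cost]
  | const d v =>
    have := hs d
    simp only [step, Finsupp.coe_update, Function.update_self] at this
    simp only [cost]; omega
  | add d r x | sub d r x | store d r x =>
    have h1 := hr r; have h2 := hr x
    simp only [cost] at *; omega
  | half d r | ifnz r | whilenz r | output r =>
    have h1 := hr r
    simp only [cost] at *; omega
  | load d k r =>
    have h1 := hr r; have h2 := hm (k, reg r)
    simp only [cost] at *; omega
  | input d r =>
    have h1 := hr r; have h2 := hs d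
    simp only [step, Finsupp.coe_update, Function.update_self] at h2
    simp only [cost] at *; omega

theorem space_le_of_fits {σ : Config} (h : σ.Fits R A V D) :
    σ.space ≤ R * V.size + A * (D + 1) * (D.size + V.size) := by
  unfold Config.space
  refine Nat.add_le_add ?_ ?_
  · refine (Finset.sum_le_card_nsmul _ _ V.size fun r _ =>
      Nat.size_le_size (h.reg_le r)).trans ?_
    rw [smul_eq_mul]
    refine Nat.mul_le_mul_right _ ?_
    calc σ.reg.support.card ≤ (Finset.range R).card := Finset.card_le_card fun r hr =>
          Finset.mem_range.2 (h.reg_lt r (Finsupp.mem_support_iff.1 hr))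
      _ = R := Finset.card_range R
  · refine (Finset.sum_le_card_nsmul _ _ (D.size + V.size) fun c hc =>
      Nat.add_le_add (Nat.size_le_size (h.mem_lt c (Finsupp.mem_support_iff.1 hc)).2)
        (Nat.size_le_size (h.mem_le c))).trans ?_
    rw [smul_eq_mul]
    refine Nat.mul_le_mul_right _ ?_
    calc σ.mem.support.card ≤ (Finset.range A ×ˢ Finset.range (D + 1)).card :=
          Finset.card_le_card fun c hc => by
            have := h.mem_lt c (Finsupp.mem_support_iff.1 hc)
            simp only [Finset.mem_product, Finset.mem_range]; omega
      _ = A * (D + 1) := by simp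

/-- What a weakest precondition says about the machine. -/
theorem run_of_wp (hP : P.within R A = true) {Q : St → Prop} (h : wp inp V D P Q St.start)
    (ω : ℕ → Bool) : ∃ s', Q s' ∧ (run P inp ω s'.time).Halted ∧
      (run P inp ω s'.time).out = s'.out ∧
      time P inp ω ≤ ((s'.time * (1 + 2 * V.size) : ℕ) : ℝ≥0∞) ∧
      space P inp ω ≤ ((R * V.size + A * (D + 1) * (D.size + V.size) : ℕ) : ℝ≥0∞) := by
  have h0 : At P inp ω R A V D [P] St.start := by
    refine ⟨rfl, fun _ => rfl, fun _ _ => rfl, rfl, fun τ hτ => ?_⟩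
    obtain rfl : τ = 0 := Nat.le_zero.1 hτ
    exact ⟨by simp [run, init], by simp [run, init], by simp [run, init], by simp [run, init]⟩
  obtain ⟨s', hQ, hs⟩ := wp_sound P hP h h0
  have hfits : ∀ τ, (run P inp ω τ).Fits R A V D := fun τ => by
    rcases Nat.le_total τ s'.time with h' | h'
    · exact hs.fits τ h'
    · rw [run_of_halted hs.code h']; exact hs.fits _ le_rfl
  refine ⟨s', hQ, hs.code, hs.out, ?_, iSup_le fun τ => Nat.cast_le.2 (space_le_of_fits (hfits τ))⟩
  unfold time
  rw [tsum_eq_sum (s := Finset.range s'.time) fun τ hτ => ?_]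
  · rw [← Nat.cast_sum, Nat.cast_le]
    refine (Finset.sum_le_card_nsmul _ _ _ fun τ _ =>
      cost_le_of_fits (hfits τ) (b := ω τ) (hfits (τ + 1))).trans ?_
    simp
  · rw [run_of_halted hs.code (by simpa using hτ), cost, hs.code, Nat.cast_zero]

end
end RAM
end

/-! ### Ranking of subsets, separating moduli and balanced partitions. -/

noncomputable section

namespace SubsetSum

/-- The `r`-th subset of `{0, …, i - 1}` with `o` elements. -/
def unrank : ℕ → ℕ → ℕ → Finset ℕ
  | 0, _, _ => ∅
  | i + 1, o, r =>
    if r < i.choose o then unrank i o r else insert i (unrank i (o - 1) (r - i.choose o))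

theorem unrank_subset (i o r : ℕ) : unrank i o r ⊆ Finset.range i := by
  induction i generalizing o r with
  | zero => simp [unrank]
  | succ i ih =>
    rw [unrank, Finset.range_add_one]
    split_ifs
    · exact (ih _ _).trans (Finset.subset_insert _ _)
    · exact Finset.insert_subset_insert _ (ih _ _)

theorem notMem_unrank (i o r : ℕ) : i ∉ unrank i o r := fun h => by
  simpa using unrank_subset i o r h

/-- Pascal's rule: the ranks not used by the subsets without the last element count those that
contain it. -/
theorem unrank_rank_lt {i o r : ℕ} (h : r < (i + 1).choose o) (h' : ¬ r < i.choose o) :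
    0 < o ∧ r - i.choose o < i.choose (o - 1) := by
  cases o with
  | zero => simp at h h'; omega
  | succ o => rw [Nat.choose_succ_succ'] at h; simp only [Nat.add_sub_cancel]; omega

theorem card_unrank {i o r : ℕ} (h : r < i.choose o) : (unrank i o r).card = o := by
  induction i generalizing o r with
  | zero => cases o <;> simp_all [unrank]
  | succ i ih =>
    rw [unrank]
    split_ifs with h'
    · exact ih h'
    · obtain ⟨h1, h2⟩ := unrank_rank_lt h h'
      rw [Finset.card_insert_of_notMem (notMem_unrank _ _ _), ih h2]
      omega

theorem exists_unrank {i o : ℕ} {X : Finset ℕ} (hX : X ⊆ Finset.range i) (ho : X.card = o) :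
    ∃ r < i.choose o, unrank i o r = X := by
  induction i generalizing o X with
  | zero =>
    obtain rfl : X = ∅ := by simpa using hX
    subst ho
    exact ⟨0, by simp, rfl⟩
  | succ i ih =>
    by_cases hi : i ∈ X
    · obtain ⟨r, hr, h⟩ := ih (o := o - 1) (X := X.erase i)
        (fun a ha => by
          have := hX (Finset.mem_of_mem_erase ha)
          have := Finset.ne_of_mem_erase ha
          simp_all; omega)
        (by rw [Finset.card_erase_of_mem hi, ho])
      have ho' : 0 < o := ho ▸ Finset.card_pos.2 ⟨i, hi⟩
      obtain ⟨o, rfl⟩ : ∃ o', o = o' + 1 := ⟨o - 1, by omega⟩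
      refine ⟨i.choose (o + 1) + r, ?_, ?_⟩
      · rw [Nat.choose_succ_succ']; simp only [Nat.add_sub_cancel] at hr; omega
      · rw [unrank, if_neg (by omega), Nat.add_sub_cancel_left, h, Finset.insert_erase hi]
    · obtain ⟨r, hr, h⟩ := ih (o := o) (X := X)
        (fun a ha => by
          have := hX ha
          have : a ≠ i := fun h => hi (h ▸ ha)
          simp_all; omega) ho
      refine ⟨r, hr.trans_le (Nat.choose_le_choose _ (Nat.le_succ _)), ?_⟩
      rw [unrank, if_pos hr, h]

/-- Double induction with Pascal's rule. With a = w and b = N - w it shows that the table of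
binomial coefficients and the list of groups have size O(S). -/
theorem mul_add_one_le_choose (a b : ℕ) : a * b + 1 ≤ (a + b).choose a := by
  induction a generalizing b with
  | zero => simp
  | succ a iha =>
    induction b with
    | zero => simp
    | succ b ihb =>
      have h1 := iha (b + 1)
      have h2 : (a + 1 + (b + 1)).choose (a + 1) =
          (a + (b + 1)).choose a + (a + 1 + b).choose (a + 1) := by
        rw [show a + 1 + (b + 1) = (a + (b + 1)) + 1 by ring, Nat.choose_succ_succ',
          show a + (b + 1) = a + 1 + b by ring]
      rw [h2]
      nlinarith

/-- Reduces to C(2k, k) ≥ 2^k, where consecutive central binomial coefficients have ratio 2(2k +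
1)/(k + 1) ≥ 2. -/
theorem two_pow_le_choose {n k : ℕ} (h : 2 * k ≤ n) : 2 ^ k ≤ n.choose k := by
  refine le_trans ?_ (Nat.choose_le_choose k h)
  clear h
  rw [← Nat.centralBinom_eq_two_mul_choose]
  induction k with
  | zero => simp
  | succ k ih =>
    have := Nat.succ_mul_centralBinom_succ k
    have h2 : (k + 1) * 2 ^ (k + 1) ≤ (k + 1) * (k + 1).centralBinom := by
      rw [this, pow_succ]; nlinarith
    exact Nat.le_of_mul_le_mul_left h2 (Nat.succ_pos _)

theorem two_pow_min_le_choose {n k : ℕ} (h : k ≤ n) : 2 ^ min k (n - k) ≤ n.choose k := by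
  rcases Nat.le_total k (n - k) with h' | h'
  · rw [min_eq_left h']; exact two_pow_le_choose (by omega)
  · rw [min_eq_right h', ← Nat.choose_symm h]; exact two_pow_le_choose (by omega)

/-- The distinct prime factors are at least 2 each, and their product divides `d`. -/
theorem card_primeFactors_lt {d L : ℕ} (h0 : d ≠ 0) (h : d < 2 ^ L) : d.primeFactors.card ≤ L := by
  have h1 : 2 ^ d.primeFactors.card ≤ ∏ p ∈ d.primeFactors, p :=
    Finset.pow_card_le_prod _ _ _ fun p hp => (Nat.prime_of_mem_primeFactors hp).two_le
  have h2 := Nat.le_of_dvd (Nat.pos_of_ne_zero h0) (Nat.prod_primeFactors_dvd d)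
  exact ((Nat.pow_lt_pow_iff_right one_lt_two).1 ((h1.trans h2).trans_lt h)).le

/-- A weak form of Chebyshev's lower bound for the number of primes. -/
theorem two_pow_lt_card_primes (s : ℕ) (hs : 3 ≤ s) :
    2 ^ s < s * (((Finset.range (2 ^ s + 1)).filter Nat.Prime).card + 1) := by
  obtain ⟨t, rfl⟩ : ∃ t, s = t + 1 := ⟨s - 1, by omega⟩
  set n := 2 ^ t with hn
  have h2n : 2 ^ (t + 1) = 2 * n := by rw [pow_succ]; ring
  have hn4 : 4 ≤ n := by
    calc 4 = 2 ^ 2 := rfl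
      _ ≤ 2 ^ t := Nat.pow_le_pow_right (by norm_num) (by omega)
  have h1 := Nat.four_pow_lt_mul_centralBinom n hn4
  rw [h2n]
  set π := ((Finset.range (2 * n + 1)).filter Nat.Prime).card
  -- Every prime power that exactly divides C(2n, n) is at most 2n, so C(2n, n) has at most one
  -- factor 2n per prime.
  have h3 : n.centralBinom ≤ (2 * n) ^ π := by
    rw [← Nat.prod_pow_factorization_centralBinom, ← Finset.prod_filter_of_ne (p := Nat.Prime)]
    · refine (Finset.prod_le_pow_card _ _ (2 * n) fun p _ => ?_)
      rw [Nat.centralBinom_eq_two_mul_choose]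
      exact Nat.pow_factorization_choose_le (by omega)
    · intro p _ h
      by_contra hp
      exact h (by rw [Nat.factorization_eq_zero_of_not_prime _ hp, pow_zero])
  have h4 : 4 ^ n < 2 ^ ((t + 1) * (π + 1)) := by
    refine h1.trans_le ((Nat.mul_le_mul_left n h3).trans ?_)
    rw [← h2n, ← pow_mul, hn, ← pow_add]
    exact Nat.pow_le_pow_right (by norm_num) (by nlinarith)
  rw [show 4 = 2 ^ 2 from rfl, ← pow_mul] at h4
  exact (Nat.pow_lt_pow_iff_right one_lt_two).1 h4

/-- Few numbers below `2 ^ L` have distinct residues modulo some small number. -/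
theorem exists_separating {M : Finset ℕ} {L : ℕ} (hN : ∀ i ∈ M, i < 2 ^ L)
    (hM : M.card ≤ 4 * L) : ∃ q, 0 < q ∧ q ≤ 2 ^ (12 + 4 * L.size) ∧
      ∀ i ∈ M, ∀ j ∈ M, i % q = j % q → i = j := by
  by_contra! hcon
  set s := 12 + 4 * L.size
  -- If no modulus separates, every prime up to 2^s divides a nonzero difference. There are at most
  -- (4L)² differences with at most L prime factors each. Pairs in the wrong order have truncated
  -- difference 0 and contribute no primes.
  have hsub : (Finset.range (2 ^ s + 1)).filter Nat.Prime ⊆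
      (M ×ˢ M).biUnion fun x => (x.2 - x.1).primeFactors := by
    intro p hp
    obtain ⟨h1, h2⟩ := Finset.mem_filter.1 hp
    obtain ⟨i, hi, j, hj, hij, hne⟩ := hcon p h2.pos (by simpa [Nat.lt_succ_iff] using h1)
    rw [Finset.mem_biUnion]
    rcases Nat.lt_or_gt_of_ne hne with h | h
    · refine ⟨(i, j), Finset.mem_product.2 ⟨hi, hj⟩, Nat.mem_primeFactors.2 ⟨h2, ?_, ?_⟩⟩
      · exact (Nat.modEq_iff_dvd' h.le).1 hij
      · simp only; omega
    · refine ⟨(j, i), Finset.mem_product.2 ⟨hj, hi⟩, Nat.mem_primeFactors.2 ⟨h2, ?_, ?_⟩⟩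
      · exact (Nat.modEq_iff_dvd' h.le).1 hij.symm
      · simp only; omega
  have hcard : ((Finset.range (2 ^ s + 1)).filter Nat.Prime).card ≤ (4 * L) * (4 * L) * L := by
    refine (Finset.card_le_card hsub).trans (Finset.card_biUnion_le.trans ?_)
    refine (Finset.sum_le_card_nsmul _ _ L fun x hx => ?_).trans ?_
    · rcases Nat.eq_zero_or_pos (x.2 - x.1) with h | h
      · simp [h]
      · exact card_primeFactors_lt h.ne'
          ((Nat.sub_le _ _).trans_lt (hN _ (Finset.mem_product.1 hx).2))
    · rw [smul_eq_mul, Finset.card_product]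
      exact Nat.mul_le_mul_right _ (Nat.mul_le_mul hM hM)
  have hlow := two_pow_lt_card_primes s (by omega)
  have hL : L < 2 ^ L.size := Nat.lt_size_self L
  set y := 2 ^ L.size
  -- The choice of `s` makes 2^s = 4096 y⁴ beat s · (π + 1) ≤ 16y · 17y³, which contradicts
  -- Chebyshev's bound.
  have hs2 : 2 ^ s = 4096 * y ^ 4 := by
    simp only [s, y, pow_add, ← pow_mul]; rw [mul_comm 4]; norm_num
  have hσ : L.size < y := Nat.lt_two_pow_self
  have h1 : s ≤ 16 * y := by omega
  have h2 : ((Finset.range (2 ^ s + 1)).filter Nat.Prime).card + 1 ≤ 17 * y ^ 3 := by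
    have : L ^ 3 ≤ y ^ 3 := Nat.pow_le_pow_left hL.le 3
    have h1y : 1 ≤ y ^ 3 := Nat.one_le_pow _ _ (by omega)
    nlinarith
  have h3 := Nat.mul_le_mul h1 h2
  have h4 : 0 < y ^ 4 := by positivity
  nlinarith

/-- The endpoint values lie on opposite sides of `c` (or equal it), and steps of size at most one
cannot jump over `c`. -/
theorem exists_eq_of_step_le_one {f : ℕ → ℕ} {M c : ℕ} (h : f 0 + f M = 2 * c)
    (h1 : ∀ k < M, f (k + 1) ≤ f k + 1) (h2 : ∀ k < M, f k ≤ f (k + 1) + 1) :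
    ∃ k ≤ M, f k = c := by
  by_contra! hne
  rcases Nat.lt_or_ge c (f 0) with h0 | h0
  · have : ∀ k ≤ M, c < f k := by
      intro k
      induction k with
      | zero => exact fun _ => h0
      | succ k ih =>
        intro hk
        have := ih (by omega); have := h2 k (by omega); have := hne (k + 1) hk
        omega
    have := this M le_rfl
    omega
  · have : ∀ k ≤ M, f k < c := by
      intro k
      induction k with
      | zero => intro _; have := hne 0 (by omega); omega
      | succ k ih =>
        intro hk
        have := ih (by omega); have := h1 k (by omega); have := hne (k + 1) hk
        omega
    have := this M le_rfl
    omega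

/-- Applied to the weights of the groups before and after a threshold moves by one: only one group
may change. -/
theorem sum_le_sum_add_one {N : ℕ} {a b : ℕ → ℕ} (h1 : ∀ i < N, a i ≤ b i + 1)
    (h2 : ∀ i < N, ∀ j < N, a i ≠ b i → a j ≠ b j → i = j) :
    ∑ i ∈ Finset.range N, a i ≤ ∑ i ∈ Finset.range N, b i + 1 := by
  by_cases h : ∃ i < N, a i ≠ b i
  · obtain ⟨i, hi, hne⟩ := h
    have hi' := Finset.mem_range.2 hi
    rw [← Finset.add_sum_erase _ a hi', ← Finset.add_sum_erase _ b hi']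
    have : ∑ j ∈ (Finset.range N).erase i, a j = ∑ j ∈ (Finset.range N).erase i, b j := by
      refine Finset.sum_congr rfl fun j hj => ?_
      obtain ⟨hj1, hj2⟩ := Finset.mem_erase.1 hj
      by_contra hj'
      exact hj1 (h2 j (Finset.mem_range.1 hj2) i hi hj' hne)
    have := h1 i hi
    omega
  · push Not at h
    exact (Finset.sum_congr rfl fun i hi => h i (Finset.mem_range.1 hi)).le.trans (Nat.le_succ _)

/-- The offset within a group of four of the member of the part `(h, u)`, where `r` is the residue
of the number of the group. -/
def offset (k kh h u r : ℕ) : ℕ :=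
  2 * (if r < kh then 1 - u else u) +
    if 2 * r + (if r < kh then 1 - u else u) < k then 1 - h else h

/-- The `i`-th element of the part `(h, u)`: the parts contain one element each of
every group `{4 * i, …, 4 * i + 3}`. -/
def partElem (q k kh h u i : ℕ) : ℕ := 4 * i + offset k kh h u (i % q)

theorem offset_lt {h u : ℕ} (hh : h < 2) (hu : u < 2) (k kh r : ℕ) : offset k kh h u r < 4 := by
  unfold offset; split_ifs <;> omega

theorem sum_range_four_mul (f : ℕ → ℕ) (N : ℕ) : ∑ e ∈ Finset.range (4 * N), f e =
    ∑ i ∈ Finset.range N, (f (4 * i) + f (4 * i + 1) + f (4 * i + 2) + f (4 * i + 3)) := by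
  induction N with
  | zero => simp
  | succ N ih =>
    rw [Finset.sum_range_succ, ← ih, show 4 * (N + 1) = 4 * N + 1 + 1 + 1 + 1 by ring]
    simp only [Finset.sum_range_succ]
    ring

open Classical in
/-- The groups of four on which `x` is not constant. -/
def mixed (N : ℕ) (x : ℕ → ℕ) : Finset ℕ :=
  (Finset.range N).filter fun i => ∃ a < 4, ∃ b < 4, x (4 * i + a) ≠ x (4 * i + b)

theorem mem_mixed {N i : ℕ} {x : ℕ → ℕ} :
    i ∈ mixed N x ↔ i < N ∧ ∃ a < 4, ∃ b < 4, x (4 * i + a) ≠ x (4 * i + b) := by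
  simp [mixed]

open Classical in
-- A mixed group contains at least one 1 and at least one 0.
theorem card_mixed_le {N w : ℕ} {x : ℕ → ℕ} (hx : ∀ e, x e ≤ 1)
    (hw : ∑ e ∈ Finset.range (4 * N), x e = 4 * w) :
    (mixed N x).card ≤ 4 * w ∧ (mixed N x).card + 4 * w ≤ 4 * N := by
  have hm : (mixed N x).card =
      ∑ i ∈ Finset.range N, if ∃ a < 4, ∃ b < 4, x (4 * i + a) ≠ x (4 * i + b) then 1 else 0 := by
    rw [mixed, Finset.card_filter]
  rw [sum_range_four_mul] at hw
  have key : ∀ i, (∃ a < 4, ∃ b < 4, x (4 * i + a) ≠ x (4 * i + b)) →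
      1 ≤ x (4 * i) + x (4 * i + 1) + x (4 * i + 2) + x (4 * i + 3) ∧
      x (4 * i) + x (4 * i + 1) + x (4 * i + 2) + x (4 * i + 3) ≤ 3 := by
    rintro i ⟨a, ha, b, hb, hab⟩
    have h0 := hx (4 * i); have h1 := hx (4 * i + 1); have h2 := hx (4 * i + 2)
    have h3 := hx (4 * i + 3)
    interval_cases a <;> interval_cases b <;> (try simp only [add_zero] at hab) <;> omega
  constructor
  · rw [hm, ← hw]
    refine Finset.sum_le_sum fun i _ => ?_
    split_ifs with h
    · exact (key i h).1
    · exact Nat.zero_le _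
  · rw [hm, ← hw, ← Finset.sum_add_distrib]
    refine (Finset.sum_le_card_nsmul _ _ 4 fun i _ => ?_).trans (by simp [mul_comm])
    split_ifs with h
    · have := (key i h).2; omega
    · have h0 := hx (4 * i); have h1 := hx (4 * i + 1); have h2 := hx (4 * i + 2)
      have h3 := hx (4 * i + 3)
      omega

/-- A group consists of the pairs {0, 1} and {2, 3}. Each half `h` takes one element of either pair,
chosen by comparing the pair's number 2r + v with `k`; within a half, the threshold k₀ or k₁ decides
which quarter `u` gets which pair. A unit step of a threshold affects only one residue class of
groups, hence by `hsep` at most one mixed group. So the intermediate value principle applies first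
to `k` and then to k₀ and k₁ separately. -/
theorem exists_balanced {N w q : ℕ} {x : ℕ → ℕ} (hx : ∀ e, x e ≤ 1)
    (hw : ∑ e ∈ Finset.range (4 * N), x e = 4 * w) (hq : 0 < q)
    (hsep : ∀ i ∈ mixed N x, ∀ j ∈ mixed N x, i % q = j % q → i = j) :
    ∃ k ≤ 2 * q, ∃ k₀ ≤ q, ∃ k₁ ≤ q, ∀ h < 2, ∀ u < 2,
      ∑ i ∈ Finset.range N, x (partElem q k (if h = 0 then k₀ else k₁) h u i) = w := by
  have hmix : ∀ i < N, ∀ a < 4, ∀ b < 4, x (4 * i + a) ≠ x (4 * i + b) → i ∈ mixed N x :=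
    fun i hi a ha b hb h => mem_mixed.2 ⟨hi, a, ha, b, hb, h⟩
  have hr : ∀ i, i % q < q := fun i => Nat.mod_lt i hq
  rw [sum_range_four_mul] at hw
  -- `F k i` is the weight of `x` on the two elements of group `i` that belong to the half 0.
  let F : ℕ → ℕ → ℕ := fun k i => x (4 * i + if 2 * (i % q) < k then 1 else 0) +
    x (4 * i + (2 + if 2 * (i % q) + 1 < k then 1 else 0))
  have hFne : ∀ k, ∀ i < N, F k i ≠ F (k + 1) i → i ∈ mixed N x ∧ i % q = k / 2 := by
    intro k i hi hne
    simp only [F] at hne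
    have ho : i % q = k / 2 := by
      by_contra hne'
      refine hne ?_
      congr 2 <;> split_ifs <;> omega
    refine ⟨?_, ho⟩
    by_contra hm
    have h1 := fun a ha b hb => not_imp_comm.1 (hmix i hi a ha b hb) hm
    refine hne ?_
    rw [h1 _ (by split_ifs <;> omega) 0 (by omega),
      h1 (if 2 * (i % q) < k + 1 then 1 else 0) (by split_ifs <;> omega) 0 (by omega),
      h1 (2 + if 2 * (i % q) + 1 < k then 1 else 0) (by split_ifs <;> omega) 0 (by omega),
      h1 (2 + if 2 * (i % q) + 1 < k + 1 then 1 else 0) (by split_ifs <;> omega) 0 (by omega)]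
  have hFstep : ∀ k i, F k i ≤ F (k + 1) i + 1 ∧ F (k + 1) i ≤ F k i + 1 := by
    intro k i
    simp only [F]
    have h0 := hx (4 * i); have h1 := hx (4 * i + 1); have h2 := hx (4 * i + 2)
    have h3 := hx (4 * i + 3)
    split_ifs <;> simp only [add_zero, Nat.reduceAdd] <;> omega
  -- For k = 2q all pairs are flipped compared with k = 0, so the two extreme weights of the half
  -- add up to the total 4w.
  obtain ⟨k, hk, hFk⟩ := exists_eq_of_step_le_one (M := 2 * q) (c := 2 * w)
    (f := fun k => ∑ i ∈ Finset.range N, F k i)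
    (by
      rw [← Finset.sum_add_distrib, show 2 * (2 * w) = 4 * w by ring, ← hw]
      refine Finset.sum_congr rfl fun i _ => ?_
      have := hr i
      simp only [F]
      rw [if_neg (by omega), if_neg (by omega), if_pos (by omega), if_pos (by omega)]
      simp only [add_zero, Nat.reduceAdd]
      ring)
    (fun k _ => sum_le_sum_add_one (fun i _ => (hFstep k i).2) fun i hi j hj h1 h2 => by
      have h1' := hFne k i hi h1.symm; have h2' := hFne k j hj h2.symm
      exact hsep i h1'.1 j h2'.1 (h1'.2.trans h2'.2.symm))
    (fun k _ => sum_le_sum_add_one (fun i _ => (hFstep k i).1) fun i hi j hj h1 h2 => by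
      have h1' := hFne k i hi h1; have h2' := hFne k j hj h2
      exact hsep i h1'.1 j h2'.1 (h1'.2.trans h2'.2.symm))
  -- The second threshold only exchanges the quarters of a half and does not affect their total.
  have hhalf : ∀ h < 2, ∀ k', ∑ i ∈ Finset.range N, x (partElem q k k' h 0 i) +
      ∑ i ∈ Finset.range N, x (partElem q k k' h 1 i) = 2 * w := by
    intro h hh k'
    have h0 : ∑ i ∈ Finset.range N, x (partElem q k k' 0 0 i) +
        ∑ i ∈ Finset.range N, x (partElem q k k' 0 1 i) = 2 * w := by
      rw [← hFk, ← Finset.sum_add_distrib]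
      refine Finset.sum_congr rfl fun i _ => ?_
      simp only [F, partElem, offset]
      by_cases h1 : i % q < k' <;> by_cases h2 : 2 * (i % q) < k <;>
        by_cases h3 : 2 * (i % q) + 1 < k <;> simp [h1, h2, add_comm]
    have h1 : (∑ i ∈ Finset.range N, x (partElem q k k' 0 0 i) +
        ∑ i ∈ Finset.range N, x (partElem q k k' 0 1 i)) +
        (∑ i ∈ Finset.range N, x (partElem q k k' 1 0 i) +
        ∑ i ∈ Finset.range N, x (partElem q k k' 1 1 i)) = 4 * w := by
      rw [← hw, ← Finset.sum_add_distrib, ← Finset.sum_add_distrib, ← Finset.sum_add_distrib]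
      refine Finset.sum_congr rfl fun i _ => ?_
      simp only [partElem, offset]
      by_cases h1 : i % q < k' <;> by_cases h2 : 2 * (i % q) < k <;>
        by_cases h3 : 2 * (i % q) + 1 < k <;> simp [h1, h2, h3] <;> ring
    interval_cases h <;> omega
  -- Moving the threshold from 0 to `q` turns the quarter u = 0 into the quarter u = 1, and both
  -- together have weight 2w.
  have hquart : ∀ h < 2, ∃ k' ≤ q, ∑ i ∈ Finset.range N, x (partElem q k k' h 0 i) = w := by
    intro h hh
    have hGne : ∀ k', ∀ i < N, x (partElem q k k' h 0 i) ≠ x (partElem q k (k' + 1) h 0 i) →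
        i ∈ mixed N x ∧ i % q = k' := by
      intro k' i hi hne
      refine ⟨hmix i hi _ (offset_lt hh (by omega) _ _ _) _ (offset_lt hh (by omega) _ _ _) hne, ?_⟩
      by_contra hne'
      refine hne ?_
      have : (i % q < k') ↔ (i % q < k' + 1) := by omega
      simp only [partElem, offset, this]
    refine exists_eq_of_step_le_one (M := q) (c := w)
      (f := fun k' => ∑ i ∈ Finset.range N, x (partElem q k k' h 0 i)) ?_
      (fun k' _ => sum_le_sum_add_one (fun i _ => by
        have := hx (partElem q k (k' + 1) h 0 i); omega) fun i hi j hj h1 h2 => by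
        have h1' := hGne k' i hi h1.symm; have h2' := hGne k' j hj h2.symm
        exact hsep i h1'.1 j h2'.1 (h1'.2.trans h2'.2.symm))
      (fun k' _ => sum_le_sum_add_one (fun i _ => by
        have := hx (partElem q k k' h 0 i); omega) fun i hi j hj h1 h2 => by
        have h1' := hGne k' i hi h1; have h2' := hGne k' j hj h2
        exact hsep i h1'.1 j h2'.1 (h1'.2.trans h2'.2.symm))
    rw [← hhalf h hh 0]
    congr 1
    refine Finset.sum_congr rfl fun i _ => ?_
    have := hr i
    simp only [partElem, offset]
    rw [if_pos this, if_neg (Nat.not_lt_zero _)]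
  obtain ⟨k₀, hk₀, h0⟩ := hquart 0 (by omega)
  obtain ⟨k₁, hk₁, h1⟩ := hquart 1 (by omega)
  refine ⟨k, hk, k₀, hk₀, k₁, hk₁, fun h hh u hu => ?_⟩
  have h0' := hhalf 0 (by omega) k₀
  have h1' := hhalf 1 (by omega) k₁
  interval_cases h <;> interval_cases u <;> simp <;> omega

/-- Every bit vector is balanced by a splitter from a family of size polynomial in `L`. -/
theorem exists_splitter {N w L : ℕ} {x : ℕ → ℕ} (hwN : w < N) (hw0 : 0 < w)
    (hL : N.choose w < 2 ^ L) (hx : ∀ e, x e ≤ 1)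
    (hw : ∑ e ∈ Finset.range (4 * N), x e = 4 * w) :
    ∃ q, 0 < q ∧ q ≤ 2 ^ (12 + 4 * L.size) ∧ ∃ k ≤ 2 * q, ∃ k₀ ≤ q, ∃ k₁ ≤ q,
      ∀ h < 2, ∀ u < 2,
      ∑ i ∈ Finset.range N, x (partElem q k (if h = 0 then k₀ else k₁) h u i) = w := by
  have h1 := card_mixed_le hx hw
  have h2 := two_pow_min_le_choose hwN.le
  -- This keeps the number of mixed groups below 4L, a quantity logarithmic in C(N, w).
  have h3 : min w (N - w) < L := (Nat.pow_lt_pow_iff_right one_lt_two).1 (h2.trans_lt hL)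
  have h4 : N ≤ N.choose w := by
    have := mul_add_one_le_choose w (N - w)
    rw [Nat.add_sub_cancel' hwN.le] at this
    obtain ⟨d, hd⟩ : ∃ d, N - w = d + 1 := ⟨N - w - 1, by omega⟩
    obtain ⟨v, rfl⟩ : ∃ v, w = v + 1 := ⟨w - 1, by omega⟩
    rw [hd] at this
    have h5 : N = v + d + 2 := by omega
    have h6 : v + d + 2 ≤ (v + 1) * (d + 1) + 1 := by nlinarith [Nat.zero_le (v * d)]
    omega
  obtain ⟨q, hq, hq', hsep⟩ := exists_separating (M := mixed N x) (L := L)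
    (fun i hi => (mem_mixed.1 hi).1.trans (h4.trans_lt hL)) (by omega)
  exact ⟨q, hq, hq', exists_balanced hx hw hq hsep⟩

end SubsetSum
end

/-! ### The setting of the search, and the computation of a subset from its rank. -/

noncomputable section

namespace SubsetSum

open RAM

/-- The data on which the main part of the program works: lists `E` of `N` input addresses are
searched for `w` addresses each. `V` and `D` bound values and addresses. -/
structure Ctx where
  inp : ℕ → ℕ
  N : ℕ
  w : ℕ
  t : ℕ
  B : ℕ
  Q : ℕ
  V : ℕ
  D : ℕ
  w_pos : 0 < w
  w_lt : w < N
  sum_inp : ∑ e ∈ Finset.range (4 * N), inp (e + 3) = B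
  le_V : 8 * B + t + 8 * N.choose w + 8 * Q + 8 ≤ V
  le_D : 8 * N.choose w + 8 ≤ D

namespace Ctx

variable (Γ : Ctx)

/-- The number of subsets of a part. -/
def S : ℕ := Γ.N.choose Γ.w

theorem le_V' : 8 * Γ.B + Γ.t + 8 * Γ.S + 8 * Γ.Q + 8 ≤ Γ.V := Γ.le_V

theorem le_D' : 8 * Γ.S + 8 ≤ Γ.D := Γ.le_D

theorem mul_lt_S : Γ.w * (Γ.N - Γ.w) < Γ.S := by
  have := mul_add_one_le_choose Γ.w (Γ.N - Γ.w)
  rwa [Nat.add_sub_cancel' Γ.w_lt.le] at this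

theorem N_le_S : Γ.N ≤ Γ.S := by
  have h := Γ.mul_lt_S
  have h1 := Γ.w_pos
  have h2 := Γ.w_lt
  obtain ⟨d, hd⟩ : ∃ d, Γ.N = Γ.w + d + 1 := ⟨Γ.N - Γ.w - 1, by omega⟩
  obtain ⟨v, hv⟩ : ∃ v, Γ.w = v + 1 := ⟨Γ.w - 1, by omega⟩
  rw [show Γ.N - Γ.w = d + 1 by omega, hv] at h
  have h6 : v + d + 2 ≤ (v + 1) * (d + 1) + 1 := by nlinarith [Nat.zero_le (v * d)]
  omega

theorem S_pos : 0 < Γ.S := Nat.choose_pos Γ.w_lt.le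

/-- The constant registers and the table of binomial coefficients have been set up. -/
structure Ready (s : St) : Prop where
  r0 : s.reg 0 = 4 * Γ.N
  r2 : s.reg 2 = Γ.t
  r3 : s.reg 3 = 1
  r4 : s.reg 4 = Γ.B
  r5 : s.reg 5 = Γ.N
  r7 : s.reg 7 = Γ.w + 1
  r8 : s.reg 8 = Γ.S
  r9 : s.reg 9 = 2 * Γ.B + 1
  r10 : s.reg 10 = 2 * Γ.B
  r11 : s.reg 11 = Γ.Q
  r18 : s.reg 18 = (Γ.N - Γ.w) * (Γ.w + 1) + Γ.w
  r19 : s.reg 19 = 0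
  table : ∀ z ≤ Γ.N - Γ.w, ∀ o ≤ Γ.w, 0 < z + o →
    s.mem 14 (z * (Γ.w + 1) + o) = if z = 0 then 0 else (z + o - 1).choose o

/-- Whether a program leaves the constant registers and the table alone. -/
def keeps (p : Cmd) : Bool :=
  [0, 2, 3, 4, 5, 7, 8, 9, 10, 11, 18, 19].all (fun r => !p.writes r) && !p.stores 14

variable {Γ}

theorem Ready.congr {s s' : St} (h : Γ.Ready s)
    (hr : ∀ r ∈ [0, 2, 3, 4, 5, 7, 8, 9, 10, 11, 18, 19], s'.reg r = s.reg r)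
    (hm : s'.mem 14 = s.mem 14) : Γ.Ready s' := by
  simp only [List.forall_mem_cons] at hr
  obtain ⟨h0, h2, h3, h4, h5, h7, h8, h9, h10, h11, h18, h19, -⟩ := hr
  constructor
  · rw [h0, h.r0]
  · rw [h2, h.r2]
  · rw [h3, h.r3]
  · rw [h4, h.r4]
  · rw [h5, h.r5]
  · rw [h7, h.r7]
  · rw [h8, h.r8]
  · rw [h9, h.r9]
  · rw [h10, h.r10]
  · rw [h11, h.r11]
  · rw [h18, h.r18]
  · rw [h19, h.r19]
  · rw [hm]; exact h.table

theorem Ready.frame {s s' : St} {p : Cmd} (h : Γ.Ready s) (hf : Frame p s s')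
    (hp : keeps p = true) : Γ.Ready s' := by
  simp only [keeps, Bool.and_eq_true, Bool.not_eq_true', List.all_eq_true] at hp
  exact h.congr (fun r hr => hf.reg r (hp.1 r hr)) (hf.mem _ hp.2)

/-- A variant of `Ready.frame` for a program that starts after a change of other registers. -/
theorem Ready.of_frame {s₀ s s' : St} {p : Cmd} (h : Γ.Ready s₀) (hf : Frame p s s')
    (hr : ∀ r ∈ [0, 2, 3, 4, 5, 7, 8, 9, 10, 11, 18, 19], s.reg r = s₀.reg r)
    (hm : s.mem 14 = s₀.mem 14) (hp : keeps p = true) : Γ.Ready s' :=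
  (h.congr hr hm).frame hf hp

variable (Γ)

/-- `E` lists `N` different input addresses. -/
structure IsPart (E : ℕ → ℕ) : Prop where
  inj : ∀ i < Γ.N, ∀ j < Γ.N, E i = E j → i = j
  mem : ∀ i < Γ.N, 3 ≤ E i ∧ E i < 4 * Γ.N + 3

variable {Γ}

theorem IsPart.le_D {E : ℕ → ℕ} (h : Γ.IsPart E) {i : ℕ} (hi : i < Γ.N) : E i ≤ Γ.D := by
  have := (h.mem i hi).2
  have := Γ.N_le_S
  have := Γ.le_D'
  omega

/-- Distinct addresses pick distinct input numbers. Hence all subset sums are at most `B`, and the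
complements B - sum are not truncated. -/
theorem IsPart.sum_le {E : ℕ → ℕ} (h : Γ.IsPart E) {X : Finset ℕ} (hX : X ⊆ Finset.range Γ.N) :
    ∑ i ∈ X, Γ.inp (E i) ≤ Γ.B := by
  rw [← Γ.sum_inp]
  have hinj : Set.InjOn (fun i => E i - 3) X := fun i hi j hj hij => by
    have h1 := Finset.mem_range.1 (hX hi)
    have h2 := Finset.mem_range.1 (hX hj)
    have h3 := h.mem i h1
    have h4 := h.mem j h2
    exact h.inj i h1 j h2 (by simp only at hij; omega)
  calc ∑ i ∈ X, Γ.inp (E i) = ∑ i ∈ X, (fun e => Γ.inp (e + 3)) (E i - 3) :=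
        Finset.sum_congr rfl fun i hi => by
          have := h.mem i (Finset.mem_range.1 (hX hi))
          simp only; congr 1; omega
    _ = ∑ e ∈ X.image fun i => E i - 3, Γ.inp (e + 3) :=
        (Finset.sum_image (f := fun e => Γ.inp (e + 3)) hinj).symm
    _ ≤ _ := Finset.sum_le_sum_of_subset fun e he => by
        obtain ⟨i, hi, rfl⟩ := Finset.mem_image.1 he
        have := h.mem i (Finset.mem_range.1 (hX hi))
        rw [Finset.mem_range]; omega

end Ctx

/-- Writes the subset with the rank in register 20 of the addresses in array `kE` into array 15
as a bit vector and computes the sum of its inputs in register 23. -/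
def unrankCmd (kE : ℕ) : Cmd :=
  .add 21 5 19 ;; .add 22 18 19 ;; .const 23 0 ;;
  .whilenz 21 (
    .sub 21 21 3 ;; .load 24 kE 21 ;; .load 25 14 22 ;; .add 26 20 3 ;; .sub 26 26 25 ;;
    .ifnz 26
      (.sub 20 20 25 ;; .input 27 24 ;; .add 23 23 27 ;; .store 15 24 3 ;; .sub 22 22 3)
      (.store 15 24 19 ;; .sub 22 22 7))

/-- The state of the descent is (z, o), the numbers of elements still to be left out and to be
taken. Its table address z(w + 1) + o drops by w + 1 or by 1, so no multiplication is needed.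
Indexing the table by (z, o) keeps it at O(S) cells; a triangle with N full rows can be larger than
S, for instance if w = N - 1. -/
theorem wp_unrankCmd {Γ : Ctx} {s : St} {kE : ℕ} {E : ℕ → ℕ} (hs : Γ.Ready s) (hkE : kE ≠ 15)
    (hE : Γ.IsPart E) (hEs : ∀ i < Γ.N, s.mem kE i = E i) (hr : s.reg 20 < Γ.S) :
    wp Γ.inp Γ.V Γ.D (unrankCmd kE) (fun s' =>
      s'.reg 23 = ∑ i ∈ unrank Γ.N Γ.w (s.reg 20), Γ.inp (E i) ∧
      (∀ i < Γ.N, s'.mem 15 (E i) = if i ∈ unrank Γ.N Γ.w (s.reg 20) then 1 else 0) ∧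
      (∀ a, (∀ i < Γ.N, E i ≠ a) → s'.mem 15 a = s.mem 15 a) ∧
      s'.time ≤ s.time + 40 * Γ.S) s := by
  have hNS := Γ.N_le_S
  have hV := Γ.le_V'
  have hwN := Γ.w_lt
  have hmul := Γ.mul_lt_S
  set full := unrank Γ.N Γ.w (s.reg 20) with hfull
  have hz : (Γ.N - Γ.w) * (Γ.w + 1) + Γ.w ≤ 2 * Γ.S := by
    have : (Γ.N - Γ.w) * (Γ.w + 1) = Γ.w * (Γ.N - Γ.w) + (Γ.N - Γ.w) := by ring
    omega
  simp only [unrankCmd, wp_seq, wp_add, wp_const]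
  simp only [St.tick, Function.update_apply, hs.r5, hs.r18, hs.r19]
  simp
  refine ⟨by omega, by omega, ?_⟩
  refine wp_while (fun s' => ∃ z o, s'.reg 21 = z + o ∧ s'.reg 22 = z * (Γ.w + 1) + o ∧
    z ≤ Γ.N - Γ.w ∧ o ≤ Γ.w ∧ s'.reg 20 < (z + o).choose o ∧ s'.reg 20 ≤ s.reg 20 ∧
    s'.reg 23 + ∑ i ∈ unrank (z + o) o (s'.reg 20), Γ.inp (E i) = ∑ i ∈ full, Γ.inp (E i) ∧
    (∀ i < z + o, i ∈ unrank (z + o) o (s'.reg 20) ↔ i ∈ full) ∧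
    (∀ i < Γ.N, z + o ≤ i → s'.mem 15 (E i) = if i ∈ full then 1 else 0) ∧
    (∀ a, (∀ i < Γ.N, E i ≠ a) → s'.mem 15 a = s.mem 15 a)) (fun s' => s'.reg 21) 30
    ?_ ?_ ?_
  · refine ⟨Γ.N - Γ.w, Γ.w, ?_⟩
    have : Γ.N - Γ.w + Γ.w = Γ.N := by omega
    simp [this, hfull]
    refine ⟨hr, fun i hi h => by omega⟩
  · rintro s' ⟨z, o, h21, h22, hzN, how, hrk, hrk', hsum, hmem, hX, hother⟩ hf hne
    have hs' : Γ.Ready s' :=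
      hs.of_frame hf (by simp) rfl rfl
    have hkE' : s'.mem kE = s.mem kE := hf.mem _ (by simp [Cmd.stores, hkE])
    have h14 : s'.mem 14 = s.mem 14 := hf.mem _ rfl
    have hpos : 0 < z + o := by omega
    have hT := hs.table z hzN o how hpos
    obtain ⟨i, hi⟩ : ∃ i, z + o = i + 1 := ⟨z + o - 1, by omega⟩
    have hiN : i < Γ.N := by omega
    have hEi := hE.le_D hiN
    have hin : Γ.inp (E i) ≤ ∑ j ∈ full, Γ.inp (E j) → Γ.inp (E i) ≤ Γ.B := fun h =>
      h.trans (hE.sum_le (unrank_subset _ _ _))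
    have hfullB : ∑ j ∈ full, Γ.inp (E j) ≤ Γ.B := hE.sum_le (unrank_subset _ _ _)
    have hT' : s.mem 14 (z * (Γ.w + 1) + o) = i.choose o := by
      rw [hT]
      split_ifs with hz0
      · rw [Nat.choose_eq_zero_of_lt]; omega
      · rw [hi, Nat.add_sub_cancel]
    simp only [wp_seq, wp_sub, wp_load, wp_add, wp_ifnz, wp_input, wp_store]
    simp only [St.tick, Function.update_apply]
    simp [hs'.r3, hs'.r7, hs'.r19, hkE', h14, h21, h22, hT', hi, hEs i hiN]
    refine ⟨by omega, ?_⟩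
    rw [hi] at hsum hmem hrk hX
    simp only [unrank] at hsum hmem
    by_cases hlt : s'.reg 20 < i.choose o
    · rw [if_pos (by omega)]
      -- If nothing may be left out any more, the table entry is 0 and the element is taken.
      have hz0 : z ≠ 0 := by
        rintro rfl
        rw [Nat.choose_eq_zero_of_lt (by omega)] at hlt
        omega
      obtain ⟨z, rfl⟩ : ∃ z', z = z' + 1 := ⟨z - 1, by omega⟩
      obtain rfl : i = z + o := by omega
      simp only [if_pos hlt] at hsum hmem
      refine ⟨hEi, z, o, by omega, ?_, by omega, how, hlt, hrk', hsum,
        fun j hj => hmem j (by omega), fun j hj hj' => ?_, fun a ha => ?_⟩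
      · rw [Nat.add_mul]; omega
      · rw [Function.update_apply]
        by_cases hji : j = z + o
        · subst hji
          have := hmem (z + o) (by omega)
          simp only [notMem_unrank, false_iff] at this
          simp [this]
        · rw [if_neg fun h => hji (hE.inj _ hj _ hiN h)]
          exact hX j hj (by omega)
      · rw [Function.update_apply, if_neg (Ne.symm (ha _ hiN))]; exact hother a ha
    · rw [if_neg (by omega)]
      obtain ⟨ho0, hrk2⟩ := unrank_rank_lt hrk hlt
      obtain ⟨o, rfl⟩ : ∃ o', o = o' + 1 := ⟨o - 1, by omega⟩
      obtain rfl : i = z + o := by omega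
      simp only [if_neg hlt, Nat.add_sub_cancel] at hsum hmem hrk2
      rw [Finset.sum_insert (notMem_unrank _ _ _)] at hsum
      refine ⟨by omega, by omega, hEi, z, o, by omega, by omega, hzN, by omega, hrk2, by omega,
        by omega, fun j hj => ?_, fun j hj hj' => ?_, fun a ha => ?_⟩
      · rw [← hmem j (by omega), Finset.mem_insert]
        exact ⟨Or.inr, fun h => h.resolve_left (by omega)⟩
      · rw [Function.update_apply]
        by_cases hji : j = z + o
        · subst hji
          have := hmem (z + o) (by omega)
          simp only [Finset.mem_insert_self, true_iff] at this
          simp [this]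
        · rw [if_neg fun h => hji (hE.inj _ hj _ hiN h)]
          exact hX j hj (by omega)
      · rw [Function.update_apply, if_neg (Ne.symm (ha _ hiN))]; exact hother a ha
  · rintro s' ⟨z, o, h21, h22, hzN, how, hrk, hrk', hsum, hmem, hX, hother⟩ hf h0 ht
    obtain ⟨rfl, rfl⟩ : z = 0 ∧ o = 0 := by omega
    simp [unrank] at hsum hX ht ⊢
    refine ⟨hsum, hX, hother, ?_⟩
    have := Γ.S_pos
    omega

end SubsetSum
end

/-! ### Sorted lists of the keys of a part. -/

noncomputable section

namespace SubsetSum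

open RAM

/-- The key of a subset: the sum of its inputs, or what is missing from it to the sum of all. -/
def Ctx.key (Γ : Ctx) (E : ℕ → ℕ) (neg : Bool) (r : ℕ) : ℕ :=
  if neg then Γ.B - ∑ i ∈ unrank Γ.N Γ.w r, Γ.inp (E i) else ∑ i ∈ unrank Γ.N Γ.w r, Γ.inp (E i)

theorem Ctx.IsPart.key_le {Γ : Ctx} {E : ℕ → ℕ} (hE : Γ.IsPart E) (neg : Bool) (r : ℕ) :
    Γ.key E neg r ≤ Γ.B := by
  have := hE.sum_le (unrank_subset Γ.N Γ.w r)
  unfold Ctx.key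
  split_ifs <;> omega

/-- Replaces the sum in register 23 by a key. -/
def keyCmd (kE : ℕ) (neg : Bool) : Cmd :=
  unrankCmd kE ;; bif neg then .sub 23 4 23 else .skip

theorem wp_keyCmd {Γ : Ctx} {s : St} {kE : ℕ} {E : ℕ → ℕ} (neg : Bool) (hs : Γ.Ready s)
    (hkE : kE ≠ 15) (hE : Γ.IsPart E) (hEs : ∀ i < Γ.N, s.mem kE i = E i)
    (hr : s.reg 20 < Γ.S) :
    wp Γ.inp Γ.V Γ.D (keyCmd kE neg) (fun s' =>
      s'.reg 23 = Γ.key E neg (s.reg 20) ∧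
      (∀ i < Γ.N, s'.mem 15 (E i) = if i ∈ unrank Γ.N Γ.w (s.reg 20) then 1 else 0) ∧
      (∀ a, (∀ i < Γ.N, E i ≠ a) → s'.mem 15 a = s.mem 15 a) ∧
      s'.time ≤ s.time + 42 * Γ.S) s := by
  have hS := Γ.S_pos
  rw [keyCmd, wp_seq]
  refine wp_then (wp_unrankCmd (s := s.tick) (hs.congr (by simp) rfl) hkE hE hEs hr) ?_
  rintro s' ⟨h1, h2, h3, h4⟩ hf
  have h4' : s'.reg 4 = Γ.B := (hf.reg _ rfl).trans hs.r4
  simp only [St.tick_reg, St.tick_mem, St.tick_time] at h1 h2 h3 h4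
  cases neg
  · simp [Ctx.key, h1]
    exact ⟨h2, h3, by omega⟩
  · simp [Ctx.key, h1, h4']
    exact ⟨h2, h3, by omega⟩

/-- The first `len` entries of `L` are sorted, and `P` holds exactly for them. -/
structure IsSortedList (L : ℕ → ℕ) (len : ℕ) (P : ℕ → Prop) : Prop where
  mono : ∀ i j, i ≤ j → j < len → L i ≤ L j
  mem : ∀ v, (∃ i < len, L i = v) ↔ P v

/-- The invariant of the insertion of `key` into the sorted list `L`: the first `j` entries have been
passed, `x` is to be moved on. -/
structure Bubble (L : ℕ → ℕ) (len key j x : ℕ) (L' : ℕ → ℕ) : Prop where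
  mono : ∀ i i', i ≤ i' → i' < j → L' i ≤ L' i'
  le : ∀ i < j, L' i ≤ x
  le_rest : ∀ i < j, ∀ m, j ≤ m → m < len → L' i ≤ L m
  rest : ∀ m, j ≤ m → L' m = L m
  mem : ∀ v, (∃ i < j, L' i = v) ∨ x = v ↔ (∃ i < j, L i = v) ∨ key = v

namespace Bubble

variable {L L' : ℕ → ℕ} {len key j x : ℕ} {P : ℕ → Prop}

theorem init : Bubble L len key 0 key L :=
  ⟨by simp, by simp, by simp, fun _ _ => rfl, by simp⟩

theorem keep (h : Bubble L len key j x L') (hL : ∀ i i', i ≤ i' → i' < len → L i ≤ L i')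
    (hj : j < len) (hx : L j ≤ x) : Bubble L len key (j + 1) x L' := by
  have hj' := h.rest j le_rfl
  refine ⟨fun i i' hi hi' => ?_, fun i hi => ?_, fun i hi m hm hm' => ?_,
    fun m hm => h.rest m (by omega), fun v => ?_⟩
  · rcases Nat.lt_succ_iff_lt_or_eq.1 hi' with h1 | rfl
    · exact h.mono i i' hi h1
    · rcases hi.lt_or_eq with h2 | rfl
      · rw [hj']; exact h.le_rest i h2 _ le_rfl hj
      · exact le_rfl
  · rcases Nat.lt_succ_iff_lt_or_eq.1 hi with h1 | rfl
    · exact h.le i h1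
    · rwa [hj']
  · rcases Nat.lt_succ_iff_lt_or_eq.1 hi with h1 | rfl
    · exact h.le_rest i h1 m (by omega) hm'
    · rw [hj']; exact hL _ _ (by omega) hm'
  · simp only [Nat.exists_lt_succ_right, hj', or_right_comm (c := x = v),
      or_right_comm (c := key = v), h.mem v]

theorem swap (h : Bubble L len key j x L') (hL : ∀ i i', i ≤ i' → i' < len → L i ≤ L i')
    (hj : j < len) (hx : x < L j) :
    Bubble L len key (j + 1) (L j) (Function.update L' j x) := by
  have hlt : ∀ i < j, Function.update L' j x i = L' i := fun i hi =>
    Function.update_of_ne hi.ne _ _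
  have hself : Function.update L' j x j = x := Function.update_self ..
  refine ⟨fun i i' hi hi' => ?_, fun i hi => ?_, fun i hi m hm hm' => ?_, fun m hm => ?_,
    fun v => ?_⟩
  · rcases Nat.lt_succ_iff_lt_or_eq.1 hi' with h1 | rfl
    · rw [hlt _ h1, hlt _ (by omega)]; exact h.mono i i' hi h1
    · rcases hi.lt_or_eq with h2 | rfl
      · rw [hself, hlt _ h2]; exact h.le i h2
      · exact le_rfl
  · rcases Nat.lt_succ_iff_lt_or_eq.1 hi with h1 | rfl
    · rw [hlt _ h1]; exact h.le_rest i h1 j le_rfl hj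
    · rw [hself]; exact hx.le
  · rcases Nat.lt_succ_iff_lt_or_eq.1 hi with h1 | rfl
    · rw [hlt _ h1]; exact h.le_rest i h1 m (by omega) hm'
    · rw [hself]; exact hx.le.trans (hL _ _ (by omega) hm')
  · rw [Function.update_of_ne (by omega)]; exact h.rest m (by omega)
  · have h1 : (∃ i < j, Function.update L' j x i = v) ↔ ∃ i < j, L' i = v :=
      exists_congr fun i => and_congr_right fun hi => by rw [hlt i hi]
    simp only [Nat.exists_lt_succ_right, hself, h1, h.mem v, or_right_comm (c := key = v)]

theorem finish (h : Bubble L len key len x L') (hL : IsSortedList L len P) :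
    IsSortedList (Function.update L' len x) (len + 1) (fun v => P v ∨ key = v) := by
  have hlt : ∀ i < len, Function.update L' len x i = L' i := fun i hi =>
    Function.update_of_ne hi.ne _ _
  have hself : Function.update L' len x len = x := Function.update_self ..
  refine ⟨fun i i' hi hi' => ?_, fun v => ?_⟩
  · rcases Nat.lt_succ_iff_lt_or_eq.1 hi' with h1 | rfl
    · rw [hlt _ h1, hlt _ (by omega)]; exact h.mono i i' hi h1
    · rcases hi.lt_or_eq with h2 | rfl
      · rw [hself, hlt _ h2]; exact h.le i h2
      · exact le_rfl
  · have h1 : (∃ i < len, Function.update L' len x i = v) ↔ ∃ i < len, L' i = v :=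
      exists_congr fun i => and_congr_right fun hi => by rw [hlt i hi]
    simp only [Nat.exists_lt_succ_right, hself, h1, h.mem v, hL.mem v]

end Bubble

def insertBody (kL : ℕ) : Cmd :=
  .load 34 kL 33 ;; .sub 35 34 23 ;; .ifnz 35 (.store kL 33 23 ;; .add 23 34 19) .skip ;;
  .add 33 33 3 ;; .sub 32 32 3

/-- Inserts register 23 into the sorted array `kL`, whose length is in register 30. -/
def insertCmd (kL : ℕ) : Cmd :=
  .add 32 30 19 ;; .const 33 0 ;; .whilenz 32 (insertBody kL) ;; .store kL 33 23 ;; .add 30 33 3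

theorem keeps_insertBody {kL : ℕ} (h : 14 ≠ kL) : Ctx.keeps (insertBody kL) = true := by
  simp [Ctx.keeps, insertBody, Cmd.writes, Cmd.stores, h]

/-- The key is carried through the whole list and exchanged with every larger entry it meets. One
insertion costs O(S), so sorting costs O(S²), which the time bound allows. -/
theorem wp_insertCmd {Γ : Ctx} {s : St} {kL : ℕ} {P : ℕ → Prop} (hs : Γ.Ready s) (hkL : 14 ≠ kL)
    (hlen : s.reg 30 < Γ.S) (hL : IsSortedList (s.mem kL) (s.reg 30) P)
    (hP : ∀ v, P v → v ≤ Γ.B) (hkey : s.reg 23 ≤ Γ.B) :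
    wp Γ.inp Γ.V Γ.D (insertCmd kL) (fun s' =>
      s'.reg 30 = s.reg 30 + 1 ∧
      IsSortedList (s'.mem kL) (s.reg 30 + 1) (fun v => P v ∨ s.reg 23 = v) ∧
      s'.time ≤ s.time + 40 * Γ.S) s := by
  have hV := Γ.le_V'
  have hD := Γ.le_D'
  set len := s.reg 30 with hlen'
  have hLB : ∀ i < len, s.mem kL i ≤ Γ.B := fun i hi => hP _ ((hL.mem _).1 ⟨i, hi, rfl⟩)
  simp [insertCmd, hs.r19]
  refine ⟨by omega, ?_⟩
  refine wp_while (fun s' => s'.reg 32 + s'.reg 33 = len ∧ s'.reg 23 ≤ Γ.B ∧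
    Bubble (s.mem kL) len (s.reg 23) (s'.reg 33) (s'.reg 23) (s'.mem kL)) (fun s' => s'.reg 32) 20
    ?_ ?_ ?_
  · simp [hlen', hkey, Bubble.init]
  · rintro s' ⟨h1, h5, hB⟩ hf hne
    have hs' : Γ.Ready s' := hs.of_frame hf (by simp) rfl (keeps_insertBody hkL)
    set j := s'.reg 33 with hj
    have hLj := hLB j (by omega)
    have hLj' := hB.rest j le_rfl
    simp [insertBody, hs'.r3, hs'.r19, ← hj, hLj']
    split_ifs with hc
    · exact ⟨by omega, ⟨by omega, h5, hB.keep hL.mono (by omega) (by omega)⟩, by omega⟩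
    · exact ⟨by omega, by omega, by omega,
        ⟨by omega, hLj, hB.swap hL.mono (by omega) (by omega)⟩, by omega⟩
  · rintro s' ⟨h1, h5, hB⟩ hf h0 ht
    have hs' : Γ.Ready s' := hs.of_frame hf (by simp) rfl (keeps_insertBody hkL)
    have h33 : s'.reg 33 = len := by omega
    rw [h33] at hB
    simp [hs'.r3, h33]
    simp [← hlen'] at ht
    exact ⟨by omega, by omega, hB.finish hL, by omega⟩

def listBody (kE : ℕ) (neg : Bool) (kL : ℕ) : Cmd :=
  .sub 31 31 3 ;; .add 20 31 19 ;; keyCmd kE neg ;; insertCmd kL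

/-- Writes the sorted list of all keys, followed by a sentinel, into array `kL`. -/
def listCmd (kE : ℕ) (neg : Bool) (kL : ℕ) : Cmd :=
  .const 30 0 ;; .add 31 8 19 ;; .whilenz 31 (listBody kE neg kL) ;; .store kL 30 9

/-- Only the values are kept, and the list is specified as a set of values: a subset with a given
key is recomputed later. The sentinel 2B + 1 exceeds every sum of two keys, so a pair sum that
involves it is recognizable. -/
theorem wp_listCmd {Γ : Ctx} {s : St} {kE kL : ℕ} {E : ℕ → ℕ} (neg : Bool) (hs : Γ.Ready s)
    (hkE : kE ≠ 15) (hkL : 14 ≠ kL) (hkEL : kE ≠ kL) (hkL' : kL ≠ 15) (hE : Γ.IsPart E)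
    (hEs : ∀ i < Γ.N, s.mem kE i = E i) :
    wp Γ.inp Γ.V Γ.D (listCmd kE neg kL) (fun s' =>
      IsSortedList (s'.mem kL) Γ.S (fun v => ∃ r < Γ.S, Γ.key E neg r = v) ∧
      s'.mem kL Γ.S = 2 * Γ.B + 1 ∧
      s'.time ≤ s.time + 110 * Γ.S ^ 2) s := by
  have hV := Γ.le_V'
  have hD := Γ.le_D'
  have hSpos := Γ.S_pos
  have hkeepU : Ctx.keeps (keyCmd kE neg) = true := by cases neg <;> rfl
  have hkeepI : Ctx.keeps (insertCmd kL) = true := by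
    simp [Ctx.keeps, insertCmd, insertBody, Cmd.writes, Cmd.stores, hkL]
  have hkeep : Ctx.keeps (listBody kE neg kL) = true := by
    cases neg <;> simp [Ctx.keeps, listBody, keyCmd, unrankCmd, insertCmd, insertBody, Cmd.writes,
      Cmd.stores, hkL]
  simp [listCmd, hs.r8, hs.r19]
  refine ⟨by omega, ?_⟩
  refine wp_while (fun s' => s'.reg 31 + s'.reg 30 = Γ.S ∧
    IsSortedList (s'.mem kL) (s'.reg 30) (fun v => ∃ r < Γ.S, s'.reg 31 ≤ r ∧ Γ.key E neg r = v))
    (fun s' => s'.reg 31) (90 * Γ.S) ?_ ?_ ?_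
  · simp
    exact ⟨by simp, fun v => by simp; intro r h1 h2; omega⟩
  · rintro s' ⟨h1, h2⟩ hf hne
    have hs' : Γ.Ready s' := hs.of_frame hf (by simp) rfl hkeep
    have hEs' : s'.mem kE = s.mem kE := hf.mem _ (by
      cases neg <;> simp [listBody, keyCmd, unrankCmd, insertCmd, insertBody, Cmd.stores, hkE, hkEL])
    simp [listBody, hs'.r3, hs'.r19]
    refine ⟨by omega, ?_⟩
    refine wp_then (wp_keyCmd (E := E) neg (hs'.congr (by simp) rfl) hkE hE
      (by simpa [hEs'] using hEs) (by simp; omega)) ?_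
    rintro s₁ ⟨h23, -, -, ht⟩ hf₁
    have hs₁ : Γ.Ready s₁ := hs'.of_frame hf₁ (by simp) rfl hkeepU
    have h30 : s₁.reg 30 = s'.reg 30 := (hf₁.reg _ (by cases neg <;> rfl)).trans (by simp)
    have h31 : s₁.reg 31 = s'.reg 31 - 1 := (hf₁.reg _ (by cases neg <;> rfl)).trans (by simp)
    have hm : s₁.mem kL = s'.mem kL := hf₁.mem _ (by
      cases neg <;> simp [keyCmd, unrankCmd, Cmd.stores, hkL'])
    simp at h23 ht
    refine wp_then (wp_insertCmd hs₁ hkL (by omega) (by rw [hm, h30]; exact h2) ?_ ?_) ?_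
    · rintro v ⟨r, -, -, rfl⟩
      exact hE.key_le neg r
    · rw [h23]; exact hE.key_le neg _
    · rintro s₂ ⟨h30', hl, ht'⟩ hf₂
      have h31' : s₂.reg 31 = s'.reg 31 - 1 := (hf₂.reg _ rfl).trans h31
      refine ⟨⟨by omega, ?_, ?_⟩, by omega, by omega⟩
      · rw [h30']; exact hl.mono
      · intro v
        rw [h30', hl.mem, h31', h23]
        constructor
        · rintro (⟨r, h3, h4, h5⟩ | h3)
          · exact ⟨r, h3, by omega, h5⟩
          · exact ⟨_, by omega, le_rfl, h3⟩
        · rintro ⟨r, h3, h4, h5⟩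
          rcases h4.lt_or_eq with h6 | h6
          · exact Or.inl ⟨r, h3, by omega, h5⟩
          · exact Or.inr (h6 ▸ h5)
  · rintro s' ⟨h1, h2⟩ hf h0 ht
    have hs' : Γ.Ready s' := hs.of_frame hf (by simp) rfl hkeep
    have h30 : s'.reg 30 = Γ.S := by omega
    rw [h0, h30] at h2
    simp at ht
    simp [h30, hs'.r9]
    refine ⟨by omega, ⟨fun i j hij hj => ?_, fun v => ?_⟩, by nlinarith⟩
    · rw [Function.update_of_ne (by omega), Function.update_of_ne (by omega)]
      exact h2.mono i j hij hj
    · rw [← (by simpa using h2.mem v :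
        (∃ i < Γ.S, s'.mem kL i = v) ↔ ∃ r < Γ.S, Γ.key E neg r = v)]
      exact exists_congr fun i => and_congr_right fun hi => by rw [Function.update_of_ne hi.ne]

end SubsetSum
end

/-! ### Tournament trees and the ordered enumeration of pair sums. -/

noncomputable section

namespace SubsetSum

open RAM

/-- In a tournament with keys `M` and winners `W`, the node `k` holds the better one of its children
`2 * k` and `2 * k + 1`. -/
structure NodeOK (M W : ℕ → ℕ) (k : ℕ) : Prop where
  eq : M k = M (2 * k) ∧ W k = W (2 * k) ∨ M k = M (2 * k + 1) ∧ W k = W (2 * k + 1)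
  left : M k ≤ M (2 * k)
  right : M k ≤ M (2 * k + 1)

/-- The arrays `M` and `W` hold a tournament between the `S` leaves `S, …, 2 * S - 1`; only the nodes
in `G` are up to date. -/
structure Tournament (S : ℕ) (key M W : ℕ → ℕ) (G : ℕ → Prop) : Prop where
  leaf : ∀ i < S, M (S + i) = key i ∧ W (S + i) = S + i
  node : ∀ k, 0 < k → k < S → G k → NodeOK M W k

namespace Tournament

variable {S : ℕ} {key M W : ℕ → ℕ}

/-- Downward induction on the index shows that every node carries the key of the leaf it names;
descending from the root shows that no key below it is smaller. The indexing with children 2k and 2k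
+ 1 works for every S, not only for powers of two. -/
theorem root (h : Tournament S key M W fun _ => True) (hS : 0 < S) :
    ∃ i < S, W 1 = S + i ∧ M 1 = key i ∧ ∀ j < S, M 1 ≤ key j := by
  have h1 : ∀ k, 0 < k → k < 2 * S → ∃ i < S, W k = S + i ∧ M k = key i := by
    intro k
    induction hm : 2 * S - k using Nat.strong_induction_on generalizing k with
    | _ m ih =>
      intro hk hk'
      subst hm
      by_cases hkS : k < S
      · rcases (h.node k hk hkS trivial).eq with ⟨h1, h2⟩ | ⟨h1, h2⟩
        · rw [h1, h2]; exact ih (2 * S - 2 * k) (by omega) _ rfl (by omega) (by omega)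
        · rw [h1, h2]; exact ih (2 * S - (2 * k + 1)) (by omega) _ rfl (by omega) (by omega)
      · obtain ⟨i, rfl⟩ : ∃ i, k = S + i := ⟨k - S, by omega⟩
        exact ⟨i, by omega, (h.leaf i (by omega)).2, (h.leaf i (by omega)).1⟩
  have h2 : ∀ k, 0 < k → k < 2 * S → M 1 ≤ M k := by
    intro k
    induction k using Nat.strong_induction_on with
    | _ k ih =>
      intro hk hk'
      rcases Nat.lt_or_ge 1 k with h' | h'
      · refine (ih (k / 2) (by omega) (by omega) (by omega)).trans ?_
        have hn := h.node (k / 2) (by omega) (by omega) trivial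
        rcases Nat.mod_two_eq_zero_or_one k with h0 | h0
        · have := hn.left; rwa [show 2 * (k / 2) = k by omega] at this
        · have := hn.right; rwa [show 2 * (k / 2) + 1 = k by omega] at this
      · rw [show k = 1 by omega]
  obtain ⟨i, hi, h3, h4⟩ := h1 1 one_pos (by omega)
  exact ⟨i, hi, h3, h4, fun j hj => (h2 (S + j) (by omega) (by omega)).trans (h.leaf j hj).1.le⟩

theorem congr_key {key' : ℕ → ℕ} {G : ℕ → Prop} (h : Tournament S key M W G)
    (hk : ∀ i < S, key i = key' i) : Tournament S key' M W G :=
  ⟨fun i hi => by rw [← hk i hi]; exact h.leaf i hi, h.node⟩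

/-- A changed leaf can invalidate only its parent. -/
theorem update_leaf {i v : ℕ} (h : Tournament S key M W fun _ => True) (hi : i < S) :
    Tournament S (Function.update key i v) (Function.update M (S + i) v) W
      fun k => k ≠ (S + i) / 2 := by
  refine ⟨fun j hj => ⟨?_, (h.leaf j hj).2⟩, fun k hk hkS hne => ?_⟩
  · by_cases hji : j = i
    · subst hji; simp
    · rw [Function.update_of_ne hji, Function.update_of_ne (by omega)]
      exact (h.leaf j hj).1
  · have := h.node k hk hkS trivial
    constructor <;> simp only [Function.update_of_ne (show 2 * k ≠ S + i by omega),
      Function.update_of_ne (show 2 * k + 1 ≠ S + i by omega),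
      Function.update_of_ne (show k ≠ S + i by omega)]
    · exact this.eq
    · exact this.left
    · exact this.right

/-- Repairing a node moves the possible defect to its parent. -/
theorem update_node {G : ℕ → Prop} {j m w : ℕ} (h : Tournament S key M W G)
    (hjS : j < S) (hok : NodeOK (Function.update M j m) (Function.update W j w) j) :
    Tournament S key (Function.update M j m) (Function.update W j w)
      fun k => k = j ∨ (G k ∧ k ≠ j / 2) := by
  refine ⟨fun i hi => ?_, fun k hk hkS hG => ?_⟩
  · rw [Function.update_of_ne (by omega), Function.update_of_ne (by omega)]
    exact h.leaf i hi
  · by_cases hkj : k = j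
    · rw [hkj]; exact hok
    · obtain ⟨hG, hk2⟩ := hG.resolve_left hkj
      have := h.node k hk hkS hG
      constructor <;> simp only [Function.update_of_ne (show 2 * k ≠ j by omega),
        Function.update_of_ne (show 2 * k + 1 ≠ j by omega), Function.update_of_ne hkj]
      · exact this.eq
      · exact this.left
      · exact this.right

theorem mono {G G' : ℕ → Prop} (h : Tournament S key M W G)
    (hG : ∀ k, 0 < k → k < S → G' k → G k) : Tournament S key M W G' :=
  ⟨h.leaf, fun k hk hkS h' => h.node k hk hkS (hG k hk hkS h')⟩

end Tournament

/-- Brings the node in register 20 up to date. -/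
def fixCmd (kM kW : ℕ) : Cmd :=
  .add 21 20 20 ;; .add 22 21 3 ;; .load 23 kM 21 ;; .load 24 kM 22 ;; .sub 25 23 24 ;;
  .ifnz 25 (.store kM 20 24 ;; .load 26 kW 22 ;; .store kW 20 26)
    (.store kM 20 23 ;; .load 26 kW 21 ;; .store kW 20 26)

theorem wp_fixCmd {Γ : Ctx} {s : St} {kM kW : ℕ} (hs : Γ.Ready s) (hMW : kM ≠ kW)
    (h0 : 0 < s.reg 20) (hS : s.reg 20 < Γ.S) :
    wp Γ.inp Γ.V Γ.D (fixCmd kM kW) (fun s' =>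
      (∃ m w, s'.mem kM = Function.update (s.mem kM) (s.reg 20) m ∧
        s'.mem kW = Function.update (s.mem kW) (s.reg 20) w) ∧
      NodeOK (s'.mem kM) (s'.mem kW) (s.reg 20) ∧ s'.time ≤ s.time + 20) s := by
  have hV := Γ.le_V'
  have hD := Γ.le_D'
  have h1 : 2 * s.reg 20 ≠ s.reg 20 := by omega
  have h2 : 2 * s.reg 20 + 1 ≠ s.reg 20 := by omega
  simp [fixCmd, hs.r3, ← two_mul]
  refine ⟨by omega, by omega, ?_⟩
  split_ifs with hc
  · simp [hMW, hMW.symm]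
    exact ⟨by omega, by simp [h1], by simp [h1], by simp [h2]; omega⟩
  · simp [hMW, hMW.symm]
    exact ⟨by omega, by simp [h2], by simp [h1]; omega, by simp [h2]⟩

def climbBody (kM kW : ℕ) : Cmd := fixCmd kM kW ;; .half 20 20

/-- Brings the ancestors of the node in register 20 up to date. -/
def climbCmd (kM kW : ℕ) : Cmd := .half 20 20 ;; .whilenz 20 (climbBody kM kW)

theorem size_half_lt {j : ℕ} (h : j ≠ 0) : (j / 2).size < j.size := by
  have h1 : 0 < j.size := Nat.size_pos.2 (Nat.pos_of_ne_zero h)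
  obtain ⟨m, hm⟩ : ∃ m, j.size = m + 1 := ⟨j.size - 1, by omega⟩
  have h2 := Nat.lt_size_self j
  rw [hm, pow_succ] at h2
  rw [hm, Nat.lt_succ_iff, Nat.size_le]
  omega

/-- The only node that may be out of date is the current one. Each halving moves it one level up,
and index 0 is outside the tree; the number of levels is at most the bit length of S. -/
theorem wp_climbCmd {Γ : Ctx} {s : St} {kM kW : ℕ} {key : ℕ → ℕ} (hs : Γ.Ready s) (hMW : kM ≠ kW)
    (hM : 14 ≠ kM) (hW : 14 ≠ kW) (hS : s.reg 20 < 2 * Γ.S)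
    (hT : Tournament Γ.S key (s.mem kM) (s.mem kW) fun k => k ≠ s.reg 20 / 2) :
    wp Γ.inp Γ.V Γ.D (climbCmd kM kW) (fun s' =>
      Tournament Γ.S key (s'.mem kM) (s'.mem kW) (fun _ => True) ∧
      s'.time ≤ s.time + 30 * Γ.S.size + 10) s := by
  simp [climbCmd]
  refine wp_while (fun s' => s'.reg 20 < Γ.S ∧
    Tournament Γ.S key (s'.mem kM) (s'.mem kW) (fun k => k ≠ s'.reg 20))
    (fun s' => (s'.reg 20).size) 30 ?_ ?_ ?_
  · simp
    exact ⟨by omega, hT⟩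
  · rintro s' ⟨h1, h2⟩ hf hne
    have hs' : Γ.Ready s' := hs.of_frame hf (by simp) rfl (by
      simp [Ctx.keeps, climbBody, fixCmd, Cmd.writes, Cmd.stores, hM, hW])
    rw [climbBody, wp_seq]
    refine wp_then (wp_fixCmd (s := s'.tick.tick) (hs'.congr (by simp) rfl) hMW (by simp; omega)
      (by simpa using h1)) ?_
    rintro s₁ ⟨⟨m, w, h3, h4⟩, h5, h6⟩ hf₁
    have h20 : s₁.reg 20 = s'.reg 20 := hf₁.reg _ rfl
    simp at h3 h4 h5 h6
    simp [h20]
    rw [h3, h4] at h5 ⊢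
    refine ⟨⟨by omega, (h2.update_node h1 h5).mono fun k hk hkS hk' => ?_⟩,
      size_half_lt hne, by omega⟩
    by_cases h : k = s'.reg 20
    · exact Or.inl h
    · exact Or.inr ⟨h, hk'⟩
  · rintro s' ⟨h1, h2⟩ hf h0 ht
    simp at ht ⊢
    refine ⟨h2.mono fun k hk _ _ => by omega, ?_⟩
    have : (s.reg 20 / 2).size ≤ Γ.S.size := Nat.size_le_size (by omega)
    omega

/-- The sums `A i + B p` are enumerated in ascending order; for every `i` those with `p < P i` have
been passed. -/
structure Stream (S : ℕ) (A B M W P : ℕ → ℕ) : Prop where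
  le : ∀ i < S, P i ≤ S
  tree : Tournament S (fun i => A i + B (P i)) M W fun _ => True

/-- The lists whose sums are enumerated, with a sentinel after the second one. -/
structure Ctx.IsPair (Γ : Ctx) (A B : ℕ → ℕ) : Prop where
  left_le : ∀ i < Γ.S, A i ≤ Γ.B
  right_le : ∀ i < Γ.S, B i ≤ Γ.B
  mono : ∀ i j, i ≤ j → j < Γ.S → B i ≤ B j
  sentinel : B Γ.S = 2 * Γ.B + 1

theorem Ctx.IsPair.le_sentinel {Γ : Ctx} {A B : ℕ → ℕ} (h : Γ.IsPair A B) {i : ℕ} (hi : i ≤ Γ.S) :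
    B i ≤ 2 * Γ.B + 1 := by
  rcases hi.lt_or_eq with h' | rfl
  · have := h.right_le i h'; omega
  · exact h.sentinel.le

/-- Compatibility of array numbers. -/
structure ArraysOK (kM kW kP kA kB : ℕ) : Prop where
  MW : kM ≠ kW
  MP : kM ≠ kP
  WP : kW ≠ kP
  AM : kA ≠ kM
  AW : kA ≠ kW
  AP : kA ≠ kP
  BM : kB ≠ kM
  BW : kB ≠ kW
  BP : kB ≠ kP
  M14 : 14 ≠ kM
  W14 : 14 ≠ kW
  P14 : 14 ≠ kP

def leafBody (kM kW kP kA kB : ℕ) : Cmd :=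
  .sub 27 27 3 ;; .add 20 8 27 ;; .store kP 27 19 ;; .load 21 kA 27 ;; .load 22 kB 19 ;;
  .add 21 21 22 ;; .store kM 20 21 ;; .store kW 20 20

def nodeBody (kM kW : ℕ) : Cmd := .add 20 27 19 ;; fixCmd kM kW ;; .sub 27 27 3

/-- Starts an enumeration of sums. -/
def buildCmd (kM kW kP kA kB : ℕ) : Cmd :=
  .add 27 8 19 ;; .whilenz 27 (leafBody kM kW kP kA kB) ;; .sub 27 8 3 ;;
  .whilenz 27 (nodeBody kM kW)

/-- Inner nodes are repaired in descending order, so children come before parents. The pointers are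
reset explicitly because the arrays may hold leftovers of earlier attempts. -/
theorem wp_buildCmd {Γ : Ctx} {s : St} {kM kW kP kA kB : ℕ} (hs : Γ.Ready s)
    (hk : ArraysOK kM kW kP kA kB) (hAB : Γ.IsPair (s.mem kA) (s.mem kB)) :
    wp Γ.inp Γ.V Γ.D (buildCmd kM kW kP kA kB) (fun s' =>
      Stream Γ.S (s.mem kA) (s.mem kB) (s'.mem kM) (s'.mem kW) (s'.mem kP) ∧
      (∀ i < Γ.S, s'.mem kP i = 0) ∧ s'.time ≤ s.time + 100 * Γ.S) s := by
  have hV := Γ.le_V'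
  have hD := Γ.le_D'
  have hS := Γ.S_pos
  obtain ⟨MW, MP, WP, AM, AW, AP, BM, BW, BP, M14, W14, P14⟩ := hk
  have hkeep₁ : Ctx.keeps (leafBody kM kW kP kA kB) = true := by
    simp [Ctx.keeps, leafBody, Cmd.writes, Cmd.stores, M14, W14, P14]
  have hkeep₂ : Ctx.keeps (nodeBody kM kW) = true := by
    simp [Ctx.keeps, nodeBody, fixCmd, Cmd.writes, Cmd.stores, M14, W14]
  simp [buildCmd, hs.r8, hs.r19]
  refine ⟨by omega, ?_⟩
  refine wp_while (fun s' => s'.reg 27 ≤ Γ.S ∧ ∀ i < Γ.S, s'.reg 27 ≤ i → s'.mem kP i = 0 ∧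
    s'.mem kM (Γ.S + i) = s.mem kA i + s.mem kB 0 ∧ s'.mem kW (Γ.S + i) = Γ.S + i)
    (fun s' => s'.reg 27) 30 ?_ ?_ ?_
  · simp; intros; omega
  · rintro s' ⟨h1, h2⟩ hf hne
    have hs' : Γ.Ready s' := hs.of_frame hf (by simp) rfl hkeep₁
    have hA : s'.mem kA = s.mem kA := hf.mem _ (by simp [leafBody, Cmd.stores, AM, AW, AP])
    have hB : s'.mem kB = s.mem kB := hf.mem _ (by simp [leafBody, Cmd.stores, BM, BW, BP])
    have h3 := hAB.left_le (s'.reg 27 - 1) (by omega)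
    have h4 := hAB.right_le 0 (by omega)
    simp [leafBody, hs'.r3, hs'.r8, hs'.r19, hA, hB, MW, MW.symm, MP, MP.symm, WP, WP.symm, AP, BP]
    refine ⟨by omega, by omega, by omega, by omega, ⟨by omega, fun i hi hi' => ?_⟩, by omega⟩
    simp only [Function.update_apply, Nat.add_right_inj]
    by_cases hii : i = s'.reg 27 - 1
    · simp [hii]
    · simp [hii]; exact h2 i hi (by omega)
  · rintro s' ⟨h1, h2⟩ hf h0 ht
    have hs' : Γ.Ready s' := hs.of_frame hf (by simp) rfl hkeep₁
    simp at ht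
    simp [hs'.r3, hs'.r8]
    refine wp_while (fun s' => s'.reg 27 < Γ.S ∧ (∀ i < Γ.S, s'.mem kP i = 0) ∧
      Tournament Γ.S (fun i => s.mem kA i + s.mem kB 0) (s'.mem kM) (s'.mem kW)
        fun k => s'.reg 27 < k) (fun s' => s'.reg 27) 30 ?_ ?_ ?_
    · simp
      exact ⟨by omega, fun i hi => (h2 i hi (by omega)).1, fun i hi => (h2 i hi (by omega)).2,
        fun k hk hkS h => by omega⟩
    · rintro s₁ ⟨h3, h4, h5⟩ hf₁ hne
      have hs₁ : Γ.Ready s₁ := hs'.of_frame hf₁ (by simp) rfl hkeep₂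
      simp [nodeBody, hs₁.r19]
      refine ⟨by omega, ?_⟩
      refine wp_then (wp_fixCmd (hs₁.congr (by simp) rfl) MW (by simp; omega) (by simpa using h3)) ?_
      rintro s₂ ⟨⟨m, w, h6, h7⟩, h8, h9⟩ hf₂
      have h27 : s₂.reg 27 = s₁.reg 27 := (hf₂.reg _ rfl).trans (by simp)
      have h3' : s₂.reg 3 = 1 := (hf₂.reg _ rfl).trans (by simp [hs₁.r3])
      have hP : s₂.mem kP = s₁.mem kP :=
        hf₂.mem _ (by simp [fixCmd, Cmd.stores, MP.symm, WP.symm])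
      simp at h6 h7 h8 h9
      simp [h27, h3', hP]
      rw [h6, h7] at h8 ⊢
      refine ⟨⟨by omega, h4, (h5.update_node h3 h8).mono fun k hk hkS hk' => ?_⟩,
        by omega, by omega⟩
      omega
    · rintro s₁ ⟨h3, h4, h5⟩ hf₁ h0' ht₁
      simp at ht₁ ⊢
      refine ⟨⟨fun i hi => by rw [h4 i hi]; omega,
        (h5.mono fun k hk _ _ => by omega).congr_key fun i hi => by rw [h4 i hi]⟩, h4, by omega⟩

/-- Passes the smallest remaining sum of an enumeration. -/
def advanceCmd (kM kW kP kA kB : ℕ) : Cmd :=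
  .load 20 kW 3 ;; .sub 27 20 8 ;; .load 28 kP 27 ;; .add 28 28 3 ;; .store kP 27 28 ;;
  .load 21 kA 27 ;; .load 22 kB 28 ;; .add 21 21 22 ;; .store kM 20 21 ;; climbCmd kM kW

/-- Only the winning leaf changes: its pointer moves to the next entry of the sorted second list,
possibly the sentinel, and its ancestors are repaired. -/
theorem wp_advanceCmd {Γ : Ctx} {s : St} {kM kW kP kA kB i : ℕ} (hs : Γ.Ready s)
    (hk : ArraysOK kM kW kP kA kB) (hAB : Γ.IsPair (s.mem kA) (s.mem kB))
    (hst : Stream Γ.S (s.mem kA) (s.mem kB) (s.mem kM) (s.mem kW) (s.mem kP))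
    (hi : i < Γ.S) (hW : s.mem kW 1 = Γ.S + i) (hP : s.mem kP i < Γ.S) :
    wp Γ.inp Γ.V Γ.D (advanceCmd kM kW kP kA kB) (fun s' =>
      s'.mem kP = Function.update (s.mem kP) i (s.mem kP i + 1) ∧
      Stream Γ.S (s.mem kA) (s.mem kB) (s'.mem kM) (s'.mem kW) (s'.mem kP) ∧
      s'.time ≤ s.time + 30 * Γ.S.size + 40) s := by
  have hV := Γ.le_V'
  have hD := Γ.le_D'
  obtain ⟨MW, MP, WP, AM, AW, AP, BM, BW, BP, M14, W14, P14⟩ := hk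
  have h1 := hAB.left_le i hi
  have h2 := hAB.le_sentinel (i := s.mem kP i + 1) hP
  simp [advanceCmd, hs.r3, hs.r8, hW, MP, AP, BP]
  refine ⟨by omega, by omega, by omega, by omega, ?_⟩
  have hT := (hst.tree.update_leaf (v := s.mem kA i + s.mem kB (s.mem kP i + 1)) hi)
  refine wp_then (wp_climbCmd (hs.congr (by simp) (by simp [M14, P14])) MW M14 W14
    (by simp; omega) (by simpa [MW, MW.symm, MP, WP] using hT)) ?_
  rintro s' ⟨h3, h4⟩ hf
  have hP' : s'.mem kP = Function.update (s.mem kP) i (s.mem kP i + 1) :=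
    (hf.mem _ (by simp [climbCmd, climbBody, fixCmd, Cmd.stores, MP.symm, WP.symm])).trans
      (by simp [MP.symm])
  simp at h4
  refine ⟨hP', ⟨fun j hj => ?_, h3.congr_key fun j hj => ?_⟩, by omega⟩
  · rw [hP', Function.update_apply]
    split_ifs
    · exact hP
    · exact hst.le j hj
  · rw [hP']
    by_cases hji : j = i
    · subst hji; simp
    · simp [hji]

end SubsetSum
end

/-! ### The scan of the two enumerations for a match. -/

noncomputable section

namespace SubsetSum

open RAM

theorem arraysOK_left : ArraysOK 8 9 10 4 5 := by constructor <;> decide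

theorem arraysOK_right : ArraysOK 11 12 13 6 7 := by constructor <;> decide

def mergeBody : Cmd :=
  .load 33 8 3 ;; .load 34 11 3 ;; .sub 36 9 33 ;; .sub 37 9 34 ;;
  .ifnz 36 (.ifnz 37
    (.add 36 33 10 ;; .add 37 34 2 ;; .sub 38 37 36 ;; .sub 39 36 37 ;;
      .ifnz 38 (advanceCmd 8 9 10 4 5)
        (.ifnz 39 (advanceCmd 11 12 13 6 7) (.const 12 1 ;; .const 35 0)))
    (.const 35 0)) (.const 35 0)

/-- Searches the arrays 4, 5, 6, 7 for a match and tells in register 12 whether there is one. -/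
def mergeCmd : Cmd :=
  buildCmd 8 9 10 4 5 ;; buildCmd 11 12 13 6 7 ;; .const 35 1 ;; .whilenz 35 mergeBody

theorem Stream.root {S : ℕ} {A B M W P : ℕ → ℕ} (h : Stream S A B M W P) (hS : 0 < S) :
    ∃ i < S, W 1 = S + i ∧ M 1 = A i + B (P i) ∧ ∀ j < S, M 1 ≤ A j + B (P j) :=
  h.tree.root hS

theorem sum_advance_lt {S i : ℕ} {P : ℕ → ℕ} (hi : i < S) (hP : P i < S) :
    ∑ j ∈ Finset.range S, (S - Function.update P i (P i + 1) j) <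
      ∑ j ∈ Finset.range S, (S - P j) := by
  refine Finset.sum_lt_sum (fun j _ => ?_) ⟨i, Finset.mem_range.2 hi, ?_⟩
  · rw [Function.update_apply]; split_ifs with h
    · rw [h]; omega
    · exact le_rfl
  · rw [Function.update_self]; omega

/-- The four entries solve the problem. -/
def Ctx.Match (Γ : Ctx) (A B C E : ℕ → ℕ) (i p i' p' : ℕ) : Prop :=
  (i < Γ.S ∧ p < Γ.S ∧ i' < Γ.S ∧ p' < Γ.S) ∧ A i + B p + 2 * Γ.B = C i' + E p' + Γ.t

def MergeResult (Γ : Ctx) (A B C E : ℕ → ℕ) (s : St) : Prop :=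
  (s.reg 12 = 0 ∧ ∀ i p i' p', ¬ Γ.Match A B C E i p i' p') ∨
  (s.reg 12 = 1 ∧ ∃ i i', Γ.Match A B C E i (s.mem 10 i) i' (s.mem 13 i') ∧
    s.mem 9 1 = Γ.S + i ∧ s.mem 12 1 = Γ.S + i')

structure MergeInv (Γ : Ctx) (A B C E : ℕ → ℕ) (s : St) : Prop where
  flag : s.reg 35 ≤ 1
  left : Stream Γ.S A B (s.mem 8) (s.mem 9) (s.mem 10)
  right : Stream Γ.S C E (s.mem 11) (s.mem 12) (s.mem 13)
  go : s.reg 35 = 1 → s.reg 12 = 0 ∧ ∀ i p i' p', Γ.Match A B C E i p i' p' →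
    s.mem 10 i ≤ p ∧ s.mem 13 i' ≤ p'
  halt : s.reg 35 = 0 → MergeResult Γ A B C E s

def mergeMeasure (S : ℕ) (s : St) : ℕ :=
  s.reg 35 + (∑ j ∈ Finset.range S, (S - s.mem 10 j) + ∑ j ∈ Finset.range S, (S - s.mem 13 j))

/-- The second pair of lists holds complements, so both enumerations ascend and a solution is an
equality left + 2B = right + t. If the left minimum is too small, no match uses it, since right sums
of matches not yet passed are at least the right minimum; the other case is symmetric. Hence no
match is ever passed, and none is left once one side is exhausted. -/
theorem wp_mergeBody {Γ : Ctx} {s : St} {A B C E : ℕ → ℕ} (hs : Γ.Ready s)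
    (hAB : Γ.IsPair A B) (hCE : Γ.IsPair C E) (h4 : s.mem 4 = A) (h5 : s.mem 5 = B)
    (h6 : s.mem 6 = C) (h7 : s.mem 7 = E) (h : MergeInv Γ A B C E s) (hgo : s.reg 35 ≠ 0) :
    wp Γ.inp Γ.V Γ.D mergeBody (fun s' => MergeInv Γ A B C E s' ∧
      mergeMeasure Γ.S s' < mergeMeasure Γ.S s ∧ s'.time ≤ s.time + (30 * Γ.S.size + 100)) s := by
  have hV := Γ.le_V'
  have hS := Γ.S_pos
  obtain ⟨i, hi, hW, hM, hmin⟩ := h.left.root hS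
  obtain ⟨i', hi', hW', hM', hmin'⟩ := h.right.root hS
  have h35 : s.reg 35 = 1 := by have := h.flag; omega
  obtain ⟨h12, hgo'⟩ := h.go h35
  have hdone : ∀ s' : St, s'.reg 12 = s.reg 12 → s'.mem = s.mem → s'.reg 35 = 0 →
      (∀ i p i' p', ¬ Γ.Match A B C E i p i' p') →
      MergeInv Γ A B C E s' ∧ mergeMeasure Γ.S s' < mergeMeasure Γ.S s := by
    intro s' h1 h2 h3 h4
    refine ⟨⟨by omega, h2 ▸ h.left, h2 ▸ h.right, fun h => by omega, fun _ => Or.inl ⟨by omega, h4⟩⟩,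
      ?_⟩
    unfold mergeMeasure
    rw [h2]; omega
  have e1 := hAB.left_le i hi
  have e2 := hAB.le_sentinel (h.left.le i hi)
  have e1' := hCE.left_le i' hi'
  have e2' := hCE.le_sentinel (h.right.le i' hi')
  simp [mergeBody, hs.r3, hs.r9, hs.r10, hs.r2]
  split_ifs with hL hR hlt hgt
  · rw [← and_assoc]
    refine ⟨hdone _ (by simp) rfl (by simp) ?_, by omega⟩
    rintro j p j' p' hm
    have h1 := hmin j hm.1.1
    have h2 := (hgo' _ _ _ _ hm).1
    have h3 := hm.1.2.1
    have h4 := hAB.left_le j hm.1.1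
    have h5 := hAB.right_le (s.mem 10 j) (by omega)
    omega
  · rw [← and_assoc]
    refine ⟨hdone _ (by simp) rfl (by simp) ?_, by omega⟩
    rintro j p j' p' hm
    have h1 := hmin' j' hm.1.2.2.1
    have h2 := (hgo' _ _ _ _ hm).2
    have h3 := hm.1.2.2.2
    have h4 := hCE.left_le j' hm.1.2.2.1
    have h5 := hCE.right_le (s.mem 13 j') (by omega)
    omega
  all_goals
    have hPi : s.mem 10 i < Γ.S := by
      rcases (h.left.le i hi).lt_or_eq with h1 | h1
      · exact h1
      · rw [h1, hAB.sentinel] at hM; omega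
    have hPi' : s.mem 13 i' < Γ.S := by
      rcases (h.right.le i' hi').lt_or_eq with h1 | h1
      · exact h1
      · rw [h1, hCE.sentinel] at hM'; omega
    refine ⟨by omega, by omega, ?_⟩
  · have hm : Γ.Match A B C E i (s.mem 10 i) i' (s.mem 13 i') :=
      ⟨⟨hi, hPi, hi', hPi'⟩, by omega⟩
    refine ⟨by omega, ⟨by simp, h.left, h.right, by simp, fun _ => Or.inr ⟨by simp, i, i', hm, hW,
      hW'⟩⟩, by simp [mergeMeasure, h35], by omega⟩
  · refine wp_then (wp_advanceCmd (i := i') (hs.congr (by simp) rfl) arraysOK_right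
      (by simpa [h6, h7] using hCE) (by simpa [h6, h7] using h.right) hi' hW' hPi') ?_
    rintro s' ⟨a1, a2, a3⟩ hf
    have f8 : s'.mem 8 = s.mem 8 := hf.mem _ rfl
    have f9 : s'.mem 9 = s.mem 9 := hf.mem _ rfl
    have f10 : s'.mem 10 = s.mem 10 := hf.mem _ rfl
    have f12 : s'.reg 12 = s.reg 12 := (hf.reg _ rfl).trans (by simp)
    have f35 : s'.reg 35 = s.reg 35 := (hf.reg _ rfl).trans (by simp)
    simp only [St.tick_mem, St.tick_time, h6, h7] at a1 a2 a3
    refine ⟨⟨by omega, ?_, a2, fun _ => ⟨by omega, ?_⟩, by omega⟩, ?_, by omega⟩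
    · rw [f8, f9, f10]; exact h.left
    · intro j p j' p' hm
      obtain ⟨b1, b2⟩ := hgo' _ _ _ _ hm
      rw [f10, a1, Function.update_apply]
      refine ⟨b1, ?_⟩
      split_ifs with hj
      · subst hj
        rcases b2.lt_or_eq with b3 | b3
        · exact b3
        · exfalso
          -- If the passed right sum were in a match, its left partner would be smaller than the
          -- left minimum; `b5` uses that the second list is sorted.
          have b4 := hmin j hm.1.1
          have b5 := hAB.mono _ _ b1 hm.1.2.1
          have b6 := hm.2
          rw [← b3] at b6
          omega
      · exact b2
    · have := sum_advance_lt hi' hPi'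
      rw [mergeMeasure, mergeMeasure, f35, f10, a1]
      omega
  · refine wp_then (wp_advanceCmd (i := i) (hs.congr (by simp) rfl) arraysOK_left
      (by simpa [h4, h5] using hAB) (by simpa [h4, h5] using h.left) hi hW hPi) ?_
    rintro s' ⟨a1, a2, a3⟩ hf
    have f11 : s'.mem 11 = s.mem 11 := hf.mem _ rfl
    have f12' : s'.mem 12 = s.mem 12 := hf.mem _ rfl
    have f13 : s'.mem 13 = s.mem 13 := hf.mem _ rfl
    have f12 : s'.reg 12 = s.reg 12 := (hf.reg _ rfl).trans (by simp)
    have f35 : s'.reg 35 = s.reg 35 := (hf.reg _ rfl).trans (by simp)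
    simp only [St.tick_mem, St.tick_time, h4, h5] at a1 a2 a3
    refine ⟨⟨by omega, a2, ?_, fun _ => ⟨by omega, ?_⟩, by omega⟩, ?_, by omega⟩
    · rw [f11, f12', f13]; exact h.right
    · intro j p j' p' hm
      obtain ⟨b1, b2⟩ := hgo' _ _ _ _ hm
      rw [f13, a1, Function.update_apply]
      refine ⟨?_, b2⟩
      split_ifs with hj
      · subst hj
        rcases b1.lt_or_eq with b3 | b3
        · exact b3
        · exfalso
          have b4 := hmin' j' hm.1.2.2.1
          have b5 := hCE.mono _ _ b2 hm.1.2.2.2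
          have b6 := hm.2
          rw [← b3] at b6
          omega
      · exact b1
    · have := sum_advance_lt hi hPi
      rw [mergeMeasure, mergeMeasure, f35, f13, a1]
      omega

theorem wp_mergeCmd {Γ : Ctx} {s : St} (hs : Γ.Ready s)
    (h45 : Γ.IsPair (s.mem 4) (s.mem 5)) (h67 : Γ.IsPair (s.mem 6) (s.mem 7))
    (h12 : s.reg 12 = 0) :
    wp Γ.inp Γ.V Γ.D mergeCmd (fun s' =>
      MergeResult Γ (s.mem 4) (s.mem 5) (s.mem 6) (s.mem 7) s' ∧
      s'.time ≤ s.time + 600 * Γ.S ^ 2 * Γ.S.size) s := by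
  have hV := Γ.le_V'
  have hS := Γ.S_pos
  have hL : 0 < Γ.S.size := Nat.size_pos.2 hS
  rw [mergeCmd, wp_seq]
  refine wp_then (wp_buildCmd (s := s.tick) (hs.congr (by simp) rfl) arraysOK_left h45) ?_
  rintro s₁ ⟨h1, h2, h3⟩ hf₁
  have hs₁ : Γ.Ready s₁ := hs.of_frame hf₁ (by simp) rfl rfl
  have e6 : s₁.mem 6 = s.mem 6 := hf₁.mem _ rfl
  have e7 : s₁.mem 7 = s.mem 7 := hf₁.mem _ rfl
  rw [wp_seq]
  refine wp_then (wp_buildCmd (s := s₁.tick) (hs₁.congr (by simp) rfl) arraysOK_right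
    (by simp only [St.tick_mem, e6, e7]; exact h67)) ?_
  rintro s₂ ⟨h1', h2', h3'⟩ hf₂
  have hs₂ : Γ.Ready s₂ := hs₁.of_frame hf₂ (by simp) rfl rfl
  have hf := fun k (hk : (buildCmd 11 12 13 6 7).stores k = false) => hf₂.mem k hk
  have e4 : s₂.mem 4 = s.mem 4 := (hf₂.mem 4 rfl).trans (hf₁.mem 4 rfl)
  have e5 : s₂.mem 5 = s.mem 5 := (hf₂.mem 5 rfl).trans (hf₁.mem 5 rfl)
  have e6' : s₂.mem 6 = s.mem 6 := (hf₂.mem 6 rfl).trans e6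
  have e7' : s₂.mem 7 = s.mem 7 := (hf₂.mem 7 rfl).trans e7
  have e8 : s₂.mem 8 = s₁.mem 8 := hf₂.mem 8 rfl
  have e9 : s₂.mem 9 = s₁.mem 9 := hf₂.mem 9 rfl
  have e10 : s₂.mem 10 = s₁.mem 10 := hf₂.mem 10 rfl
  have e12 : s₂.reg 12 = 0 := ((hf₂.reg 12 rfl).trans (hf₁.reg 12 rfl)).trans h12
  simp only [St.tick_mem, St.tick_time, e6, e7] at h1 h3 h1' h3'
  simp
  refine ⟨by omega, ?_⟩
  refine wp_while (MergeInv Γ (s.mem 4) (s.mem 5) (s.mem 6) (s.mem 7)) (mergeMeasure Γ.S)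
    (30 * Γ.S.size + 101) ?_ ?_ ?_
  · refine ⟨by simp, ?_, h1', fun _ => ⟨by simp [e12], fun i p i' p' hm => ?_⟩, fun h => ?_⟩
    · simp only [e8, e9, e10]; exact h1
    · simp only [e10, h2 i hm.1.1, h2' i' hm.1.2.2.1]
      exact ⟨Nat.zero_le _, Nat.zero_le _⟩
    · simp at h
  · intro s' hinv hf hne
    have hs' : Γ.Ready s' := hs₂.of_frame hf (by simp) rfl rfl
    refine wp_mono (wp_mergeBody (s := s'.tick) (hs'.congr (by simp) rfl) h45 h67
      ((hf.mem _ rfl).trans e4) ((hf.mem _ rfl).trans e5) ((hf.mem _ rfl).trans e6')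
      ((hf.mem _ rfl).trans e7') ⟨hinv.1, hinv.2, hinv.3, hinv.4, hinv.5⟩ hne) ?_
    rintro s'' ⟨a1, a2, a3⟩
    exact ⟨a1, a2, by simp at a3; omega⟩
  · intro s' hinv hf h0 ht
    refine ⟨hinv.halt h0, ?_⟩
    -- The flag counts 1 and each side has at most S² pairs to pass.
    have hm : mergeMeasure Γ.S
        (St.tick ⟨Function.update s₂.reg 35 1, s₂.mem, s₂.out, s₂.time + 1 + 1⟩) ≤
          3 * Γ.S ^ 2 := by
      have hb : ∀ P : ℕ → ℕ, ∑ j ∈ Finset.range Γ.S, (Γ.S - P j) ≤ Γ.S ^ 2 := fun P =>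
        (Finset.sum_le_card_nsmul _ _ Γ.S fun j _ => Nat.sub_le _ _).trans (by simp [sq])
      have b1 := hb (s₂.mem 10)
      have b2 := hb (s₂.mem 13)
      have b3 : 1 ≤ Γ.S ^ 2 := Nat.one_le_pow _ _ hS
      simp [mergeMeasure]
      omega
    have hm' := Nat.mul_le_mul_right (30 * Γ.S.size + 101) hm
    have h9 := ht.trans (Nat.add_le_add_left hm' _)
    simp at h9 ⊢
    have b4 : Γ.S ≤ Γ.S ^ 2 * Γ.S.size := by nlinarith [Nat.mul_le_mul hS hL]
    have b5 : Γ.S ^ 2 ≤ Γ.S ^ 2 * Γ.S.size := by nlinarith [Nat.mul_le_mul hS hL]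
    have b6 : 0 < Γ.S ^ 2 := by positivity
    nlinarith

end SubsetSum
end

/-! ### Laying out a partition, recovering subsets from keys, and output. -/

noncomputable section

namespace SubsetSum

open RAM

/-- Parameters of a partition into four parts. -/
structure Splitter where
  q : ℕ
  k : ℕ
  k₀ : ℕ
  k₁ : ℕ

/-- The `i`-th element of the part `p < 4`. -/
def Splitter.elem (σ : Splitter) (p i : ℕ) : ℕ :=
  partElem σ.q σ.k (if p / 2 = 0 then σ.k₀ else σ.k₁) (p / 2) (p % 2) i

/-- The input address of the `i`-th element of the part `p < 4`. -/
def Splitter.addr (σ : Splitter) (p i : ℕ) : ℕ := σ.elem p i + 3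

/-- The parameters are in the registers 13 to 16. -/
structure Splitter.Loaded (σ : Splitter) (s : St) : Prop where
  q : s.reg 13 = σ.q
  k : s.reg 14 = σ.k
  k₀ : s.reg 15 = σ.k₀
  k₁ : s.reg 16 = σ.k₁

/-- Every part meets every group of four once, so the address determines the group; within a group
the four offsets are distinct. -/
theorem Splitter.addr_eq_iff (σ : Splitter) {p p' i i' : ℕ} (hp : p < 4) (hp' : p' < 4) :
    σ.addr p i = σ.addr p' i' ↔ p = p' ∧ i = i' := by
  constructor
  · intro h
    have h1 : σ.elem p i = σ.elem p' i' := by simpa [addr] using h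
    unfold elem partElem at h1
    have o1 := offset_lt (h := p / 2) (u := p % 2) (by omega) (by omega) σ.k
      (if p / 2 = 0 then σ.k₀ else σ.k₁) (i % σ.q)
    have o2 := offset_lt (h := p' / 2) (u := p' % 2) (by omega) (by omega) σ.k
      (if p' / 2 = 0 then σ.k₀ else σ.k₁) (i' % σ.q)
    obtain rfl : i = i' := by omega
    refine ⟨?_, rfl⟩
    have h2 := Nat.add_left_cancel h1
    clear h h1 o1 o2
    interval_cases p <;> interval_cases p' <;> simp only [offset, Nat.reduceDiv, Nat.reduceMod,
      if_true, one_ne_zero, if_false] at h2 ⊢ <;> split_ifs at h2 <;> omega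
  · rintro ⟨rfl, rfl⟩; rfl

theorem Splitter.sum_elem (σ : Splitter) (f : ℕ → ℕ) (N : ℕ) :
    ∑ e ∈ Finset.range (4 * N), f e = ∑ i ∈ Finset.range N, f (σ.elem 0 i) +
      ∑ i ∈ Finset.range N, f (σ.elem 1 i) + ∑ i ∈ Finset.range N, f (σ.elem 2 i) +
      ∑ i ∈ Finset.range N, f (σ.elem 3 i) := by
  rw [sum_range_four_mul, ← Finset.sum_add_distrib, ← Finset.sum_add_distrib,
    ← Finset.sum_add_distrib]
  refine Finset.sum_congr rfl fun i _ => ?_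
  simp only [elem, partElem, offset, Nat.reduceDiv, Nat.reduceMod, if_true, one_ne_zero, if_false]
  by_cases h1 : i % σ.q < σ.k₀ <;> by_cases h2 : i % σ.q < σ.k₁ <;>
    by_cases h3 : 2 * (i % σ.q) < σ.k <;> by_cases h4 : 2 * (i % σ.q) + 1 < σ.k <;>
    simp [h1, h2, h3, h4] <;> ring

theorem Splitter.isPart (Γ : Ctx) (σ : Splitter) {p : ℕ} (hp : p < 4) : Γ.IsPart (σ.addr p) := by
  refine ⟨fun i _ j _ h => ((σ.addr_eq_iff hp hp).1 h).2, fun i hi => ?_⟩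
  have o1 := offset_lt (h := p / 2) (u := p % 2) (by omega) (by omega) σ.k
      (if p / 2 = 0 then σ.k₀ else σ.k₁) (i % σ.q)
  unfold addr elem partElem
  omega

/-- Writes the address of the member of the part `(h, u)` in a group into array `kE`. -/
def placeCmd (h u kh kE : ℕ) : Cmd :=
  .add 23 21 3 ;; .sub 23 23 kh ;; .ifnz 23 (.const 24 u) (.const 24 (1 - u)) ;;
  .add 25 21 21 ;; .add 25 25 24 ;; .add 25 25 3 ;; .sub 25 25 14 ;;
  .ifnz 25 (.const 26 h) (.const 26 (1 - h)) ;;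
  .add 27 22 24 ;; .add 27 27 24 ;; .add 27 27 26 ;; .store kE 20 27

theorem wp_placeCmd {Γ : Ctx} {s : St} {h u kh kE : ℕ} (hs : Γ.Ready s) (hh : h < 2) (hu : u < 2)
    (h20 : s.reg 20 < Γ.N) (h21 : s.reg 21 ≤ Γ.N) (h22 : s.reg 22 ≤ 4 * Γ.N)
    (hkh : kh = 15 ∨ kh = 16) :
    wp Γ.inp Γ.V Γ.D (placeCmd h u kh kE) (fun s' =>
      s'.mem = Function.update s.mem kE (Function.update (s.mem kE) (s.reg 20)
        (s.reg 22 + offset (s.reg 14) (s.reg kh) h u (s.reg 21))) ∧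
      s'.time ≤ s.time + 40) s := by
  have hV := Γ.le_V'
  have hD := Γ.le_D'
  have hN := Γ.N_le_S
  have hkh' : kh ≠ 23 := by rintro rfl; simp at hkh
  simp [placeCmd, hs.r3, ← two_mul, hkh']
  refine ⟨by omega, ?_⟩
  unfold offset
  split_ifs <;> first
    | (exfalso; omega)
    | (refine ⟨by omega, by omega, by omega, by omega, by omega, by omega, by omega, by omega,
        by omega, ?_⟩
       congr 2; omega)

def fillBody : Cmd :=
  placeCmd 0 0 15 0 ;; placeCmd 0 1 15 1 ;; placeCmd 1 0 16 2 ;; placeCmd 1 1 16 3 ;;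
  .add 20 20 3 ;; .add 22 22 3 ;; .add 22 22 3 ;; .add 22 22 3 ;; .add 22 22 3 ;;
  .add 21 21 3 ;; .sub 28 13 21 ;; .ifnz 28 .skip (.const 21 0) ;; .sub 29 29 3

/-- Writes the parts of a partition into the arrays 0 to 3. -/
def fillCmd : Cmd :=
  .const 20 0 ;; .const 21 0 ;; .const 22 3 ;; .add 29 5 19 ;; .whilenz 29 fillBody

/-- The machine has no division, so the residue i mod q is kept as a counter that is reset when it
reaches `q`. -/
theorem wp_fillCmd {Γ : Ctx} {s : St} {σ : Splitter} (hs : Γ.Ready s) (hσ : σ.Loaded s)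
    (hq : 0 < σ.q) :
    wp Γ.inp Γ.V Γ.D fillCmd (fun s' =>
      (∀ p < 4, ∀ i < Γ.N, s'.mem p i = σ.addr p i) ∧ s'.time ≤ s.time + 300 * Γ.S) s := by
  have hV := Γ.le_V'
  have hN := Γ.N_le_S
  have hS := Γ.S_pos
  simp [fillCmd, hs.r5, hs.r19]
  refine ⟨by omega, by omega, ?_⟩
  refine wp_while (fun s' => s'.reg 20 + s'.reg 29 = Γ.N ∧ s'.reg 21 = s'.reg 20 % σ.q ∧
    s'.reg 22 = 4 * s'.reg 20 + 3 ∧ ∀ p < 4, ∀ i < s'.reg 20, s'.mem p i = σ.addr p i)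
    (fun s' => s'.reg 29) 240 ?_ ?_ ?_
  · simp
  · rintro s' ⟨h1, h2, h3, h4⟩ hf hne
    have hs' : Γ.Ready s' := hs.of_frame hf (by simp) rfl rfl
    have f13 : s'.reg 13 = σ.q := (hf.reg _ rfl).trans hσ.q
    have f14 : s'.reg 14 = σ.k := (hf.reg _ rfl).trans hσ.k
    have f15 : s'.reg 15 = σ.k₀ := (hf.reg _ rfl).trans hσ.k₀
    have f16 : s'.reg 16 = σ.k₁ := (hf.reg _ rfl).trans hσ.k₁
    have hlt := Nat.mod_lt (s'.reg 20) hq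
    have hle := Nat.mod_le (s'.reg 20) σ.q
    set i := s'.reg 20 with hi
    rw [fillBody, wp_seq]
    refine wp_then (wp_placeCmd (s := s'.tick.tick) (hs'.congr (by simp) rfl) (by omega) (by omega)
      (by simp only [St.tick_reg]; omega) (by simp only [St.tick_reg]; omega)
      (by simp only [St.tick_reg]; omega) (Or.inl rfl)) ?_
    rintro s₁ ⟨m₁, t₁⟩ g₁
    have hs₁ : Γ.Ready s₁ := hs'.of_frame g₁ (by simp) rfl rfl
    have r₁ := g₁.reg
    simp only [St.tick_reg, St.tick_mem, St.tick_time] at m₁ t₁ r₁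
    rw [wp_seq]
    refine wp_then (wp_placeCmd (s := s₁.tick) (hs₁.congr (by simp) rfl) (by omega) (by omega)
      (by simp only [St.tick_reg, r₁ 20 rfl]; omega) (by simp only [St.tick_reg, r₁ 21 rfl]; omega)
      (by simp only [St.tick_reg, r₁ 22 rfl]; omega) (Or.inl rfl)) ?_
    rintro s₂ ⟨m₂, t₂⟩ g₂
    have hs₂ : Γ.Ready s₂ := hs₁.of_frame g₂ (by simp) rfl rfl
    have r₂ := fun r h => (g₂.reg r h).trans (r₁ r h)
    simp only [St.tick_reg, St.tick_mem, St.tick_time] at m₂ t₂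
    rw [wp_seq]
    refine wp_then (wp_placeCmd (s := s₂.tick) (hs₂.congr (by simp) rfl) (by omega) (by omega)
      (by simp only [St.tick_reg, r₂ 20 rfl]; omega) (by simp only [St.tick_reg, r₂ 21 rfl]; omega)
      (by simp only [St.tick_reg, r₂ 22 rfl]; omega) (Or.inr rfl)) ?_
    rintro s₃ ⟨m₃, t₃⟩ g₃
    have hs₃ : Γ.Ready s₃ := hs₂.of_frame g₃ (by simp) rfl rfl
    have r₃ := fun r h => (g₃.reg r h).trans (r₂ r h)
    simp only [St.tick_reg, St.tick_mem, St.tick_time] at m₃ t₃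
    rw [wp_seq]
    refine wp_then (wp_placeCmd (s := s₃.tick) (hs₃.congr (by simp) rfl) (by omega) (by omega)
      (by simp only [St.tick_reg, r₃ 20 rfl]; omega) (by simp only [St.tick_reg, r₃ 21 rfl]; omega)
      (by simp only [St.tick_reg, r₃ 22 rfl]; omega) (Or.inr rfl)) ?_
    rintro s₄ ⟨m₄, t₄⟩ g₄
    have hs₄ : Γ.Ready s₄ := hs₃.of_frame g₄ (by simp) rfl rfl
    have r₄ := fun r h => (g₄.reg r h).trans (r₃ r h)
    simp only [St.tick_reg, St.tick_mem, St.tick_time] at m₄ t₄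
    have hmem : ∀ p < 4, s₄.mem p = Function.update (s'.mem p) i (σ.addr p i) := by
      intro p hp
      rw [m₄, m₃, m₂, m₁]
      simp only [r₁ 14 rfl, r₁ 15 rfl, r₁ 20 rfl, r₁ 21 rfl, r₁ 22 rfl, r₂ 14 rfl, r₂ 16 rfl,
        r₂ 20 rfl, r₂ 21 rfl, r₂ 22 rfl, r₃ 14 rfl, r₃ 16 rfl, r₃ 20 rfl, r₃ 21 rfl, r₃ 22 rfl,
        ← hi, f14, f15, f16, h2, h3]
      interval_cases p <;> simp [Splitter.addr, Splitter.elem, partElem] <;>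
        congr 1 <;> omega
    have hmod : (i + 1) % σ.q = if σ.q - (i % σ.q + 1) = 0 then 0 else i % σ.q + 1 := by
      rw [← Nat.mod_add_mod]
      split_ifs with h
      · rw [show i % σ.q + 1 = σ.q by omega, Nat.mod_self]
      · exact Nat.mod_eq_of_lt (by omega)
    have hmem' : ∀ p < 4, ∀ j < i + 1, s₄.mem p j = σ.addr p j := by
      intro p hp j hj
      rw [hmem p hp, Function.update_apply]
      split_ifs with hji
      · rw [hji]
      · exact h4 p hp j (by omega)
    simp [hs₄.r3, r₄ 20 rfl, r₄ 21 rfl, r₄ 22 rfl, r₄ 13 rfl, r₄ 29 rfl, ← hi, f13, h2, h3]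
    refine ⟨by omega, by omega, by omega, by omega, by omega, by omega, ?_⟩
    split_ifs with hc
    · simp [hmod, hc]
      exact ⟨⟨by omega, by omega, fun p hp j hj => hmem' p hp j (by omega)⟩, by omega, by omega⟩
    · simp [hmod, hc]
      exact ⟨⟨by omega, by omega, fun p hp j hj => hmem' p hp j (by omega)⟩, by omega, by omega⟩
  · rintro s' ⟨h1, h2, h3, h4⟩ hf h0 ht
    simp at ht ⊢
    rw [h0, Nat.add_zero] at h1
    rw [h1] at h4
    exact ⟨h4, by omega⟩

def reconBody (kE : ℕ) (neg : Bool) (v : ℕ) : Cmd :=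
  .sub 31 31 3 ;; .add 20 31 19 ;; keyCmd kE neg ;; .sub 24 23 v ;; .sub 25 v 23 ;; .add 30 24 25

/-- Writes a subset with the key in register `v` into array 15. -/
def reconCmd (kE : ℕ) (neg : Bool) (v : ℕ) : Cmd :=
  .add 31 8 19 ;; .const 30 1 ;; .whilenz 30 (reconBody kE neg v)

/-- Ranks are tried in descending order until the key agrees; register 30 holds the absolute
difference as a sum of two truncated subtractions. The last subset written is the right one, and
cells of other parts are untouched. The bound on `v` keeps the target key out of the registers used
here. -/
theorem wp_reconCmd {Γ : Ctx} {s : St} {kE v : ℕ} {E : ℕ → ℕ} (neg : Bool) (hs : Γ.Ready s)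
    (hkE : kE ≠ 15) (hE : Γ.IsPart E) (hEs : ∀ i < Γ.N, s.mem kE i = E i)
    (hv : 32 < v) (hr : ∃ r < Γ.S, Γ.key E neg r = s.reg v) :
    wp Γ.inp Γ.V Γ.D (reconCmd kE neg v) (fun s' =>
      (∃ r < Γ.S, Γ.key E neg r = s.reg v ∧
        ∀ i < Γ.N, s'.mem 15 (E i) = if i ∈ unrank Γ.N Γ.w r then 1 else 0) ∧
      (∀ a, (∀ i < Γ.N, E i ≠ a) → s'.mem 15 a = s.mem 15 a) ∧
      s'.time ≤ s.time + 80 * Γ.S ^ 2) s := by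
  have hV := Γ.le_V'
  have hS := Γ.S_pos
  have hkeep : Ctx.keeps (reconBody kE neg v) = true := by cases neg <;> rfl
  have hw : (reconBody kE neg v).writes v = false := by
    cases neg <;> simp [reconBody, keyCmd, unrankCmd, Cmd.writes] <;> omega
  have hst : (reconBody kE neg v).stores kE = false := by
    cases neg <;> simp [reconBody, keyCmd, unrankCmd, Cmd.stores, hkE]
  have hkw : (keyCmd kE neg).writes v = false := by
    cases neg <;> simp [keyCmd, unrankCmd, Cmd.writes] <;> omega
  simp [reconCmd, hs.r8, hs.r19]
  refine ⟨by omega, by omega, ?_⟩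
  refine wp_while (fun s' => s'.reg 31 ≤ Γ.S ∧
    (s'.reg 30 ≠ 0 → ∃ r < s'.reg 31, Γ.key E neg r = s.reg v) ∧
    (s'.reg 30 = 0 → ∃ r < Γ.S, Γ.key E neg r = s.reg v ∧
        ∀ i < Γ.N, s'.mem 15 (E i) = if i ∈ unrank Γ.N Γ.w r then 1 else 0) ∧
    (∀ a, (∀ i < Γ.N, E i ≠ a) → s'.mem 15 a = s.mem 15 a)) (fun s' => s'.reg 31) (60 * Γ.S)
    ?_ ?_ ?_
  · simp; exact hr
  · rintro s' ⟨h1, h2, -, h4⟩ hf hne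
    obtain ⟨r, hr1, hr2⟩ := h2 hne
    have hs' : Γ.Ready s' := hs.of_frame hf (by simp) rfl hkeep
    have fv : s'.reg v = s.reg v := (hf.reg _ hw).trans (by
      simp [show v ≠ 30 by omega, show v ≠ 31 by omega])
    have hEs' : s'.mem kE = s.mem kE := hf.mem _ hst
    have hB := hE.key_le neg r
    simp [reconBody, hs'.r3, hs'.r19]
    refine ⟨by omega, ?_⟩
    refine wp_then (wp_keyCmd (E := E) neg (hs'.congr (by simp) rfl) hkE hE
      (by simpa [hEs'] using hEs) (by simp; omega)) ?_
    rintro s₁ ⟨a1, a2, a3, a4⟩ hf₁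
    have gv : s₁.reg v = s.reg v := (hf₁.reg _ hkw).trans (by
      simp [show v ≠ 20 by omega, show v ≠ 31 by omega, fv])
    have g31 : s₁.reg 31 = s'.reg 31 - 1 := (hf₁.reg _ (by cases neg <;> rfl)).trans (by simp)
    have hB' := hE.key_le neg (s'.reg 31 - 1)
    simp at a1 a2 a3 a4
    simp [show v ≠ 24 by omega, gv, g31, a1]
    refine ⟨by omega, ⟨by omega, fun h => ?_, fun h h' => ?_, fun a ha => ?_⟩, by omega, by omega⟩
    · refine ⟨r, ?_, hr2⟩
      rcases Nat.lt_or_ge r (s'.reg 31 - 1) with h3 | h3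
      · exact h3
      · obtain rfl : r = s'.reg 31 - 1 := by omega
        rw [hr2] at h; omega
    · exact ⟨_, by omega, by omega, a2⟩
    · rw [a3 a ha]; exact h4 a ha
  · rintro s' ⟨h1, h2, h3, h4⟩ hf h0 ht
    simp at ht ⊢
    refine ⟨h3 h0, h4, ?_⟩
    nlinarith

def outputBody : Cmd := .load 22 15 20 ;; .output 22 ;; .add 20 20 3 ;; .sub 21 21 3

/-- Outputs the bit vector in array 15. -/
def outputCmd : Cmd := .const 20 3 ;; .add 21 0 19 ;; .whilenz 21 outputBody

theorem wp_outputCmd {Γ : Ctx} {s : St} (hs : Γ.Ready s) :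
    wp Γ.inp Γ.V Γ.D outputCmd (fun s' =>
      s'.out = s.out ++ (List.range (4 * Γ.N)).map (fun e => decide (s.mem 15 (e + 3) ≠ 0)) ∧
      s'.time ≤ s.time + 80 * Γ.S) s := by
  have hV := Γ.le_V'
  have hS := Γ.S_pos
  have hN := Γ.N_le_S
  simp only [outputCmd, wp_seq, wp_const, wp_add]
  simp [hs.r0, hs.r19]
  refine ⟨by omega, by omega, ?_⟩
  refine wp_while (fun s' => s'.reg 20 + s'.reg 21 = 4 * Γ.N + 3 ∧ 3 ≤ s'.reg 20 ∧ s'.out =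
    s.out ++ (List.range (s'.reg 20 - 3)).map (fun e => decide (s.mem 15 (e + 3) ≠ 0)))
    (fun s' => s'.reg 21) 12 ?_ ?_ ?_
  · simp; omega
  · rintro s' ⟨h1, h2, h3⟩ hf hne
    have hs' : Γ.Ready s' := hs.of_frame hf (by simp) rfl rfl
    have f15 : s'.mem 15 = s.mem 15 := hf.mem _ rfl
    simp only [outputBody, wp_seq, wp_load, wp_output, wp_add, wp_sub]
    simp [hs'.r3, f15]
    refine ⟨by omega, ⟨by omega, by omega, ?_⟩, by omega⟩
    rw [h3, show s'.reg 20 - 2 = (s'.reg 20 - 3) + 1 by omega, List.range_succ]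
    simp [show s'.reg 20 - 3 + 3 = s'.reg 20 by omega]
  · rintro s' ⟨h1, h2, h3⟩ hf h0 ht
    simp at ht ⊢
    rw [h3, show s'.reg 20 - 3 = 4 * Γ.N by omega]
    exact ⟨by simp, by omega⟩

end SubsetSum
end

/-! ### One attempt: search and reconstruction for a fixed partition. -/

noncomputable section

namespace SubsetSum

open RAM

/-- Reconstructs a solution from a match and outputs it. -/
def solveCmd : Cmd :=
  .load 20 9 3 ;; .sub 27 20 8 ;; .load 33 4 27 ;; .load 28 10 27 ;; .load 34 5 28 ;;
  .load 20 12 3 ;; .sub 27 20 8 ;; .load 35 6 27 ;; .load 28 13 27 ;; .load 36 7 28 ;;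
  reconCmd 0 false 33 ;; reconCmd 1 false 34 ;; reconCmd 2 true 35 ;; reconCmd 3 true 36 ;;
  outputCmd

/-- Searches for a solution that is balanced with respect to one partition. -/
def attemptCmd : Cmd :=
  fillCmd ;; listCmd 0 false 4 ;; listCmd 1 false 5 ;; listCmd 2 true 6 ;; listCmd 3 true 7 ;;
  mergeCmd ;; .ifnz 12 solveCmd .skip

/-- The lists have been computed. -/
structure Ctx.Listed (Γ : Ctx) (σ : Splitter) (s : St) : Prop where
  part : ∀ p < 4, ∀ i < Γ.N, s.mem p i = σ.addr p i
  l0 : IsSortedList (s.mem 4) Γ.S (fun v => ∃ r < Γ.S, Γ.key (σ.addr 0) false r = v)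
  l1 : IsSortedList (s.mem 5) Γ.S (fun v => ∃ r < Γ.S, Γ.key (σ.addr 1) false r = v)
  l2 : IsSortedList (s.mem 6) Γ.S (fun v => ∃ r < Γ.S, Γ.key (σ.addr 2) true r = v)
  l3 : IsSortedList (s.mem 7) Γ.S (fun v => ∃ r < Γ.S, Γ.key (σ.addr 3) true r = v)

/-- The bit vector `x` solves the problem. -/
structure Ctx.Solves (Γ : Ctx) (x : ℕ → ℕ) : Prop where
  le_one : ∀ e < 4 * Γ.N, x e ≤ 1
  weight : ∑ e ∈ Finset.range (4 * Γ.N), x e = 4 * Γ.w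
  sum : ∑ e ∈ Finset.range (4 * Γ.N), Γ.inp (e + 3) * x e = Γ.t

/-- The parts partition all positions, so weights and sums add up; replacing the complements in
`hsum` by the sums themselves gives total `t`. -/
theorem Ctx.solves_of_parts {Γ : Ctx} {σ : Splitter} {x : ℕ → ℕ} {r0 r1 r2 r3 : ℕ}
    (b0 : r0 < Γ.S) (b1 : r1 < Γ.S) (b2 : r2 < Γ.S) (b3 : r3 < Γ.S)
    (x0 : ∀ j < Γ.N, x (σ.addr 0 j) = if j ∈ unrank Γ.N Γ.w r0 then 1 else 0)
    (x1 : ∀ j < Γ.N, x (σ.addr 1 j) = if j ∈ unrank Γ.N Γ.w r1 then 1 else 0)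
    (x2 : ∀ j < Γ.N, x (σ.addr 2 j) = if j ∈ unrank Γ.N Γ.w r2 then 1 else 0)
    (x3 : ∀ j < Γ.N, x (σ.addr 3 j) = if j ∈ unrank Γ.N Γ.w r3 then 1 else 0)
    (hsum : Γ.key (σ.addr 0) false r0 + Γ.key (σ.addr 1) false r1 + 2 * Γ.B =
      Γ.key (σ.addr 2) true r2 + Γ.key (σ.addr 3) true r3 + Γ.t) :
    Γ.Solves fun e => x (e + 3) := by
  have P := fun p (hp : p < 4) => σ.isPart Γ hp
  have hw : ∀ p r, r < Γ.S → (∀ j < Γ.N, x (σ.addr p j) =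
      if j ∈ unrank Γ.N Γ.w r then 1 else 0) →
      ∑ j ∈ Finset.range Γ.N, x (σ.elem p j + 3) = Γ.w := by
    intro p r hr h
    change ∑ j ∈ Finset.range Γ.N, x (σ.addr p j) = Γ.w
    rw [Finset.sum_congr rfl fun j hj => h j (Finset.mem_range.1 hj), Finset.sum_ite_mem,
      Finset.inter_eq_right.2 (unrank_subset _ _ _), Finset.sum_const, smul_eq_mul, mul_one,
      card_unrank hr]
  have hv : ∀ p r, (∀ j < Γ.N, x (σ.addr p j) =
      if j ∈ unrank Γ.N Γ.w r then 1 else 0) →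
      ∑ j ∈ Finset.range Γ.N, Γ.inp (σ.elem p j + 3) * x (σ.elem p j + 3) =
      ∑ j ∈ unrank Γ.N Γ.w r, Γ.inp (σ.addr p j) := by
    intro p r h
    change ∑ j ∈ Finset.range Γ.N, Γ.inp (σ.addr p j) * x (σ.addr p j) = _
    rw [Finset.sum_congr rfl fun j hj => congrArg _ (h j (Finset.mem_range.1 hj))]
    simp only [mul_ite, mul_one, mul_zero]
    rw [Finset.sum_ite_mem, Finset.inter_eq_right.2 (unrank_subset _ _ _)]
  refine ⟨fun e he => ?_, ?_, ?_⟩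
  · have hx : ∀ e ∈ Finset.range (4 * Γ.N), x (e + 3) - 1 = 0 := by
      rw [← Finset.sum_eq_zero_iff, σ.sum_elem]
      have : ∀ p r, (∀ j < Γ.N, x (σ.addr p j) =
          if j ∈ unrank Γ.N Γ.w r then 1 else 0) →
          ∑ j ∈ Finset.range Γ.N, (x (σ.elem p j + 3) - 1) = 0 := by
        intro p r h
        refine Finset.sum_eq_zero fun j hj => ?_
        have := h j (Finset.mem_range.1 hj)
        rw [Splitter.addr] at this
        rw [this]; split_ifs <;> rfl
      rw [this 0 r0 x0, this 1 r1 x1, this 2 r2 x2, this 3 r3 x3]; rfl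
    have := hx e (Finset.mem_range.2 he)
    omega
  · rw [σ.sum_elem, hw 0 r0 b0 x0, hw 1 r1 b1 x1, hw 2 r2 b2 x2, hw 3 r3 b3 x3]
    ring
  · rw [σ.sum_elem, hv 0 r0 x0, hv 1 r1 x1, hv 2 r2 x2, hv 3 r3 x3]
    have y2 := (P 2 (by omega)).sum_le (unrank_subset Γ.N Γ.w r2)
    have y3 := (P 3 (by omega)).sum_le (unrank_subset Γ.N Γ.w r3)
    simp only [Ctx.key] at hsum
    simp at hsum
    omega

set_option maxHeartbeats 1000000 in
-- The roots name the winning leaves and the pointers give their partners, so the four keys can be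
-- read. The four reconstructions write disjoint cells of array 15, which together hold the
-- solution.
theorem wp_solveCmd {Γ : Ctx} {σ : Splitter} {s : St} (hs : Γ.Ready s) (hl : Γ.Listed σ s)
    {i i' : ℕ} (hm : Γ.Match (s.mem 4) (s.mem 5) (s.mem 6) (s.mem 7) i (s.mem 10 i) i' (s.mem 13 i'))
    (h9 : s.mem 9 1 = Γ.S + i) (h12 : s.mem 12 1 = Γ.S + i') :
    wp Γ.inp Γ.V Γ.D solveCmd (fun s' => (∃ x, Γ.Solves x ∧
      s'.out = s.out ++ (List.range (4 * Γ.N)).map (fun e => decide (x e ≠ 0))) ∧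
      s'.time ≤ s.time + 430 * Γ.S ^ 2) s := by
  have hS := Γ.S_pos
  have hSS : Γ.S ≤ Γ.S ^ 2 := Nat.le_self_pow two_ne_zero _
  obtain ⟨⟨hi, hp, hi', hp'⟩, hsum⟩ := hm
  obtain ⟨q0, hq0, k0⟩ := (hl.l0.mem _).1 ⟨i, hi, rfl⟩
  obtain ⟨q1, hq1, k1⟩ := (hl.l1.mem _).1 ⟨_, hp, rfl⟩
  obtain ⟨q2, hq2, k2⟩ := (hl.l2.mem _).1 ⟨i', hi', rfl⟩
  obtain ⟨q3, hq3, k3⟩ := (hl.l3.mem _).1 ⟨_, hp', rfl⟩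
  have P := fun p (hp : p < 4) => σ.isPart Γ hp
  simp [solveCmd, hs.r3, hs.r8, h9, h12]
  refine wp_then (wp_reconCmd (E := σ.addr 0) false (hs.congr (by simp) rfl) (by decide)
    (P 0 (by omega)) (hl.part 0 (by omega)) (by omega) ⟨q0, hq0, by simp [k0]⟩) ?_
  rintro s₁ ⟨⟨r0, b0, c0, d0⟩, e0, t0⟩ f0
  have hs₁ : Γ.Ready s₁ := hs.of_frame f0 (by simp) rfl rfl
  have v1 := f0.reg 34 rfl
  have v2 := f0.reg 35 rfl
  have v3 := f0.reg 36 rfl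
  have m1 := f0.mem 1 rfl
  have m2 := f0.mem 2 rfl
  have m3 := f0.mem 3 rfl
  simp at v1 v2 v3 m1 m2 m3 c0 t0
  rw [wp_seq]
  refine wp_then (wp_reconCmd (s := s₁.tick) (E := σ.addr 1) false (hs₁.congr (by simp) rfl)
    (by decide) (P 1 (by omega)) (by
      rw [St.tick_mem, m1]; exact hl.part 1 (by omega)) (by omega)
    ⟨q1, hq1, by rw [St.tick_reg, v1]; exact k1⟩) ?_
  rintro s₂ ⟨⟨r1, b1, c1, d1⟩, e1, t1⟩ f1
  have hs₂ : Γ.Ready s₂ := hs₁.of_frame f1 (by simp) rfl rfl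
  replace v2 := (f1.reg 35 rfl).trans v2
  replace v3 := (f1.reg 36 rfl).trans v3
  replace m2 := (f1.mem 2 rfl).trans m2
  replace m3 := (f1.mem 3 rfl).trans m3
  rw [St.tick_reg, v1] at c1
  rw [wp_seq]
  refine wp_then (wp_reconCmd (s := s₂.tick) (E := σ.addr 2) true (hs₂.congr (by simp) rfl)
    (by decide) (P 2 (by omega)) (by
      rw [St.tick_mem, m2]; exact hl.part 2 (by omega)) (by omega)
    ⟨q2, hq2, by rw [St.tick_reg, v2]; exact k2⟩) ?_
  rintro s₃ ⟨⟨r2, b2, c2, d2⟩, e2, t2⟩ f2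
  have hs₃ : Γ.Ready s₃ := hs₂.of_frame f2 (by simp) rfl rfl
  replace v3 := (f2.reg 36 rfl).trans v3
  replace m3 := (f2.mem 3 rfl).trans m3
  rw [St.tick_reg, v2] at c2
  rw [wp_seq]
  refine wp_then (wp_reconCmd (s := s₃.tick) (E := σ.addr 3) true (hs₃.congr (by simp) rfl)
    (by decide) (P 3 (by omega)) (by
      rw [St.tick_mem, m3]; exact hl.part 3 (by omega)) (by omega)
    ⟨q3, hq3, by rw [St.tick_reg, v3]; exact k3⟩) ?_
  rintro s₄ ⟨⟨r3, b3, c3, d3⟩, e3, t3⟩ f3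
  have hs₄ : Γ.Ready s₄ := hs₃.of_frame f3 (by simp) rfl rfl
  have ho : s₄.out = s.out :=
    (f3.out rfl).trans ((f2.out rfl).trans ((f1.out rfl).trans (f0.out rfl)))
  rw [St.tick_reg, v3] at c3
  rw [St.tick_time] at t1 t2 t3
  refine wp_then (wp_outputCmd hs₄) ?_
  rintro s₅ ⟨ho', t4⟩ -
  have hne : ∀ p < 4, ∀ p' < 4, p ≠ p' → ∀ i j, σ.addr p i ≠ σ.addr p' j := fun p hp p' hp' h i j e =>
    h ((σ.addr_eq_iff hp hp').1 e).1
  have x3 : ∀ j < Γ.N, s₄.mem 15 (σ.addr 3 j) = if j ∈ unrank Γ.N Γ.w r3 then 1 else 0 := d3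
  have x2 : ∀ j < Γ.N, s₄.mem 15 (σ.addr 2 j) = if j ∈ unrank Γ.N Γ.w r2 then 1 else 0 :=
    fun j hj => by
      rw [e3 _ fun j' _ => hne 3 (by omega) 2 (by omega) (by omega) _ _]; exact d2 j hj
  have x1 : ∀ j < Γ.N, s₄.mem 15 (σ.addr 1 j) = if j ∈ unrank Γ.N Γ.w r1 then 1 else 0 :=
    fun j hj => by
      rw [e3 _ fun j' _ => hne 3 (by omega) 1 (by omega) (by omega) _ _, St.tick_mem,
        e2 _ fun j' _ => hne 2 (by omega) 1 (by omega) (by omega) _ _]; exact d1 j hj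
  have x0 : ∀ j < Γ.N, s₄.mem 15 (σ.addr 0 j) = if j ∈ unrank Γ.N Γ.w r0 then 1 else 0 :=
    fun j hj => by
      rw [e3 _ fun j' _ => hne 3 (by omega) 0 (by omega) (by omega) _ _, St.tick_mem,
        e2 _ fun j' _ => hne 2 (by omega) 0 (by omega) (by omega) _ _, St.tick_mem,
        e1 _ fun j' _ => hne 1 (by omega) 0 (by omega) (by omega) _ _]; exact d0 j hj
  exact ⟨⟨fun e => s₄.mem 15 (e + 3), Ctx.solves_of_parts b0 b1 b2 b3 x0 x1 x2 x3
    (by rw [c0, c1, c2, c3]; exact hsum), by simp [ho', ho]⟩, by omega⟩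

/-- The support of a balanced solution in each part has `w` elements and thus a rank below S, so its
key occurs in the list. -/
theorem Ctx.Listed.match_of_balanced {Γ : Ctx} {σ : Splitter} {s : St} (hl : Γ.Listed σ s)
    {x : ℕ → ℕ} (hx : ∀ e, x e ≤ 1)
    (hsum : ∑ e ∈ Finset.range (4 * Γ.N), Γ.inp (e + 3) * x e = Γ.t)
    (hbal : ∀ p < 4, ∑ i ∈ Finset.range Γ.N, x (σ.elem p i) = Γ.w) :
    ∃ i p i' p', Γ.Match (s.mem 4) (s.mem 5) (s.mem 6) (s.mem 7) i p i' p' := by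
  have hr : ∀ p < 4, ∃ r < Γ.S, ∑ j ∈ unrank Γ.N Γ.w r, Γ.inp (σ.addr p j) =
      ∑ j ∈ Finset.range Γ.N, Γ.inp (σ.elem p j + 3) * x (σ.elem p j) := by
    intro p hp
    obtain ⟨r, hr, h⟩ := exists_unrank (i := Γ.N) (o := Γ.w)
      (X := (Finset.range Γ.N).filter fun i => x (σ.elem p i) = 1) (Finset.filter_subset _ _) (by
        rw [Finset.card_filter, ← hbal p hp]
        refine Finset.sum_congr rfl fun i _ => ?_
        have := hx (σ.elem p i)
        split_ifs <;> omega)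
    refine ⟨r, hr, ?_⟩
    rw [h, Finset.sum_filter]
    refine Finset.sum_congr rfl fun i _ => ?_
    split_ifs with h1
    · rw [h1, mul_one]; rfl
    · rw [show x (σ.elem p i) = 0 by have := hx (σ.elem p i); omega, mul_zero]
  obtain ⟨r0, b0, c0⟩ := hr 0 (by omega)
  obtain ⟨r1, b1, c1⟩ := hr 1 (by omega)
  obtain ⟨r2, b2, c2⟩ := hr 2 (by omega)
  obtain ⟨r3, b3, c3⟩ := hr 3 (by omega)
  obtain ⟨i, hi, ei⟩ := (hl.l0.mem _).2 ⟨r0, b0, rfl⟩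
  obtain ⟨p, hp, ep⟩ := (hl.l1.mem _).2 ⟨r1, b1, rfl⟩
  obtain ⟨i', hi', ei'⟩ := (hl.l2.mem _).2 ⟨r2, b2, rfl⟩
  obtain ⟨p', hp', ep'⟩ := (hl.l3.mem _).2 ⟨r3, b3, rfl⟩
  refine ⟨i, p, i', p', ⟨hi, hp, hi', hp'⟩, ?_⟩
  have y2 := (σ.isPart Γ (p := 2) (by omega)).sum_le (unrank_subset Γ.N Γ.w r2)
  have y3 := (σ.isPart Γ (p := 3) (by omega)).sum_le (unrank_subset Γ.N Γ.w r3)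
  rw [σ.sum_elem, ← c0, ← c1, ← c2, ← c3] at hsum
  rw [ei, ep, ei', ep']
  simp only [Ctx.key]
  simp
  omega

/-- The output is right so far. -/
def Ctx.Found (Γ : Ctx) (s : St) : Prop :=
  s.reg 12 ≠ 0 ∧ ∃ x, Γ.Solves x ∧ s.out = (List.range (4 * Γ.N)).map (fun e => decide (x e ≠ 0))

/-- No solution is balanced with respect to the partition. -/
def Ctx.Unsolved (Γ : Ctx) (σ : Splitter) : Prop :=
  ∀ x : ℕ → ℕ, (∀ e, x e ≤ 1) → ∑ e ∈ Finset.range (4 * Γ.N), Γ.inp (e + 3) * x e = Γ.t →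
    ¬ ∀ p < 4, ∑ i ∈ Finset.range Γ.N, x (σ.elem p i) = Γ.w

/-- A match yields a true solution whatever the partition; only completeness is relative to it.
Output is produced solely on success, so failed attempts leave it empty. -/
theorem wp_attemptCmd {Γ : Ctx} {σ : Splitter} {s : St} (hs : Γ.Ready s) (hσ : σ.Loaded s)
    (hq : 0 < σ.q) (h12 : s.reg 12 = 0) (hout : s.out = []) :
    wp Γ.inp Γ.V Γ.D attemptCmd (fun s' =>
      ((s'.reg 12 = 0 ∧ s'.out = [] ∧ Γ.Unsolved σ) ∨ Γ.Found s') ∧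
      s'.time ≤ s.time + 2000 * Γ.S ^ 2 * Γ.S.size) s := by
  have hS := Γ.S_pos
  have hL : 0 < Γ.S.size := Nat.size_pos.2 hS
  have P := fun p (hp : p < 4) => σ.isPart Γ hp
  rw [attemptCmd, wp_seq]
  refine wp_then (wp_fillCmd (s := s.tick) (hs.congr (by simp) rfl) ⟨hσ.1, hσ.2, hσ.3, hσ.4⟩ hq) ?_
  rintro s₀ ⟨h0, t0⟩ f0
  have hs₀ : Γ.Ready s₀ := hs.of_frame f0 (by simp) rfl rfl
  have v0 := f0.reg 12 rfl
  have o0 := f0.out rfl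
  rw [wp_seq]
  refine wp_then (wp_listCmd (s := s₀.tick) (kE := 0) (kL := 4) false (hs₀.congr (by simp) rfl)
    (by decide) (by decide) (by decide) (by decide) (P 0 (by omega)) (h0 0 (by omega))) ?_
  rintro s₁ ⟨h1, e1, t1⟩ f1
  have hs₁ : Γ.Ready s₁ := hs₀.of_frame f1 (by simp) rfl rfl
  rw [wp_seq]
  refine wp_then (wp_listCmd (s := s₁.tick) (kE := 1) (kL := 5) false (hs₁.congr (by simp) rfl)
    (by decide) (by decide) (by decide) (by decide) (P 1 (by omega)) (by
      rw [St.tick_mem, f1.mem 1 rfl]; exact h0 1 (by omega))) ?_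
  rintro s₂ ⟨h2, e2, t2⟩ f2
  have hs₂ : Γ.Ready s₂ := hs₁.of_frame f2 (by simp) rfl rfl
  rw [wp_seq]
  refine wp_then (wp_listCmd (s := s₂.tick) (kE := 2) (kL := 6) true (hs₂.congr (by simp) rfl)
    (by decide) (by decide) (by decide) (by decide) (P 2 (by omega)) (by
      rw [St.tick_mem, f2.mem 2 rfl, St.tick_mem, f1.mem 2 rfl]; exact h0 2 (by omega))) ?_
  rintro s₃ ⟨h3, e3, t3⟩ f3
  have hs₃ : Γ.Ready s₃ := hs₂.of_frame f3 (by simp) rfl rfl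
  rw [wp_seq]
  refine wp_then (wp_listCmd (s := s₃.tick) (kE := 3) (kL := 7) true (hs₃.congr (by simp) rfl)
    (by decide) (by decide) (by decide) (by decide) (P 3 (by omega)) (by
      rw [St.tick_mem, f3.mem 3 rfl, St.tick_mem, f2.mem 3 rfl, St.tick_mem, f1.mem 3 rfl]
      exact h0 3 (by omega))) ?_
  rintro s₄ ⟨h4, e4, t4⟩ f4
  have hs₄ : Γ.Ready s₄ := hs₃.of_frame f4 (by simp) rfl rfl
  have m4 : s₄.mem 4 = s₁.mem 4 := (f4.mem 4 rfl).trans ((f3.mem 4 rfl).trans (f2.mem 4 rfl))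
  have m5 : s₄.mem 5 = s₂.mem 5 := (f4.mem 5 rfl).trans (f3.mem 5 rfl)
  have m6 : s₄.mem 6 = s₃.mem 6 := f4.mem 6 rfl
  have v4 : s₄.reg 12 = 0 := by
    rw [f4.reg 12 rfl, St.tick_reg, f3.reg 12 rfl, St.tick_reg, f2.reg 12 rfl, St.tick_reg,
      f1.reg 12 rfl, St.tick_reg, v0]; exact h12
  have o4 : s₄.out = [] := by
    rw [f4.out rfl, St.tick_out, f3.out rfl, St.tick_out, f2.out rfl, St.tick_out, f1.out rfl,
      St.tick_out, o0]; exact hout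
  have hl : Γ.Listed σ s₄ := by
    refine ⟨fun p hp i hi => ?_, by rw [m4]; exact h1, by rw [m5]; exact h2, by rw [m6]; exact h3,
      h4⟩
    rw [← h0 p hp i hi]
    have st : ∀ k, (listCmd 0 false k).stores p = (k == p || p == 15) ∧
        (listCmd 1 false k).stores p = (k == p || p == 15) ∧
        (listCmd 2 true k).stores p = (k == p || p == 15) ∧
        (listCmd 3 true k).stores p = (k == p || p == 15) := by
      intro k
      refine ⟨?_, ?_, ?_, ?_⟩ <;> rw [Bool.eq_iff_iff] <;>
        simp [listCmd, listBody, keyCmd, unrankCmd, insertCmd, insertBody, Cmd.stores] <;> omega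
    rw [f4.mem p (by rw [(st 7).2.2.2]; simp; omega), St.tick_mem,
      f3.mem p (by rw [(st 6).2.2.1]; simp; omega), St.tick_mem,
      f2.mem p (by rw [(st 5).2.1]; simp; omega), St.tick_mem,
      f1.mem p (by rw [(st 4).1]; simp; omega), St.tick_mem]
  have key_le : ∀ {p : ℕ} {neg : Bool} {L : ℕ → ℕ}, p < 4 →
      IsSortedList L Γ.S (fun v => ∃ r < Γ.S, Γ.key (σ.addr p) neg r = v) →
      ∀ i < Γ.S, L i ≤ Γ.B := by
    intro p neg L hp h i hi
    obtain ⟨r, -, h'⟩ := (h.mem _).1 ⟨i, hi, rfl⟩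
    rw [← h']; exact (P p hp).key_le neg r
  rw [wp_seq]
  refine wp_then (wp_mergeCmd (s := s₄.tick) (hs₄.congr (by simp) rfl)
    ⟨key_le (by omega) hl.l0, key_le (by omega) hl.l1, hl.l1.mono, by
      rw [St.tick_mem, m5]; exact e2⟩
    ⟨key_le (by omega) hl.l2, key_le (by omega) hl.l3, hl.l3.mono, e4⟩ v4) ?_
  rintro s₅ ⟨hres, t5⟩ f5
  have hs₅ : Γ.Ready s₅ := hs₄.of_frame f5 (by simp) rfl rfl
  have o5 : s₅.out = [] := (f5.out rfl).trans o4
  have m5' := f5.mem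
  simp only [St.tick_mem, St.tick_time] at t0 t1 t2 t3 t4 t5 hres m5'
  have b4 : Γ.S ≤ Γ.S ^ 2 * Γ.S.size := by nlinarith [Nat.mul_le_mul hS hL]
  have b5 : Γ.S ^ 2 ≤ Γ.S ^ 2 * Γ.S.size := by nlinarith [Nat.mul_le_mul hS hL]
  rw [Nat.mul_assoc] at t5 ⊢
  generalize Γ.S ^ 2 * Γ.S.size = Y at *
  rcases hres with ⟨a1, a2⟩ | ⟨a1, i, i', a2, a3, a4⟩
  · simp [a1, o5]
    refine ⟨Or.inl fun x hx hsum hbal => ?_, by omega⟩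
    obtain ⟨i, p, i', p', hm⟩ := hl.match_of_balanced hx hsum hbal
    exact a2 _ _ _ _ hm
  · rw [wp_ifnz, if_pos (by omega)]
    have hl' : Γ.Listed σ s₅.tick := by
      refine ⟨fun p hp i hi => ?_, ?_, ?_, ?_, ?_⟩
      · rw [← hl.part p hp i hi, St.tick_mem]
        refine congrFun (m5' p ?_) i
        interval_cases p <;> rfl
      · rw [St.tick_mem, m5' 4 rfl]; exact hl.l0
      · rw [St.tick_mem, m5' 5 rfl]; exact hl.l1
      · rw [St.tick_mem, m5' 6 rfl]; exact hl.l2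
      · rw [St.tick_mem, m5' 7 rfl]; exact hl.l3
    refine wp_then (wp_solveCmd (hs₅.congr (by simp) rfl) hl' ?_ a3 a4) ?_
    · rw [St.tick_mem, m5' 4 rfl, m5' 5 rfl, m5' 6 rfl, m5' 7 rfl]; exact a2
    · rintro s₆ ⟨⟨x, hx, ho⟩, t6⟩ f6
      have v6 : s₆.reg 12 = s₅.reg 12 := f6.reg 12 rfl
      rw [St.tick_out, o5, List.nil_append] at ho
      rw [St.tick_time] at t6
      exact ⟨Or.inr ⟨by omega, x, hx, ho⟩, by omega⟩

end SubsetSum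
end

/-! ### Sweeping over all partitions. -/

noncomputable section

namespace SubsetSum

open RAM

/-- The splitters in `A` have been tried. -/
def Ctx.Tried (Γ : Ctx) (A : Splitter → Prop) (s : St) : Prop :=
  (s.reg 12 = 0 ∧ s.out = [] ∧ ∀ σ, A σ → Γ.Unsolved σ) ∨ Γ.Found s

theorem Ctx.Tried.congr {Γ : Ctx} {A : Splitter → Prop} {s s' : St} (h : Γ.Tried A s)
    (hr : s'.reg 12 = s.reg 12) (ho : s'.out = s.out) : Γ.Tried A s' := by
  rcases h with ⟨h1, h2, h3⟩ | ⟨h1, h2⟩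
  · exact Or.inl ⟨hr.trans h1, ho.trans h2, h3⟩
  · exact Or.inr ⟨by rwa [hr], by rwa [ho]⟩

theorem Ctx.Tried.imp {Γ : Ctx} {A A' : Splitter → Prop} {s : St} (h : Γ.Tried A s)
    (hA : ∀ σ, A' σ → A σ) : Γ.Tried A' s :=
  h.imp_left fun h => ⟨h.1, h.2.1, fun σ hσ => h.2.2 σ (hA σ hσ)⟩

/-- Runs a program for all values of a register below the current one. -/
def sweepCmd (r : ℕ) (p : Cmd) : Cmd := .whilenz r (.sub r r 3 ;; p)

/-- A descending loop that accumulates the sets of splitters excluded by its rounds. The hypothesis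
on the body is stated for an arbitrary set `A'` tried before, so that sweeps can be nested. -/
theorem wp_sweepCmd {Γ : Ctx} {s : St} {r c : ℕ} {p : Cmd} {A : Splitter → Prop}
    {B : ℕ → Splitter → Prop} (hs : Γ.Ready s) (hg : Γ.Tried A s)
    (hpk : Ctx.keeps (.sub r r 3 ;; p) = true) (hr : r ≠ 12) (hpr : p.writes r = false)
    (hbody : ∀ v A' s', Γ.Ready s' → Γ.Tried A' s' → s'.reg r = v →
      (∀ k, k ≠ r → p.writes k = false → s'.reg k = s.reg k) →
      wp Γ.inp Γ.V Γ.D p (fun s'' => Γ.Tried (fun σ => A' σ ∨ B v σ) s'' ∧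
        s''.time ≤ s'.time + c) s') :
    wp Γ.inp Γ.V Γ.D (sweepCmd r p) (fun s' => Γ.Tried (fun σ => A σ ∨ ∃ v < s.reg r, B v σ) s' ∧
      s'.time ≤ s.time + s.reg r * (c + 3) + 1) s := by
  have hr3 : (3 : ℕ) ≠ r := by
    rintro rfl
    simp [Ctx.keeps, Cmd.writes] at hpk
  refine wp_while (fun s' => s'.reg r ≤ s.reg r ∧
    Γ.Tried (fun σ => A σ ∨ ∃ v, s'.reg r ≤ v ∧ v < s.reg r ∧ B v σ) s')
    (fun s' => s'.reg r) (c + 3) ?_ ?_ ?_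
  · exact ⟨le_rfl, hg.imp fun σ hσ => hσ.resolve_right fun ⟨v, h1, h2, _⟩ => by omega⟩
  · rintro s' ⟨hle, ht⟩ hf hne
    have hs' : Γ.Ready s' := hs.frame hf hpk
    rw [wp_seq, wp_sub]
    refine wp_then (hbody (s'.reg r - 1) _ _ (hs'.congr (fun k hk => ?_) rfl) (ht.congr ?_ rfl) ?_
      fun k hk hw => ?_) ?_
    · refine Function.update_of_ne ?_ _ _
      rintro rfl
      simp only [Ctx.keeps, Bool.and_eq_true, List.all_eq_true, Bool.not_eq_true'] at hpk
      have := hpk.1 k hk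
      simp [Cmd.writes] at this
    · exact Function.update_of_ne (Ne.symm hr) _ _
    · simp [hs'.r3]
    · refine (Function.update_of_ne hk _ _).trans ?_
      exact hf.reg k (by simp only [Cmd.writes, hw, Bool.or_false, beq_eq_false_iff_ne]; exact hk)
    · rintro s'' ⟨h1, h2⟩ hf'
      have h3 : s''.reg r = s'.reg r - 1 := by
        rw [hf'.reg r hpr]; simp [hs'.r3]
      refine ⟨⟨by omega, h1.imp ?_⟩, by omega, by simp at h2; omega⟩
      rintro σ (h | ⟨v, hv, hv', hB⟩)
      · exact Or.inl (Or.inl h)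
      · rcases eq_or_ne v (s'.reg r - 1) with rfl | hv''
        · exact Or.inr hB
        · exact Or.inl (Or.inr ⟨v, by omega, hv', hB⟩)
  · rintro s' ⟨hle, ht⟩ hf h0 ht'
    exact ⟨(ht.congr rfl rfl).imp fun σ hσ => hσ.imp_right fun ⟨v, h1, h2⟩ =>
      ⟨v, by omega, h1, h2⟩, by simp; omega⟩

/-- A sweep covers the values strictly below the initial one, hence the start at Q + 1. Once a
solution is found, register 12 turns the remaining attempts into skips. -/
def sweepFourthCmd : Cmd := .add 16 11 3 ;; sweepCmd 16 (.ifnz 12 .skip attemptCmd)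

def sweepThirdCmd : Cmd := .add 15 11 3 ;; sweepCmd 15 sweepFourthCmd

def sweepSecondCmd : Cmd := .add 14 11 11 ;; .add 14 14 3 ;; sweepCmd 14 sweepThirdCmd

/-- Tries all splitters. -/
def searchCmd : Cmd := .add 13 11 3 ;; sweepCmd 13 (.ifnz 13 sweepSecondCmd .skip)

theorem wp_sweepFourthCmd {Γ : Ctx} {s : St} {A : Splitter → Prop} (hs : Γ.Ready s)
    (hg : Γ.Tried A s) (hq : 0 < s.reg 13) :
    wp Γ.inp Γ.V Γ.D sweepFourthCmd (fun s' => Γ.Tried (fun σ => A σ ∨ σ.k₁ ≤ Γ.Q ∧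
        σ.q = s.reg 13 ∧ σ.k = s.reg 14 ∧ σ.k₀ = s.reg 15) s' ∧
      s'.time ≤ s.time + (Γ.Q + 2) * (2000 * Γ.S ^ 2 * Γ.S.size + 8)) s := by
  have hV := Γ.le_V'
  simp [sweepFourthCmd, hs.r3, hs.r11]
  refine ⟨by omega, ?_⟩
  refine wp_then (wp_sweepCmd (A := A) (c := 2000 * Γ.S ^ 2 * Γ.S.size + 2) (B := fun v σ =>
    σ.k₁ = v ∧ σ.q = s.reg 13 ∧ σ.k = s.reg 14 ∧ σ.k₀ = s.reg 15)
    (hs.congr (by simp) rfl) (hg.congr (by simp) rfl) rfl (by decide) rfl ?_) ?_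
  · intro v A' s' hs' hg' hv hk
    rw [wp_ifnz]
    have e13 : s'.reg 13 = s.reg 13 := by rw [hk 13 (by decide) rfl]; simp
    have e14 : s'.reg 14 = s.reg 14 := by rw [hk 14 (by decide) rfl]; simp
    have e15 : s'.reg 15 = s.reg 15 := by rw [hk 15 (by decide) rfl]; simp
    rcases hg' with ⟨h1, h2, h3⟩ | h1
    · rw [if_neg (by omega)]
      refine wp_then (wp_attemptCmd (s := s'.tick) (σ := ⟨s.reg 13, s.reg 14, s.reg 15, v⟩)
        (hs'.congr (by simp) rfl) ⟨e13, e14, e15, hv⟩ hq h1 h2) ?_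
      rintro s'' ⟨h4, h5⟩ -
      simp only [St.tick_time] at h5
      refine ⟨h4.imp_left fun ⟨h6, h7, h8⟩ => ⟨h6, h7, ?_⟩, by omega⟩
      rintro ⟨q, k, k₀, k₁⟩ (h | ⟨rfl, rfl, rfl, rfl⟩)
      · exact h3 _ h
      · exact h8
    · rw [if_pos h1.1]
      exact ⟨Or.inr h1, by simp⟩
  · rintro s' ⟨h1, h2⟩ -
    simp at h1 h2
    refine ⟨h1.imp fun σ hσ => hσ.imp_right fun ⟨h3, h4⟩ => ⟨by omega, h4⟩, h2.trans ?_⟩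
    generalize 2000 * Γ.S ^ 2 * Γ.S.size = Y
    nlinarith

theorem wp_sweepThirdCmd {Γ : Ctx} {s : St} {A : Splitter → Prop} (hs : Γ.Ready s)
    (hg : Γ.Tried A s) (hq : 0 < s.reg 13) :
    wp Γ.inp Γ.V Γ.D sweepThirdCmd (fun s' => Γ.Tried (fun σ => A σ ∨ σ.k₀ ≤ Γ.Q ∧ σ.k₁ ≤ Γ.Q ∧
        σ.q = s.reg 13 ∧ σ.k = s.reg 14) s' ∧
      s'.time ≤ s.time + (Γ.Q + 2) ^ 2 * (2000 * Γ.S ^ 2 * Γ.S.size + 16)) s := by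
  have hV := Γ.le_V'
  simp [sweepThirdCmd, hs.r3, hs.r11]
  refine ⟨by omega, ?_⟩
  refine wp_then (wp_sweepCmd (A := A) (c := (Γ.Q + 2) * (2000 * Γ.S ^ 2 * Γ.S.size + 8))
    (B := fun v σ => σ.k₁ ≤ Γ.Q ∧ σ.q = s.reg 13 ∧ σ.k = s.reg 14 ∧ σ.k₀ = v)
    (hs.congr (by simp) rfl) (hg.congr (by simp) rfl) rfl (by decide) rfl ?_) ?_
  · intro v A' s' hs' hg' hv hk
    have e13 : s'.reg 13 = s.reg 13 := by rw [hk 13 (by decide) rfl]; simp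
    have e14 : s'.reg 14 = s.reg 14 := by rw [hk 14 (by decide) rfl]; simp
    rw [← e13, ← e14, ← hv]
    exact wp_sweepFourthCmd hs' hg' (by omega)
  · rintro s' ⟨h1, h2⟩ -
    simp at h1 h2
    refine ⟨h1.imp fun σ hσ => hσ.imp_right fun ⟨h3, h4, h5, h6⟩ => ⟨by omega, h4, h5, h6⟩,
      h2.trans ?_⟩
    generalize 2000 * Γ.S ^ 2 * Γ.S.size = Y
    nlinarith

theorem wp_sweepSecondCmd {Γ : Ctx} {s : St} {A : Splitter → Prop} (hs : Γ.Ready s)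
    (hg : Γ.Tried A s) (hq : 0 < s.reg 13) :
    wp Γ.inp Γ.V Γ.D sweepSecondCmd (fun s' => Γ.Tried (fun σ => A σ ∨ σ.k ≤ 2 * Γ.Q ∧
        σ.k₀ ≤ Γ.Q ∧ σ.k₁ ≤ Γ.Q ∧ σ.q = s.reg 13) s' ∧
      s'.time ≤ s.time + 2 * (Γ.Q + 2) ^ 3 * (2000 * Γ.S ^ 2 * Γ.S.size + 24)) s := by
  have hV := Γ.le_V'
  simp [sweepSecondCmd, hs.r3, hs.r11]
  refine ⟨by omega, by omega, ?_⟩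
  refine wp_then (wp_sweepCmd (A := A) (c := (Γ.Q + 2) ^ 2 * (2000 * Γ.S ^ 2 * Γ.S.size + 16))
    (B := fun v σ => σ.k₀ ≤ Γ.Q ∧ σ.k₁ ≤ Γ.Q ∧ σ.q = s.reg 13 ∧ σ.k = v)
    (hs.congr (by simp) rfl) (hg.congr (by simp) rfl) rfl (by decide) rfl ?_) ?_
  · intro v A' s' hs' hg' hv hk
    have e13 : s'.reg 13 = s.reg 13 := by rw [hk 13 (by decide) rfl]; simp
    rw [← e13, ← hv]
    exact wp_sweepThirdCmd hs' hg' (by omega)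
  · rintro s' ⟨h1, h2⟩ -
    simp at h1 h2
    refine ⟨h1.imp fun σ hσ => hσ.imp_right fun ⟨h3, h4, h5, h6⟩ => ⟨by omega, h4, h5, h6⟩,
      h2.trans ?_⟩
    generalize 2000 * Γ.S ^ 2 * Γ.S.size = Y
    have : 0 ≤ Γ.Q ^ 2 * Y := Nat.zero_le _
    have : 0 ≤ Γ.Q * Y := Nat.zero_le _
    have : 0 ≤ Γ.Q ^ 3 := Nat.zero_le _
    nlinarith

theorem wp_searchCmd {Γ : Ctx} {s : St} (hs : Γ.Ready s) (h12 : s.reg 12 = 0) (hout : s.out = []) :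
    wp Γ.inp Γ.V Γ.D searchCmd (fun s' => Γ.Tried (fun σ => 0 < σ.q ∧ σ.q ≤ Γ.Q ∧
        σ.k ≤ 2 * Γ.Q ∧ σ.k₀ ≤ Γ.Q ∧ σ.k₁ ≤ Γ.Q) s' ∧
      s'.time ≤ s.time + 2 * (Γ.Q + 2) ^ 4 * (2000 * Γ.S ^ 2 * Γ.S.size + 32)) s := by
  have hV := Γ.le_V'
  simp [searchCmd, hs.r3, hs.r11]
  refine ⟨by omega, ?_⟩
  refine wp_then (wp_sweepCmd (A := fun _ => False)
    (c := 2 * (Γ.Q + 2) ^ 3 * (2000 * Γ.S ^ 2 * Γ.S.size + 24) + 2)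
    (B := fun v σ => 0 < v ∧ σ.k ≤ 2 * Γ.Q ∧ σ.k₀ ≤ Γ.Q ∧ σ.k₁ ≤ Γ.Q ∧ σ.q = v)
    (hs.congr (by simp) rfl) (Or.inl ⟨by simpa using h12, hout, fun _ => False.elim⟩) rfl
    (by decide) rfl ?_) ?_
  · intro v A' s' hs' hg' hv hk
    rw [wp_ifnz]
    split_ifs with h13
    · refine wp_then (wp_sweepSecondCmd (s := s'.tick) (hs'.congr (by simp) rfl)
        (hg'.congr rfl rfl) (by simp; omega)) ?_
      rintro s'' ⟨h1, h2⟩ -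
      simp only [St.tick_time, St.tick_reg, hv] at h1 h2
      exact ⟨h1.imp fun σ hσ => hσ.imp_right fun h => h.2, by omega⟩
    · refine ⟨(hg'.congr rfl rfl).imp fun σ hσ => hσ.resolve_right ?_, by simp⟩
      rintro ⟨h1, -⟩
      omega
  · rintro s' ⟨h1, h2⟩ -
    simp at h1 h2
    refine ⟨h1.imp fun σ ⟨h3, h4, h5⟩ => ⟨by omega, h3, h5⟩,
      h2.trans ?_⟩
    generalize 2000 * Γ.S ^ 2 * Γ.S.size = Y
    have : 0 ≤ Γ.Q ^ 3 * Y := Nat.zero_le _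
    have : 0 ≤ Γ.Q ^ 2 * Y := Nat.zero_le _
    have : 0 ≤ Γ.Q * Y := Nat.zero_le _
    have : 0 ≤ Γ.Q ^ 3 := Nat.zero_le _
    have : 0 ≤ Γ.Q ^ 4 := Nat.zero_le _
    nlinarith

/-- With L the bit length of S, `Q` is precisely the bound on the modulus in `exists_splitter`, so
the sweep covers a splitter balanced for any given solution. -/
theorem Ctx.Tried.correct {Γ : Ctx} {s : St} (hQ : Γ.Q = 2 ^ (12 + 4 * Γ.S.size.size))
    (h : Γ.Tried (fun σ => 0 < σ.q ∧ σ.q ≤ Γ.Q ∧ σ.k ≤ 2 * Γ.Q ∧ σ.k₀ ≤ Γ.Q ∧ σ.k₁ ≤ Γ.Q) s) :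
    (∃ x, Γ.Solves x ∧ s.out = (List.range (4 * Γ.N)).map (fun e => decide (x e ≠ 0))) ∨
      ((∀ x, ¬ Γ.Solves x) ∧ s.out = []) := by
  rcases h with ⟨-, ho, h⟩ | ⟨-, h⟩
  · refine Or.inr ⟨fun x hx => ?_, ho⟩
    -- `exists_splitter` wants values at most 1 everywhere, whereas a solution is constrained only
    -- on the 4N positions.
    set y := fun e => if e < 4 * Γ.N then x e else 0 with hy
    have hxy : ∀ e ∈ Finset.range (4 * Γ.N), y e = x e := fun e he => by
      simp [hy, Finset.mem_range.1 he]
    have hy1 : ∀ e, y e ≤ 1 := fun e => by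
      simp only [hy]; split_ifs with he
      · exact hx.le_one e he
      · omega
    obtain ⟨q, hq0, hq, k, hk, k₀, hk₀, k₁, hk₁, hb⟩ := exists_splitter Γ.w_lt Γ.w_pos
      (Nat.lt_size_self Γ.S) hy1 ((Finset.sum_congr rfl hxy).trans hx.weight)
    rw [← hQ] at hq
    refine h ⟨q, k, k₀, k₁⟩ ⟨hq0, hq, by simp only; omega, by simp only; omega, by simp only; omega⟩
      y hy1 ((Finset.sum_congr rfl fun e he => by rw [hxy e he]).trans hx.sum) fun p hp => ?_
    exact hb (p / 2) (by omega) (p % 2) (by omega)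
  · exact Or.inl h

end SubsetSum
end

/-! ### Computing the binomial table and the bound on the moduli. -/

noncomputable section

namespace SubsetSum

open RAM

/-- The entries of the table of binomial coefficients. -/
def binomEntry (z o : ℕ) : ℕ := if z = 0 then 0 else (z + o - 1).choose o

/-- Pascal's rule in the coordinates (z, o): an entry is the sum of its left and its upper
neighbour, computable by additions alone. -/
theorem binomEntry_succ (z o : ℕ) :
    binomEntry (z + 1) (o + 1) = binomEntry (z + 1) o + binomEntry z (o + 1) := by
  unfold binomEntry
  rcases z with _ | z
  · simp
  · simp only [Nat.add_one_ne_zero, if_false]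
    rw [show z + 1 + 1 + (o + 1) - 1 = (z + 1 + o) + 1 by omega, Nat.choose_succ_succ,
      show z + 1 + 1 + o - 1 = z + 1 + o by omega, show z + 1 + (o + 1) - 1 = z + 1 + o by omega]

theorem binomEntry_le {z o N w : ℕ} (hw : w < N) (hz : z ≤ N - w + 1) (ho : o ≤ w) :
    binomEntry z o ≤ N.choose w := by
  unfold binomEntry
  split_ifs with h
  · exact Nat.zero_le _
  · obtain ⟨y, rfl⟩ := Nat.exists_eq_succ_of_ne_zero h
    calc (y.succ + o - 1).choose o = (y + o).choose y := by
          rw [show y.succ + o - 1 = y + o by omega, Nat.choose_symm_add]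
      _ ≤ (y + w).choose y := Nat.choose_le_choose _ (by omega)
      _ = (y + w).choose w := Nat.choose_symm_add
      _ ≤ N.choose w := Nat.choose_le_choose _ (by omega)

def tableRowBody : Cmd :=
  .sub 24 20 7 ;; .load 24 14 24 ;; .add 22 22 24 ;; .store 14 20 22 ;; .add 20 20 3 ;;
  .sub 23 23 3

def tableBody : Cmd :=
  .store 14 20 3 ;; .add 20 20 3 ;; .add 22 3 19 ;; .add 23 6 19 ;; .whilenz 23 tableRowBody ;;
  .sub 21 21 3

/-- Computes the table of binomial coefficients. -/
def tableCmd : Cmd := .add 20 7 19 ;; .add 21 17 3 ;; .whilenz 21 tableBody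

/-- The registers that are needed for the computation of the table. -/
structure Ctx.TableReady (Γ : Ctx) (s : St) : Prop where
  r3 : s.reg 3 = 1
  r6 : s.reg 6 = Γ.w
  r7 : s.reg 7 = Γ.w + 1
  r17 : s.reg 17 = Γ.N - Γ.w
  r19 : s.reg 19 = 0

theorem wp_tableRow {Γ : Ctx} {s : St} {z : ℕ} (hs : Γ.TableReady s) (hz : z < Γ.N - Γ.w + 1)
    (h20 : s.reg 20 = (z + 1) * (Γ.w + 1))
    (hT : ∀ a < s.reg 20, s.mem 14 a = binomEntry (a / (Γ.w + 1)) (a % (Γ.w + 1))) :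
    wp Γ.inp Γ.V Γ.D tableBody (fun s' => s'.reg 20 = (z + 2) * (Γ.w + 1) ∧
      (∀ a < s'.reg 20, s'.mem 14 a = binomEntry (a / (Γ.w + 1)) (a % (Γ.w + 1))) ∧
      s'.reg 22 = binomEntry (z + 1) Γ.w ∧ s'.reg 21 = s.reg 21 - 1 ∧
      s'.time ≤ s.time + 12 * (Γ.w + 1) + 4) s := by
  have hV := Γ.le_V'
  have hD := Γ.le_D'
  have hS := Γ.mul_lt_S
  have hN := Γ.N_le_S
  have hw := Γ.w_lt
  have hp : (z + 2) * (Γ.w + 1) ≤ 4 * Γ.S := by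
    have : (z + 2) * (Γ.w + 1) ≤ (Γ.N - Γ.w + 2) * (Γ.w + 1) := Nat.mul_le_mul_right _ (by omega)
    have h2 : (Γ.N - Γ.w + 2) * (Γ.w + 1) = Γ.w * (Γ.N - Γ.w) + 2 * Γ.w + (Γ.N - Γ.w) + 2 := by ring
    omega
  have hp' : (z + 2) * (Γ.w + 1) = (z + 1) * (Γ.w + 1) + (Γ.w + 1) := by ring
  have hentry : ∀ a < (z + 2) * (Γ.w + 1), binomEntry (a / (Γ.w + 1)) (a % (Γ.w + 1)) ≤ Γ.S := by
    intro a ha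
    refine binomEntry_le hw ?_ (Nat.le_of_lt_succ (Nat.mod_lt _ (by omega)))
    have := (Nat.div_lt_iff_lt_mul (by omega)).2 ha
    omega
  have hdiv : ∀ o ≤ Γ.w, ∀ y, (y * (Γ.w + 1) + o) / (Γ.w + 1) = y := fun o ho y => by
    rw [Nat.add_comm, Nat.add_mul_div_right _ _ (by omega), Nat.div_eq_of_lt (by omega), zero_add]
  have hmod : ∀ o ≤ Γ.w, ∀ y, (y * (Γ.w + 1) + o) % (Γ.w + 1) = o := fun o ho y => by
    rw [Nat.add_comm, Nat.add_mul_mod_self_right, Nat.mod_eq_of_lt (by omega)]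
  simp [tableBody, hs.r3, hs.r6, hs.r19, h20]
  refine ⟨by omega, by omega, by omega, by omega, ?_⟩
  refine wp_while (fun s' => s'.reg 23 ≤ Γ.w ∧
    s'.reg 20 + s'.reg 23 = (z + 1) * (Γ.w + 1) + (Γ.w + 1) ∧
    s'.reg 22 = binomEntry (z + 1) (Γ.w - s'.reg 23) ∧
    ∀ a < s'.reg 20, s'.mem 14 a = binomEntry (a / (Γ.w + 1)) (a % (Γ.w + 1)))
    (fun s' => s'.reg 23) 12 ?_ ?_ ?_
  · simp
    refine ⟨by omega, by simp [binomEntry], fun a ha => ?_⟩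
    rcases eq_or_ne a ((z + 1) * (Γ.w + 1)) with rfl | hne
    · have h1 := hdiv 0 (by omega) (z + 1)
      have h2 := hmod 0 (by omega) (z + 1)
      rw [Nat.add_zero] at h1 h2
      rw [h1, h2]
      simp [binomEntry]
    · rw [Function.update_of_ne hne]
      exact hT a (by omega)
  · rintro s' ⟨h1, h2, h3, h4⟩ hf hne
    have e3 : s'.reg 3 = 1 := (hf.reg 3 rfl).trans hs.r3
    have e7 : s'.reg 7 = Γ.w + 1 := (hf.reg 7 rfl).trans hs.r7
    obtain ⟨o, ho⟩ : ∃ o, Γ.w = o + s'.reg 23 := ⟨Γ.w - s'.reg 23, by omega⟩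
    have h20' : s'.reg 20 = (z + 1) * (Γ.w + 1) + (o + 1) := by omega
    have h20'' : s'.reg 20 - (Γ.w + 1) = z * (Γ.w + 1) + (o + 1) := by
      rw [h20', show (z + 1) * (Γ.w + 1) = z * (Γ.w + 1) + (Γ.w + 1) by ring]; omega
    have hold : s'.mem 14 (s'.reg 20 - (Γ.w + 1)) = binomEntry z (o + 1) := by
      rw [h4 _ (by omega), h20'', hdiv _ (by omega), hmod _ (by omega)]
    have hnew : s'.reg 22 + s'.mem 14 (s'.reg 20 - (Γ.w + 1)) = binomEntry (z + 1) (o + 1) := by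
      rw [hold, h3, show Γ.w - s'.reg 23 = o by omega, binomEntry_succ]
    have hle := hentry (s'.reg 20) (by omega)
    rw [h20', hdiv _ (by omega), hmod _ (by omega)] at hle
    simp [tableRowBody, e3, e7, hnew]
    refine ⟨by omega, by omega, by omega, ⟨by omega, by omega, ?_, fun a ha => ?_⟩, by omega⟩
    · rw [show Γ.w - (s'.reg 23 - 1) = o + 1 by omega]
    · rcases eq_or_ne a (s'.reg 20) with rfl | hne'
      · rw [Function.update_self]
        conv_rhs => rw [h20', hdiv _ (by omega), hmod _ (by omega)]
      · rw [Function.update_of_ne hne']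
        exact h4 a (by omega)
  · rintro s' ⟨h1, h2, h3, h4⟩ hf h0 ht
    have e3 : s'.reg 3 = 1 := (hf.reg 3 rfl).trans hs.r3
    have e21 : s'.reg 21 = s.reg 21 := hf.reg 21 rfl
    rw [h0, Nat.sub_zero] at h3
    simp at ht
    simp [e3, e21, h3]
    exact ⟨by omega, h4, by omega⟩

/-- Row 0 consists of zeros and is supplied by the untouched memory. One row more than the unranking
needs is computed, because its last entry is C(N, w) = S; this is how S enters its register. -/
theorem wp_tableCmd {Γ : Ctx} {s : St} (hs : Γ.TableReady s) (hm : s.mem 14 = 0) :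
    wp Γ.inp Γ.V Γ.D tableCmd (fun s' => s'.reg 20 = (Γ.N - Γ.w + 2) * (Γ.w + 1) ∧
      (∀ z ≤ Γ.N - Γ.w, ∀ o ≤ Γ.w, s'.mem 14 (z * (Γ.w + 1) + o) = binomEntry z o) ∧
      s'.reg 22 = Γ.S ∧ s'.time ≤ s.time + 100 * Γ.S) s := by
  have hV := Γ.le_V'
  have hS := Γ.mul_lt_S
  have hN := Γ.N_le_S
  have hw := Γ.w_lt
  simp [tableCmd, hs.r3, hs.r7, hs.r17, hs.r19]
  refine ⟨by omega, by omega, ?_⟩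
  refine wp_while (fun s' => ∃ z, z + s'.reg 21 = Γ.N - Γ.w + 1 ∧
    s'.reg 20 = (z + 1) * (Γ.w + 1) ∧ (0 < z → s'.reg 22 = binomEntry z Γ.w) ∧
    ∀ a < s'.reg 20, s'.mem 14 a = binomEntry (a / (Γ.w + 1)) (a % (Γ.w + 1)))
    (fun s' => s'.reg 21) (12 * (Γ.w + 1) + 5) ?_ ?_ ?_
  · refine ⟨0, by simp, by simp, by omega, fun a ha => ?_⟩
    simp at ha
    simp [hm, binomEntry, show a < Γ.w + 1 by omega]
  · rintro s' ⟨z, h1, h2, h3, h4⟩ hf hne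
    refine wp_then (wp_tableRow (s := s'.tick) (z := z) ⟨(hf.reg 3 rfl).trans hs.r3,
      (hf.reg 6 rfl).trans hs.r6, (hf.reg 7 rfl).trans hs.r7, (hf.reg 17 rfl).trans hs.r17,
      (hf.reg 19 rfl).trans hs.r19⟩ (by omega) h2 h4) ?_
    rintro s'' ⟨g1, g2, g3, g4, g5⟩ -
    simp only [St.tick_reg, St.tick_time] at g4 g5
    exact ⟨⟨z + 1, by omega, g1, fun _ => g3, g2⟩, by omega, by omega⟩
  · rintro s' ⟨z, h1, h2, h3, h4⟩ hf h0 ht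
    obtain rfl : z = Γ.N - Γ.w + 1 := by omega
    simp at ht ⊢
    refine ⟨h2, fun z hz o ho => ?_, ?_, ?_⟩
    · rw [h4 _ ?_, Nat.add_comm, Nat.add_mul_div_right _ _ (by omega), Nat.div_eq_of_lt (by omega),
        zero_add, Nat.add_mul_mod_self_right, Nat.mod_eq_of_lt (by omega)]
      rw [h2]
      nlinarith [Nat.mul_le_mul_right (Γ.w + 1) hz]
    · rw [h3 (by omega), binomEntry, if_neg (by omega), Ctx.S]
      congr 1; omega
    · have : (Γ.N - Γ.w + 1) * (12 * (Γ.w + 1) + 5) =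
        12 * (Γ.w * (Γ.N - Γ.w)) + 17 * (Γ.N - Γ.w) + 12 * Γ.w + 17 := by ring
      omega

/-- Computes the number of splitters that are to be tried. -/
def boundCmd : Cmd :=
  .add 24 8 19 ;; .const 25 0 ;; .whilenz 24 (.half 24 24 ;; .add 25 25 3) ;;
  .const 11 4096 ;;
  .whilenz 25 (.half 25 25 ;; .add 11 11 11 ;; .add 11 11 11 ;; .add 11 11 11 ;; .add 11 11 11)

theorem size_half_add_one {j : ℕ} (h : j ≠ 0) : (j / 2).size + 1 = j.size := by
  conv_rhs => rw [← Nat.bit_bodd_div2 j]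
  rw [Nat.size_bit (by rwa [Nat.bit_bodd_div2]), Nat.div2_val]

theorem size_le_self (m : ℕ) : m.size ≤ m := Nat.size_le.2 Nat.lt_two_pow_self

/-- The first loop counts the bits of S by halving; the second halves this count and multiplies 4096
= 2^12 by 16 for each of its bits. -/
theorem wp_boundCmd {Γ : Ctx} {s : St} (hQ : Γ.Q = 2 ^ (12 + 4 * Γ.S.size.size))
    (h3 : s.reg 3 = 1) (h8 : s.reg 8 = Γ.S) (h19 : s.reg 19 = 0) :
    wp Γ.inp Γ.V Γ.D boundCmd (fun s' => s'.reg 11 = Γ.Q ∧ s'.time ≤ s.time + 40 * Γ.S) s := by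
  have hV := Γ.le_V'
  have hS := Γ.S_pos
  have hSS := size_le_self Γ.S
  have hSS' := size_le_self Γ.S.size
  have hQ' : 4096 ≤ Γ.Q := by
    rw [hQ, pow_add]; exact Nat.le_mul_of_pos_right _ (by positivity)
  simp [boundCmd, h8, h19]
  refine ⟨by omega, ?_⟩
  refine wp_while (fun s' => s'.reg 25 + (s'.reg 24).size = Γ.S.size) (fun s' => (s'.reg 24).size) 6
    ?_ ?_ ?_
  · simp
  · rintro s' h1 hf hne
    have e3 : s'.reg 3 = 1 := (hf.reg 3 rfl).trans h3
    have := size_half_add_one hne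
    simp [e3]
    omega
  · rintro s' h1 hf h0 ht
    rw [h0, Nat.size_zero, Nat.add_zero] at h1
    simp at ht
    simp
    refine ⟨by omega, ?_⟩
    refine wp_while (fun s' => s'.reg 11 * 2 ^ (4 * (s'.reg 25).size) = Γ.Q)
      (fun s' => (s'.reg 25).size) 11 ?_ ?_ ?_
    · simp [h1, hQ, pow_add]
    · rintro s'' g1 hf' hne
      have := size_half_add_one hne
      have hle : s''.reg 11 * 16 ≤ Γ.Q := by
        rw [← g1]
        refine Nat.mul_le_mul_left _ ?_
        calc 16 = 2 ^ (4 * 1) := by norm_num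
          _ ≤ _ := Nat.pow_le_pow_right (by omega) (by omega)
      simp
      refine ⟨by omega, by omega, by omega, by omega, ?_⟩
      refine ⟨?_, by omega⟩
      rw [← g1, ← this, Nat.mul_add, Nat.pow_add]
      ring
    · rintro s'' g1 hf' h0' ht'
      rw [h0', Nat.size_zero] at g1
      simp [h1] at ht' g1 ⊢
      omega

end SubsetSum
end

/-! ### Reading the input, and the complete program. -/

noncomputable section

namespace SubsetSum

open RAM

/-- Sets up the constant registers and the table. -/
def prepareCmd : Cmd :=
  .half 5 0 ;; .half 5 5 ;; .half 6 1 ;; .half 6 6 ;; .sub 17 5 6 ;; .add 7 6 3 ;;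
  tableCmd ;;
  .add 8 22 19 ;; .sub 18 20 3 ;; .sub 18 18 7 ;; .add 10 4 4 ;; .add 9 10 3 ;; boundCmd

/-- The input has been read: its length, weight, target and the sum of its numbers. -/
structure InputRead (n ℓ t B : ℕ) (s : St) : Prop where
  r0 : s.reg 0 = n
  r1 : s.reg 1 = ℓ
  r2 : s.reg 2 = t
  r3 : s.reg 3 = 1
  r4 : s.reg 4 = B
  r12 : s.reg 12 = 0
  r19 : s.reg 19 = 0
  mem : s.mem = 0
  out : s.out = []

theorem InputRead.congr {n ℓ t B : ℕ} {s s' : St} (h : InputRead n ℓ t B s)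
    (hr : ∀ r ∈ [0, 1, 2, 3, 4, 12, 19], s'.reg r = s.reg r) (hm : s'.mem = s.mem)
    (ho : s'.out = s.out) : InputRead n ℓ t B s' := by
  simp only [List.forall_mem_cons] at hr
  obtain ⟨h0, h1, h2, h3, h4, h12, h19, -⟩ := hr
  exact ⟨h0.trans h.r0, h1.trans h.r1, h2.trans h.r2, h3.trans h.r3, h4.trans h.r4,
    h12.trans h.r12, h19.trans h.r19, hm.trans h.mem, ho.trans h.out⟩

theorem wp_prepareCmd {Γ : Ctx} {s : St} (hQ : Γ.Q = 2 ^ (12 + 4 * Γ.S.size.size))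
    (hs : InputRead (4 * Γ.N) (4 * Γ.w) Γ.t Γ.B s) :
    wp Γ.inp Γ.V Γ.D prepareCmd (fun s' => Γ.Ready s' ∧ s'.reg 12 = 0 ∧ s'.out = [] ∧
      s'.time ≤ s.time + 200 * Γ.S) s := by
  have hV := Γ.le_V'
  have hS := Γ.S_pos
  have hN := Γ.N_le_S
  have hw := Γ.w_lt
  have e5 : 4 * Γ.N / 2 / 2 = Γ.N := by omega
  have e6 : 4 * Γ.w / 2 / 2 = Γ.w := by omega
  simp [prepareCmd, hs.r0, hs.r1, hs.r3, e5, e6]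
  refine ⟨by omega, ?_⟩
  refine wp_then (wp_tableCmd ⟨by simp [hs.r3], by simp, by simp, by simp, by simp [hs.r19]⟩
    (by simp [hs.mem])) ?_
  rintro s₁ ⟨h20, hT, h22, t1⟩ f1
  have e0 : s₁.reg 0 = 4 * Γ.N := (f1.reg 0 rfl).trans (by simp [hs.r0])
  have e2 : s₁.reg 2 = Γ.t := (f1.reg 2 rfl).trans (by simp [hs.r2])
  have e3 : s₁.reg 3 = 1 := (f1.reg 3 rfl).trans (by simp [hs.r3])
  have e4 : s₁.reg 4 = Γ.B := (f1.reg 4 rfl).trans (by simp [hs.r4])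
  have e5 : s₁.reg 5 = Γ.N := (f1.reg 5 rfl).trans (by simp)
  have e7 : s₁.reg 7 = Γ.w + 1 := (f1.reg 7 rfl).trans (by simp)
  have e12 : s₁.reg 12 = 0 := (f1.reg 12 rfl).trans (by simp [hs.r12])
  have e19 : s₁.reg 19 = 0 := (f1.reg 19 rfl).trans (by simp [hs.r19])
  have eo : s₁.out = [] := (f1.out rfl).trans (by simp [hs.out])
  -- The table ends one row after row N - w, so stepping back one cell and one row gives the address
  -- at which the unranking starts.
  have e18 : (Γ.N - Γ.w + 2) * (Γ.w + 1) - 1 - (Γ.w + 1) = (Γ.N - Γ.w) * (Γ.w + 1) + Γ.w := by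
    rw [show (Γ.N - Γ.w + 2) * (Γ.w + 1) = (Γ.N - Γ.w) * (Γ.w + 1) + 2 * Γ.w + 2 by ring]
    omega
  simp at t1
  simp [e3, e4, e7, e19, h20, h22, e18]
  refine ⟨by omega, by omega, by omega, ?_⟩
  refine wp_then (wp_boundCmd hQ (by simp [e3]) (by simp) (by simp [e19])) ?_
  rintro s₂ ⟨h11, t2⟩ f2
  simp at t2
  refine ⟨⟨?_, ?_, ?_, ?_, ?_, ?_, ?_, ?_, ?_, h11, ?_, ?_, ?_⟩, ?_, ?_, by omega⟩
  · exact (f2.reg 0 rfl).trans (by simp [e0])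
  · exact (f2.reg 2 rfl).trans (by simp [e2])
  · exact (f2.reg 3 rfl).trans (by simp [e3])
  · exact (f2.reg 4 rfl).trans (by simp [e4])
  · exact (f2.reg 5 rfl).trans (by simp [e5])
  · exact (f2.reg 7 rfl).trans (by simp [e7])
  · exact (f2.reg 8 rfl).trans (by simp)
  · exact (f2.reg 9 rfl).trans (by simp; omega)
  · exact (f2.reg 10 rfl).trans (by simp; omega)
  · exact (f2.reg 18 rfl).trans (by simp)
  · exact (f2.reg 19 rfl).trans (by simp [e19])
  · rw [f2.mem 14 rfl]
    exact fun z hz o ho _ => hT z hz o ho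
  · exact (f2.reg 12 rfl).trans (by simp [e12])
  · exact (f2.out rfl).trans (by simp [eo])

/-- Reads the length, the weight and the target, and adds the numbers. -/
def readCmd : Cmd :=
  .const 3 1 ;; .input 0 20 ;; .input 1 3 ;; .add 20 3 3 ;; .input 2 20 ;; .add 20 20 3 ;;
  .add 21 0 19 ;;
  .whilenz 21 (.input 23 20 ;; .add 4 4 23 ;; .add 20 20 3 ;; .sub 21 21 3)

theorem wp_readCmd {inp : ℕ → ℕ} {V D n B : ℕ} (hn : inp 0 = n) (h1 : inp 1 ≤ n)
    (hB : ∑ e ∈ Finset.range n, inp (e + 3) = B) (hV : B + n + inp 2 + 3 ≤ V) {s : St}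
    (hs : s.reg = 0) (hm : s.mem = 0) (ho : s.out = []) :
    wp inp V D readCmd (fun s' => InputRead n (inp 1) (inp 2) B s' ∧
      s'.time ≤ s.time + 10 * n + 20) s := by
  have hle : ∀ e < n, inp (e + 3) ≤ B := fun e he => hB ▸
    Finset.single_le_sum (f := fun e => inp (e + 3)) (fun _ _ => Nat.zero_le _)
      (Finset.mem_range.2 he)
  simp [readCmd, hs, hn]
  refine ⟨by omega, by omega, by omega, by omega, by omega, by omega, by omega, ?_⟩
  refine wp_while (fun s' => ∃ i, i + s'.reg 21 = n ∧ s'.reg 20 = i + 3 ∧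
    s'.reg 4 = ∑ e ∈ Finset.range i, inp (e + 3)) (fun s' => s'.reg 21) 9 ?_ ?_ ?_
  · exact ⟨0, by simp, by simp, by simp⟩
  · rintro s' ⟨i, h2, h3, h4⟩ hf hne
    have e3 : s'.reg 3 = 1 := (hf.reg 3 rfl).trans (by simp)
    have hsum : s'.reg 4 + inp (i + 3) = ∑ e ∈ Finset.range (i + 1), inp (e + 3) := by
      rw [Finset.sum_range_succ, h4]
    have hsum' : ∑ e ∈ Finset.range (i + 1), inp (e + 3) ≤ B := hB ▸
      Finset.sum_le_sum_of_subset (Finset.range_subset_range.2 (by omega))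
    have := hle i (by omega)
    simp [e3, h3, hsum]
    omega
  · rintro s' ⟨i, h2, h3, h4⟩ hf h0 ht
    obtain rfl : i = n := by omega
    simp at ht
    refine ⟨⟨?_, ?_, ?_, ?_, ?_, ?_, ?_, ?_, ?_⟩, by simp; omega⟩
    · exact (hf.reg 0 rfl).trans (by simp)
    · exact (hf.reg 1 rfl).trans (by simp)
    · exact (hf.reg 2 rfl).trans (by simp)
    · exact (hf.reg 3 rfl).trans (by simp)
    · exact h4.trans hB
    · exact (hf.reg 12 rfl).trans (by simp)
    · exact (hf.reg 19 rfl).trans (by simp)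
    · funext k
      exact (hf.mem k rfl).trans (by simp [hm])
    · exact (hf.out rfl).trans (by simp [ho])

/-- Solves the problem if the weight equals the length. -/
def fullWeightCmd : Cmd :=
  .sub 21 4 2 ;; .sub 22 2 4 ;; .ifnz 21 .skip (.ifnz 22 .skip
    (.add 21 0 19 ;; .whilenz 21 (.output 3 ;; .sub 21 21 3)))

/-- The only vector of full weight is all ones, so it suffices to compare the total with the target.
-/
theorem wp_fullWeightCmd {inp : ℕ → ℕ} {V D n ℓ t B : ℕ} {s : St} (hV : n ≤ V)
    (hs : InputRead n ℓ t B s) :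
    wp inp V D fullWeightCmd (fun s' =>
      ((B = t ∧ s'.out = List.replicate n true) ∨ (B ≠ t ∧ s'.out = [])) ∧
      s'.time ≤ s.time + 5 * n + 20) s := by
  simp [fullWeightCmd, hs.r2, hs.r4, hs.r0, hs.r19]
  split_ifs with h1 h2
  · obtain rfl : B = t := by omega
    simp
    refine ⟨hV, ?_⟩
    refine wp_while (fun s' => s'.reg 21 ≤ n ∧ s'.out = List.replicate (n - s'.reg 21) true)
      (fun s' => s'.reg 21) 5 ?_ ?_ ?_
    · simp [hs.out]
    · rintro s' ⟨h3, h4⟩ hf hne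
      have e3 : s'.reg 3 = 1 := (hf.reg 3 rfl).trans (by simp [hs.r3])
      simp [e3, h4]
      refine ⟨⟨by omega, ?_⟩, by omega⟩
      rw [show n - (s'.reg 21 - 1) = n - s'.reg 21 + 1 by omega, List.replicate_succ']
    · rintro s' ⟨h3, h4⟩ hf h0 ht
      rw [h0, Nat.sub_zero] at h4
      simp at ht
      exact ⟨h4, by simp; omega⟩
  · exact ⟨Or.inr ⟨by omega, hs.out⟩, by omega⟩
  · exact ⟨Or.inr ⟨by omega, hs.out⟩, by omega⟩

/-- The algorithm for the fixed weight subset sum problem. -/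
def program : Cmd :=
  readCmd ;; .sub 20 0 1 ;; .ifnz 20 (prepareCmd ;; searchCmd) fullWeightCmd

theorem wp_program_of_lt {Γ : Ctx} (h0 : Γ.inp 0 = 4 * Γ.N) (h1 : Γ.inp 1 = 4 * Γ.w)
    (h2 : Γ.inp 2 = Γ.t) (hQ : Γ.Q = 2 ^ (12 + 4 * Γ.S.size.size)) :
    wp Γ.inp Γ.V Γ.D program (fun s' =>
      ((∃ x, Γ.Solves x ∧ s'.out = (List.range (4 * Γ.N)).map (fun e => decide (x e ≠ 0))) ∨
        ((∀ x, ¬ Γ.Solves x) ∧ s'.out = [])) ∧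
      s'.time ≤ 3 * (Γ.Q + 2) ^ 4 * (2000 * Γ.S ^ 2 * Γ.S.size + 32)) St.start := by
  have hV := Γ.le_V'
  have hS := Γ.S_pos
  have hN := Γ.N_le_S
  have hw := Γ.w_lt
  rw [program, wp_seq]
  refine wp_then (wp_readCmd (s := St.start.tick) h0 (by omega) Γ.sum_inp (by omega) rfl rfl rfl) ?_
  rintro s₁ ⟨hs, t1⟩ -
  rw [h1, h2] at hs
  simp at t1
  simp [hs.r0, hs.r1]
  rw [if_neg (by omega)]
  refine wp_then (wp_prepareCmd hQ (hs.congr (by simp) rfl rfl)) ?_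
  rintro s₂ ⟨hr, h12, ho, t2⟩ -
  refine wp_then (wp_searchCmd hr h12 ho) ?_
  rintro s₃ ⟨ht, t3⟩ -
  refine ⟨by simpa using ht.correct hQ, ?_⟩
  simp [St.start] at t1 t2
  have hL : 0 < Γ.S.size := Nat.size_pos.2 hS
  have hY : Γ.S ≤ Γ.S ^ 2 * Γ.S.size := by nlinarith [Nat.mul_le_mul hS hL]
  have hP : 1 ≤ (Γ.Q + 2) ^ 4 := Nat.one_le_pow _ _ (by omega)
  rw [mul_assoc 2000] at t3 ⊢
  generalize Γ.S ^ 2 * Γ.S.size = Y at *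
  generalize (Γ.Q + 2) ^ 4 = Z at *
  nlinarith [Nat.mul_le_mul hP hY]

theorem wp_program_of_eq {inp : ℕ → ℕ} {V D n B : ℕ} (h0 : inp 0 = n) (h1 : inp 1 = n)
    (hB : ∑ e ∈ Finset.range n, inp (e + 3) = B) (hV : B + n + inp 2 + 3 ≤ V) :
    wp inp V D program (fun s' =>
      ((B = inp 2 ∧ s'.out = List.replicate n true) ∨ (B ≠ inp 2 ∧ s'.out = [])) ∧
      s'.time ≤ 15 * n + 60) St.start := by
  rw [program, wp_seq]
  refine wp_then (wp_readCmd (s := St.start.tick) h0 h1.le hB hV rfl rfl rfl) ?_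
  rintro s₁ ⟨hs, t1⟩ -
  simp [St.start] at t1
  simp [hs.r0, hs.r1, h1]
  refine wp_then (wp_fullWeightCmd (n := n) (ℓ := inp 1) (by omega) (hs.congr (by simp) rfl rfl)) ?_
  rintro s₂ ⟨h, t2⟩ -
  exact ⟨h, by simp at t2; omega⟩

theorem program_within : program.within 40 16 = true := by decide

end SubsetSum
end

/-! ### From step counts to bit complexity. -/

noncomputable section

namespace SubsetSumInstance

theorem encode_add_three (I : SubsetSumInstance) (i : Fin I.n) : I.encode (i + 3) = I.a i := by
  simp [encode]

/-- The sum of all numbers of the instance. -/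
def total (I : SubsetSumInstance) : ℕ := ∑ e ∈ Finset.range I.n, I.encode (e + 3)

theorem total_eq (I : SubsetSumInstance) : I.total = ∑ i, I.a i := by
  rw [total, Finset.sum_range]
  exact Finset.sum_congr rfl fun i _ => I.encode_add_three i

theorem lt_two_pow_bitLength (I : SubsetSumInstance) :
    I.n < 2 ^ I.bitLength ∧ I.t < 2 ^ I.bitLength ∧ ∀ i, I.a i < 2 ^ I.bitLength := by
  have h := Nat.lt_size_self (max (max I.n I.ℓ) (max I.t (Finset.univ.sup I.a)))
  simp only [max_lt_iff] at h
  exact ⟨h.1.1, h.2.1, fun i => (Finset.le_sup (f := I.a) (Finset.mem_univ i)).trans_lt h.2.2⟩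

theorem bitLength_pos (I : SubsetSumInstance) : 0 < I.bitLength :=
  Nat.size_pos.2 (lt_max_of_lt_right (lt_max_of_lt_left I.target_pos))

theorem total_lt (I : SubsetSumInstance) : I.total < 2 ^ (2 * I.bitLength) := by
  obtain ⟨h1, -, h2⟩ := I.lt_two_pow_bitLength
  calc I.total ≤ I.n * 2 ^ I.bitLength := by
        rw [total_eq]
        simpa using Finset.sum_le_card_nsmul Finset.univ I.a _ fun i _ => (h2 i).le
    _ < 2 ^ I.bitLength * 2 ^ I.bitLength := Nat.mul_lt_mul_of_pos_right h1 (by positivity)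
    _ = _ := by rw [two_mul, pow_add]

theorem isSolution_iff (I : SubsetSumInstance) {x : ℕ → ℕ} (hx : ∀ e < I.n, x e ≤ 1) :
    I.IsSolution (fun i => decide (x i ≠ 0)) ↔ ∑ e ∈ Finset.range I.n, x e = I.ℓ ∧
      ∑ e ∈ Finset.range I.n, I.encode (e + 3) * x e = I.t := by
  have h : ∀ i : Fin I.n, (decide (x i ≠ 0)).toNat = x i := fun i => by
    have := hx i i.2
    rcases Nat.eq_zero_or_pos (x i) with h | h
    · simp [h]
    · simp [show x i = 1 by omega]
  simp only [IsSolution, h, Finset.sum_range, encode_add_three]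

theorem exists_of_solvable {I : SubsetSumInstance} (h : I.Solvable) :
    ∃ x : ℕ → ℕ, (∀ e < I.n, x e ≤ 1) ∧ ∑ e ∈ Finset.range I.n, x e = I.ℓ ∧
      ∑ e ∈ Finset.range I.n, I.encode (e + 3) * x e = I.t := by
  obtain ⟨y, hy1, hy2⟩ := h
  refine ⟨fun e => if h : e < I.n then (y ⟨e, h⟩).toNat else 0, fun e he => ?_, ?_, ?_⟩
  · simp only [he, dif_pos]
    exact Bool.toNat_le _
  · rw [Finset.sum_range, ← hy1]
    simp
  · rw [Finset.sum_range, ← hy2]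
    simp [encode_add_three]

theorem ofFn_decide (m : ℕ) (x : ℕ → ℕ) :
    List.ofFn (fun i : Fin m => decide (x i ≠ 0)) =
      (List.range m).map fun e => decide (x e ≠ 0) := by
  rw [List.ofFn_eq_map, ← List.map_coe_finRange_eq_range, List.map_map]
  rfl

end SubsetSumInstance

namespace SubsetSum

open RAM

/-- The program finds the answer within the stated bounds. -/
structure Performs (I : SubsetSumInstance) (ω : ℕ → Bool) : Prop where
  answer : ∃ τ, (run program I.encode ω τ).Halted ∧ I.IsAnswer (run program I.encode ω τ).out
  time_le : time program I.encode ω ≤ ((2 ^ 87 * (I.bitLength *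
    (((I.n / 4).choose (I.ℓ / 4)) ^ 2 * (if I.ℓ = I.n then I.n else 1) *
      ((I.n / 4).choose (I.ℓ / 4)).size ^ 18)) : ℕ) : ℝ≥0∞)
  space_le : space program I.encode ω ≤ ((2 ^ 87 * (I.bitLength *
    ((I.n / 4).choose (I.ℓ / 4) * ((I.n / 4).choose (I.ℓ / 4)).size ^ 18)) : ℕ) : ℝ≥0∞)

/-- Here S = 1 and the logarithmic factors are trivial, so the linear time for reading and writing
has to be paid by the factor `n`. -/
theorem performs_of_eq {I : SubsetSumInstance} (h : I.ℓ = I.n) (ω : ℕ → Bool) : Performs I ω := by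
  have hb := I.bitLength_pos
  obtain ⟨h1, h2, -⟩ := I.lt_two_pow_bitLength
  have h3 := I.total_lt
  have hn : 0 < I.n := I.weight_pos.trans_le I.weight_le
  set b := I.bitLength
  set V := I.total + I.n + I.t + 3 with hV
  have hVs : V.size ≤ 6 * b := by
    rw [Nat.size_le, hV]
    have h4 : 2 ^ b ≤ 2 ^ (2 * b) := Nat.pow_le_pow_right (by omega) (by omega)
    have h5 : 2 ^ (2 * b) * 2 ^ 4 ≤ 2 ^ (6 * b) := by
      rw [← pow_add]; exact Nat.pow_le_pow_right (by omega) (by omega)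
    have h6 : 1 ≤ 2 ^ (2 * b) := Nat.one_le_two_pow
    omega
  obtain ⟨s, ⟨h4, ht⟩, h5, h6, h7, h8⟩ := run_of_wp program_within
    (wp_program_of_eq (inp := I.encode) (V := V) (D := 0) (n := I.n) (B := I.total) rfl h rfl le_rfl) ω
  refine ⟨⟨s.time, h5, ?_⟩, h7.trans ?_, h8.trans ?_⟩
  · rw [h6]
    rcases h4 with ⟨h4, ho⟩ | ⟨h4, ho⟩
    · refine Or.inl ⟨fun _ => true, ⟨by simp [h], ?_⟩, by rw [ho, List.ofFn_const]⟩
      simp only [Bool.toNat_true, mul_one, ← I.total_eq]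
      exact h4
    · refine Or.inr ⟨fun ⟨x, hx1, hx2⟩ => h4 ?_, ho⟩
      have h9 : ∀ i ∈ Finset.univ, (x i).toNat = 1 := by
        refine (Finset.sum_eq_sum_iff_of_le fun i _ => Bool.toNat_le (x i)).1 ?_
        simp [hx1, h]
      rw [I.total_eq]
      refine Eq.trans ?_ hx2
      exact Finset.sum_congr rfl fun i hi => by rw [h9 i hi, mul_one]
  · norm_cast
    rw [h, if_pos rfl, Nat.choose_self, Nat.size_one, one_pow, one_pow, mul_one, one_mul]
    calc s.time * (1 + 2 * V.size) ≤ (75 * I.n) * (13 * b) := Nat.mul_le_mul (by omega) (by omega)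
      _ = 975 * (b * I.n) := by ring
      _ ≤ _ := Nat.mul_le_mul_right _ (by norm_num)
  · norm_cast
    rw [h, Nat.choose_self, Nat.size_one, one_pow, mul_one, mul_one, Nat.size_zero]
    omega

theorem two_pow_size_le {m : ℕ} (h : 0 < m) : 2 ^ m.size ≤ 2 * m := by
  have h1 := Nat.size_pos.2 h
  have h2 : m.size - 1 < m.size := by omega
  rw [Nat.lt_size] at h2
  calc 2 ^ m.size = 2 ^ (m.size - 1) * 2 := by rw [← pow_succ]; congr 1; omega
    _ ≤ _ := by omega

/-- With L the bit length of S: the (Q + 2)⁴ attempts contribute L^16, the tournament trees one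
factor L, and the size O(bL) of the numbers another, which gives the exponent 18. No separate factor
`n` is needed because N ≤ S. -/
theorem performs_of_lt {I : SubsetSumInstance} (hI : I.FourDivides) (h : I.ℓ < I.n)
    (ω : ℕ → Bool) : Performs I ω := by
  have hb := I.bitLength_pos
  obtain ⟨h1, h2, -⟩ := I.lt_two_pow_bitLength
  have h3 := I.total_lt
  have hℓ := I.weight_pos
  have hn4 : 4 * (I.n / 4) = I.n := by have := hI.1; omega
  have hℓ4 : 4 * (I.ℓ / 4) = I.ℓ := by have := hI.2; omega
  set b := I.bitLength with hbdef
  set S := (I.n / 4).choose (I.ℓ / 4) with hSdef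
  have hS : 0 < S := Nat.choose_pos (by omega)
  set L := S.size with hL
  have hL0 : 0 < L := Nat.size_pos.2 hS
  set Q := 2 ^ (12 + 4 * L.size) with hQ
  set V := 8 * I.total + I.t + 8 * S + 8 * Q + 8 with hV
  let Γ : Ctx := ⟨I.encode, I.n / 4, I.ℓ / 4, I.t, I.total, Q, V, 8 * S + 8, by omega, by omega,
    by rw [hn4]; rfl, le_rfl, le_rfl⟩
  have hLL : L.size ≤ L := size_le_self L
  have hSL : S < 2 ^ L := Nat.lt_size_self S
  have hbL : 1 ≤ b * L := Nat.mul_pos hb hL0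
  have hbL1 : b ≤ b * L := Nat.le_mul_of_pos_right _ hL0
  have hbL2 : L ≤ b * L := Nat.le_mul_of_pos_left _ hb
  -- The sum of the inputs has about 2b bits and `Q` has O(L); the sum of b and L is weakened to a
  -- product to bring out the factor `b`.
  have hVs : V.size ≤ 28 * (b * L) := by
    have h4 : 2 ^ b ≤ 2 ^ (2 * b + 5 * L + 15) := Nat.pow_le_pow_right (by omega) (by omega)
    have h5 : 2 ^ (2 * b) ≤ 2 ^ (2 * b + 5 * L + 15) := Nat.pow_le_pow_right (by omega) (by omega)
    have h6 : 2 ^ L ≤ 2 ^ (2 * b + 5 * L + 15) := Nat.pow_le_pow_right (by omega) (by omega)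
    have h7 : Q ≤ 2 ^ (2 * b + 5 * L + 15) := Nat.pow_le_pow_right (by omega) (by omega)
    have h8 : 1 ≤ 2 ^ (2 * b + 5 * L + 15) := Nat.one_le_two_pow
    have h9 : V.size ≤ 2 * b + 5 * L + 15 + 6 := by
      rw [Nat.size_le, hV, pow_add _ _ 6]
      omega
    omega
  have hDs : (8 * S + 8).size ≤ 5 * (b * L) := by
    have h4 : (8 * S + 8).size ≤ L + 4 := by
      rw [Nat.size_le, pow_add]
      omega
    omega
  obtain ⟨s, ⟨h4, ht⟩, h5, h6, h7, h8⟩ := run_of_wp program_within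
    (wp_program_of_lt (Γ := Γ) hn4.symm hℓ4.symm rfl rfl) ω
  refine ⟨⟨s.time, h5, ?_⟩, h7.trans ?_, h8.trans ?_⟩
  · change I.IsAnswer (run program Γ.inp ω s.time).out
    rw [h6]
    have e : 4 * Γ.N = I.n := hn4
    have e' : 4 * Γ.w = I.ℓ := hℓ4
    rcases h4 with ⟨x, hx, ho⟩ | ⟨h4, ho⟩
    · have hx1 := hx.le_one
      have hx2 := hx.weight
      have hx3 := hx.sum
      rw [e] at hx1 hx2 hx3 ho
      rw [e'] at hx2
      exact Or.inl ⟨_, (I.isSolution_iff hx1).2 ⟨hx2, hx3⟩,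
        ho.trans (SubsetSumInstance.ofFn_decide _ _).symm⟩
    · refine Or.inr ⟨fun hsol => ?_, ho⟩
      obtain ⟨x, hx1, hx2, hx3⟩ := SubsetSumInstance.exists_of_solvable hsol
      exact h4 x ⟨by rwa [e], by rw [e, e', hx2], by rw [e]; exact hx3⟩
  · norm_cast
    rw [if_neg (by omega), mul_one]
    -- From 2 ^ (size L) ≤ 2L one gets Q ≤ 2^12 · (2L)⁴ = 2^16 · L⁴.
    have hQL : Q + 2 ≤ 2 ^ 17 * L ^ 4 := by
      have g1 := Nat.pow_le_pow_left (two_pow_size_le hL0) 4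
      have g2 : Q = 2 ^ 12 * (2 ^ L.size) ^ 4 := by rw [hQ, pow_add, ← pow_mul, mul_comm 4]
      have g3 : 1 ≤ L ^ 4 := Nat.one_le_pow _ _ hL0
      rw [mul_pow] at g1
      omega
    have ht' : s.time ≤ 2 ^ 81 * (S ^ 2 * L ^ 17) := by
      refine ht.trans ?_
      change 3 * (Q + 2) ^ 4 * (2000 * S ^ 2 * L + 32) ≤ _
      have g1 : 2000 * S ^ 2 * L + 32 ≤ 2032 * (S ^ 2 * L) := by
        have : 1 ≤ S ^ 2 * L := Nat.mul_pos (by positivity) hL0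
        rw [mul_assoc]; omega
      calc 3 * (Q + 2) ^ 4 * (2000 * S ^ 2 * L + 32)
          ≤ 3 * (2 ^ 17 * L ^ 4) ^ 4 * (2032 * (S ^ 2 * L)) := by gcongr
        _ = 3 * 2032 * 2 ^ 68 * (S ^ 2 * L ^ 17) := by ring
        _ ≤ _ := Nat.mul_le_mul_right _ (by norm_num)
    calc s.time * (1 + 2 * V.size) ≤ (2 ^ 81 * (S ^ 2 * L ^ 17)) * (2 ^ 6 * (b * L)) :=
          Nat.mul_le_mul ht' (by omega)
      _ = _ := by ring
  · norm_cast
    have g1 : L ≤ L ^ 18 := Nat.le_self_pow (by omega) L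
    calc 40 * V.size + 16 * (8 * S + 8 + 1) * ((8 * S + 8).size + V.size)
        ≤ 40 * (28 * (b * L)) * S + 16 * (17 * S) * (5 * (b * L) + 28 * (b * L)) :=
          Nat.add_le_add ((Nat.mul_le_mul_left _ hVs).trans (Nat.le_mul_of_pos_right _ hS))
            (Nat.mul_le_mul (by omega) (Nat.add_le_add hDs hVs))
      _ = 10096 * (b * (S * L)) := by ring
      _ ≤ _ := by gcongr; norm_num

theorem performs {I : SubsetSumInstance} (hI : I.FourDivides) (ω : ℕ → Bool) : Performs I ω := by
  rcases I.weight_le.lt_or_eq with h | h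
  · exact performs_of_lt hI h ω
  · exact performs_of_eq h ω

/-- Since g ≥ S ≥ 1, the logarithm Λ = log₂(3 + g) is at least 2. So the constant 2^87 is at most
Λ^87, and the bit length of S is at most Λ + 1 ≤ Λ², whose 18th power is Λ^36. -/
theorem isSoftO_of_le {D : Set SubsetSumInstance} {f : SubsetSumInstance → ℝ≥0∞}
    {g : SubsetSumInstance → ℝ} {g₀ : SubsetSumInstance → ℕ}
    (hf : ∀ I ∈ D, f I ≤ ((2 ^ 87 * (I.bitLength *
      (g₀ I * ((I.n / 4).choose (I.ℓ / 4)).size ^ 18)) : ℕ) : ℝ≥0∞))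
    (hg₀ : ∀ I ∈ D, (g₀ I : ℝ) ≤ g I)
    (hS : ∀ I ∈ D, ((I.n / 4).choose (I.ℓ / 4) : ℝ) ≤ g I) : IsSoftO D f g := by
  refine ⟨87 + 36, 0, fun I hI _ => (hf I hI).trans ?_⟩
  have h1 := hg₀ I hI
  have h2 := hS I hI
  have hpos : 0 < (I.n / 4).choose (I.ℓ / 4) :=
    Nat.choose_pos (Nat.div_le_div_right I.weight_le)
  generalize (I.n / 4).choose (I.ℓ / 4) = S at *
  have h3 : (1 : ℝ) ≤ S := by exact_mod_cast hpos
  set G := g I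
  have h4 : 2 ≤ Real.logb 2 (3 + G) := by
    rw [Real.le_logb_iff_rpow_le (by norm_num) (by linarith)]
    norm_num; linarith
  have h5 : (S.size : ℝ) ≤ Real.logb 2 (3 + G) ^ 2 := by
    have h6 : (S.size : ℝ) ≤ Real.logb 2 (3 + G) + 1 := by
      rw [← sub_le_iff_le_add, Real.le_logb_iff_rpow_le (by norm_num) (by linarith),
        Real.rpow_sub (by norm_num), Real.rpow_natCast, Real.rpow_one]
      have := two_pow_size_le hpos
      have : (2 : ℝ) ^ S.size ≤ 2 * S := by exact_mod_cast this
      linarith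
    nlinarith
  generalize Real.logb 2 (3 + G) = Λ at *
  rw [← ENNReal.ofReal_natCast]
  refine ENNReal.ofReal_le_ofReal ?_
  simp only [Nat.cast_mul, Nat.cast_pow, Nat.cast_ofNat]
  have h0 : (0 : ℝ) ≤ g₀ I := Nat.cast_nonneg _
  have hG : 0 ≤ G := by linarith
  calc (2 : ℝ) ^ 87 * (I.bitLength * (g₀ I * (S.size : ℝ) ^ 18))
      ≤ Λ ^ 87 * (I.bitLength * (G * (Λ ^ 2) ^ 18)) := by gcongr
    _ = I.bitLength * (G * Λ ^ (87 + 36)) := by ring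

/-- A halted machine stays put, so any halting time shows the same output. -/
theorem isAnswer_of_halted {I : SubsetSumInstance} (hI : I.FourDivides) {ω : ℕ → Bool} {τ : ℕ}
    (h : (run program I.encode ω τ).Halted) : I.IsAnswer (run program I.encode ω τ).out := by
  obtain ⟨τ', h1, h2⟩ := (performs hI ω).answer
  rcases Nat.le_total τ τ' with h' | h'
  · rwa [run_of_halted h h'] at h2
  · rwa [run_of_halted h1 h']

instance : IsProbabilityMeasure coinMeasure := by
  unfold coinMeasure; infer_instance

/-- The factor `n` occurs only if it equals `ℓ`, and ℓ ≤ ℓ^(3/2). -/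
theorem weight_factor_le (I : SubsetSumInstance) (S : ℕ) :
    ((S ^ 2 * (if I.ℓ = I.n then I.n else 1) : ℕ) : ℝ) ≤ (I.ℓ : ℝ) ^ (3 / 2 : ℝ) * (S : ℝ) ^ 2 := by
  have h1 : (1 : ℝ) ≤ I.ℓ := by exact_mod_cast I.weight_pos
  have h2 : (((if I.ℓ = I.n then I.n else 1 : ℕ)) : ℝ) ≤ (I.ℓ : ℝ) ^ (3 / 2 : ℝ) := by
    split_ifs with h
    · rw [← h]
      conv_lhs => rw [← Real.rpow_one (I.ℓ : ℝ)]
      exact Real.rpow_le_rpow_of_exponent_le h1 (by norm_num)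
    · push_cast
      exact Real.one_le_rpow h1 (by norm_num)
  rw [Nat.cast_mul, mul_comm, Nat.cast_pow]
  exact mul_le_mul_of_nonneg_right h2 (by positivity)

end SubsetSum
end

/-! ### The tradeoff between time and space exponents. -/

noncomputable section

namespace SubsetSum

open Nat in
theorem factorial_four_mul_succ (n : ℕ) : (4 * (n + 1))! =
    8 * (n + 1) * ((2 * n + 1) * (4 * n + 1) * (4 * n + 3)) * (4 * n)! := by
  rw [show 4 * (n + 1) = 4 * n + 3 + 1 by ring]
  simp only [Nat.factorial_succ]
  ring

open Nat in
-- A form of Stirling's (4n)! ≈ const · 256^n · n!⁴ · n^(-3/2), squared to stay within the integers.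
-- In the induction step the two sides differ by a polynomial with nonnegative coefficients;
-- `le_factorial_four_mul_sq` is the matching lower bound.
theorem factorial_four_mul_sq_le (n : ℕ) :
    (4 * n)! ^ 2 * (n + 1) ^ 3 ≤ 256 ^ (2 * n) * n ! ^ 8 := by
  induction n with
  | zero => simp
  | succ n ih =>
    have key : ((2 * n + 1) * (4 * n + 1) * (4 * n + 3)) ^ 2 * (n + 2) ^ 3 ≤
        1024 * (n + 1) ^ 6 * (n + 1) ^ 3 := by
      have : 1024 * (n + 1) ^ 6 * (n + 1) ^ 3 =
          ((2 * n + 1) * (4 * n + 1) * (4 * n + 3)) ^ 2 * (n + 2) ^ 3 + (952 + 8052 * n +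
          29050 * n ^ 2 + 57519 * n ^ 3 + 66916 * n ^ 4 + 45308 * n ^ 5 + 16384 * n ^ 6 +
          2432 * n ^ 7) := by ring
      omega
    refine Nat.le_of_mul_le_mul_right ?_ (show 0 < (n + 1) ^ 3 by positivity)
    calc (4 * (n + 1))! ^ 2 * (n + 1 + 1) ^ 3 * (n + 1) ^ 3
        = 64 * (n + 1) ^ 2 * (((2 * n + 1) * (4 * n + 1) * (4 * n + 3)) ^ 2 * (n + 2) ^ 3) *
          ((4 * n)! ^ 2 * (n + 1) ^ 3) := by rw [factorial_four_mul_succ]; ring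
      _ ≤ 64 * (n + 1) ^ 2 * (1024 * (n + 1) ^ 6 * (n + 1) ^ 3) *
          (256 ^ (2 * n) * n ! ^ 8) := by gcongr
      _ = _ := by rw [Nat.factorial_succ]; ring

open Nat in
theorem le_factorial_four_mul_sq (n : ℕ) :
    256 ^ (2 * n) * n ! ^ 8 ≤ (4 * n)! ^ 2 * (8 * n + 1) ^ 3 := by
  induction n with
  | zero => simp
  | succ n ih =>
    have key : 1024 * (n + 1) ^ 6 * (8 * n + 1) ^ 3 ≤
        ((2 * n + 1) * (4 * n + 1) * (4 * n + 3)) ^ 2 * (8 * n + 9) ^ 3 := by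
      have : ((2 * n + 1) * (4 * n + 1) * (4 * n + 3)) ^ 2 * (8 * n + 9) ^ 3 =
          1024 * (n + 1) ^ 6 * (8 * n + 1) ^ 3 + (5537 + 83004 * n +
          475524 * n ^ 2 + 1320032 * n ^ 3 + 1984896 * n ^ 4 + 1660928 * n ^ 5 + 729088 * n ^ 6 +
          131072 * n ^ 7) := by ring
      omega
    refine Nat.le_of_mul_le_mul_right ?_ (show 0 < (8 * n + 1) ^ 3 by positivity)
    calc 256 ^ (2 * (n + 1)) * (n + 1)! ^ 8 * (8 * n + 1) ^ 3
        = 64 * (n + 1) ^ 2 * (1024 * (n + 1) ^ 6 * (8 * n + 1) ^ 3) *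
          (256 ^ (2 * n) * n ! ^ 8) := by rw [Nat.factorial_succ]; ring
      _ ≤ 64 * (n + 1) ^ 2 * (((2 * n + 1) * (4 * n + 1) * (4 * n + 3)) ^ 2 * (8 * n + 9) ^ 3) *
          ((4 * n)! ^ 2 * (8 * n + 1) ^ 3) := by gcongr
      _ = _ := by rw [factorial_four_mul_succ]; ring

open Nat in
-- The upper estimate for the numerator (4N)! and the lower ones for the denominators leave (8w +
-- 1)³(8m + 1)³/(N + 1)³ with m = N - w. This is at most (9w · 8)³ = (18 · 4w)³.
theorem choose_four_mul_sq_le {N w : ℕ} (hw : 0 < w) (h : w ≤ N) :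
    (4 * N).choose (4 * w) ^ 2 ≤ (18 * (4 * w)) ^ 3 * N.choose w ^ 8 := by
  obtain ⟨m, rfl⟩ := Nat.exists_eq_add_of_le h
  have h1 : (4 * (w + m)).choose (4 * w) * (4 * w)! * (4 * m)! = (4 * (w + m))! := by
    rw [Nat.mul_add, Nat.choose_symm_add, Nat.add_choose_mul_factorial_mul_factorial]
  have h2 : (w + m).choose w * w ! * m ! = (w + m)! := by
    rw [Nat.choose_symm_add, Nat.add_choose_mul_factorial_mul_factorial]
  refine Nat.le_of_mul_le_mul_right ?_
    (show 0 < (4 * w)! ^ 2 * (4 * m)! ^ 2 * (w + m + 1) ^ 3 by positivity)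
  calc (4 * (w + m)).choose (4 * w) ^ 2 * ((4 * w)! ^ 2 * (4 * m)! ^ 2 * (w + m + 1) ^ 3)
      = (4 * (w + m))! ^ 2 * (w + m + 1) ^ 3 := by rw [← h1]; ring
    _ ≤ 256 ^ (2 * (w + m)) * (w + m)! ^ 8 := factorial_four_mul_sq_le _
    _ = (w + m).choose w ^ 8 * ((256 ^ (2 * w) * w ! ^ 8) * (256 ^ (2 * m) * m ! ^ 8)) := by
        rw [← h2]; ring
    _ ≤ (w + m).choose w ^ 8 *
        (((4 * w)! ^ 2 * (8 * w + 1) ^ 3) * ((4 * m)! ^ 2 * (8 * m + 1) ^ 3)) :=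
        Nat.mul_le_mul_left _
          (Nat.mul_le_mul (le_factorial_four_mul_sq w) (le_factorial_four_mul_sq m))
    _ ≤ (w + m).choose w ^ 8 *
        (((4 * w)! ^ 2 * (9 * w) ^ 3) * ((4 * m)! ^ 2 * (8 * (w + m + 1)) ^ 3)) := by
        gcongr <;> omega
    _ = _ := by ring

/-- The middle term of Vandermonde's identity. -/
theorem choose_sq_le_choose_two_mul (n k : ℕ) : n.choose k ^ 2 ≤ (2 * n).choose (2 * k) := by
  rw [two_mul n, Nat.add_choose_eq, sq]
  exact Finset.single_le_sum (f := fun ij : ℕ × ℕ => n.choose ij.1 * n.choose ij.2)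
    (fun _ _ => Nat.zero_le _)
    (Finset.HasAntidiagonal.mem_antidiagonal (a := (k, k)).2 (two_mul k).symm)

theorem choose_pow_four_le (n k : ℕ) : n.choose k ^ 4 ≤ (4 * n).choose (4 * k) :=
  calc n.choose k ^ 4 = (n.choose k ^ 2) ^ 2 := by ring
    _ ≤ (2 * n).choose (2 * k) ^ 2 := Nat.pow_le_pow_left (choose_sq_le_choose_two_mul n k) 2
    _ ≤ (2 * (2 * n)).choose (2 * (2 * k)) := choose_sq_le_choose_two_mul _ _
    _ = _ := by congr 1 <;> ring

theorem choose_tradeoff {n ℓ : ℕ} (hn : 4 ∣ n) (hℓ : 4 ∣ ℓ) (h0 : 0 < ℓ) (h : ℓ ≤ n) :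
    timeTerm n ℓ * spaceTerm n ℓ ^ 2 ≤ (n.choose ℓ : ℝ) ∧
      (n.choose ℓ : ℝ) ≤ 81 * (ℓ : ℝ) ^ (3 / 2 : ℝ) * (timeTerm n ℓ * spaceTerm n ℓ ^ 2) := by
  obtain ⟨N, rfl⟩ := hn
  obtain ⟨w, rfl⟩ := hℓ
  simp only [timeTerm, spaceTerm, Nat.mul_div_cancel_left _ (show 0 < 4 by norm_num), ← pow_add]
  refine ⟨by exact_mod_cast choose_pow_four_le N w, ?_⟩
  rw [← pow_le_pow_iff_left₀ (by positivity) (by positivity) two_ne_zero]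
  have h1 : ((4 * N).choose (4 * w) : ℝ) ^ 2 ≤ (18 * ((4 * w : ℕ) : ℝ)) ^ 3 * N.choose w ^ 8 := by
    exact_mod_cast choose_four_mul_sq_le (N := N) (w := w) (by omega) (by omega)
  have h2 : ((((4 * w : ℕ) : ℝ)) ^ (3 / 2 : ℝ)) ^ 2 = ((4 * w : ℕ) : ℝ) ^ 3 := by
    rw [← Real.rpow_natCast, ← Real.rpow_mul (by positivity), ← Real.rpow_natCast]
    norm_num
  calc _ ≤ _ := h1
    -- The constant 81 is chosen because 18³ = 5832 ≤ 6561 = 81².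
    _ ≤ 6561 * ((4 * w : ℕ) : ℝ) ^ 3 * N.choose w ^ 8 := by
      rw [mul_pow]; gcongr; norm_num
    _ = _ := by rw [mul_pow, mul_pow, h2]; ring

end SubsetSum
end

/-! ### Assembly of the bounds. -/

namespace SubsetSum

open RAM

theorem natCast_le_mul_sq {c : ℝ} (hc : 1 ≤ c) (S : ℕ) : (S : ℝ) ≤ c * (S : ℝ) ^ 2 :=
  calc (S : ℝ) ≤ (S : ℝ) ^ 2 := by exact_mod_cast Nat.le_self_pow two_ne_zero S
    _ ≤ c * (S : ℝ) ^ 2 := le_mul_of_one_le_left (by positivity) hc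

theorem isSoftO_time : IsSoftO {I | I.FourDivides} (fun I => ⨆ ω, time program I.encode ω)
    (fun I => (I.n : ℝ) ^ 3 * timeTerm I.n I.ℓ) := by
  have hn : ∀ I : SubsetSumInstance, (1 : ℝ) ≤ I.n := fun I => by
    exact_mod_cast I.weight_pos.trans_le I.weight_le
  refine isSoftO_of_le (fun I hI => iSup_le fun ω => (performs hI ω).time_le) (fun I _ => ?_)
    fun I _ => natCast_le_mul_sq (one_le_pow₀ (hn I)) _
  have h : (((if I.ℓ = I.n then I.n else 1 : ℕ)) : ℝ) ≤ (I.n : ℝ) ^ 3 := by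
    split_ifs
    · exact le_self_pow₀ (hn I) (by norm_num)
    · exact_mod_cast one_le_pow₀ (hn I)
  rw [Nat.cast_mul, mul_comm, Nat.cast_pow]
  exact mul_le_mul_of_nonneg_right h (by positivity)

/-- The time bound holds for every coin sequence, and the coin measure has mass one. -/
theorem isSoftO_expectedTime : IsSoftO {I | I.FourDivides ∧ I.Solvable}
    (fun I => expectedTime program I.encode)
    (fun I => (I.ℓ : ℝ) ^ (3 / 2 : ℝ) * timeTerm I.n I.ℓ) := by
  refine isSoftO_of_le (fun I hI => ?_) (fun I _ => weight_factor_le I _) fun I _ =>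
    natCast_le_mul_sq (Real.one_le_rpow (by exact_mod_cast I.weight_pos) (by norm_num)) _
  refine (lintegral_mono fun ω => (performs hI.1 ω).time_le).trans ?_
  rw [lintegral_const, measure_univ, mul_one]

theorem isSoftO_space : IsSoftO {I | I.FourDivides} (fun I => ⨆ ω, space program I.encode ω)
    (fun I => spaceTerm I.n I.ℓ) :=
  isSoftO_of_le (fun _ hI => iSup_le fun ω => (performs hI ω).space_le) (fun _ _ => le_rfl)
    fun _ _ => le_rfl

end SubsetSum

theorem mainTheorem1 :
    -- the deterministic version
    (∃ P : RAM.Cmd, P.Deterministic ∧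
      (∀ I : SubsetSumInstance, I.FourDivides → ∀ ω : ℕ → Bool, ∃ τ : ℕ,
        (RAM.run P I.encode ω τ).Halted ∧ I.IsAnswer (RAM.run P I.encode ω τ).out) ∧
      IsSoftO {I | I.FourDivides} (fun I => ⨆ ω, RAM.time P I.encode ω)
        (fun I => (I.n : ℝ) ^ 3 * timeTerm I.n I.ℓ) ∧
      IsSoftO {I | I.FourDivides} (fun I => ⨆ ω, RAM.space P I.encode ω)
        (fun I => spaceTerm I.n I.ℓ)) ∧
    -- the randomized version
    (∃ P : RAM.Cmd,
      (∀ I : SubsetSumInstance, I.FourDivides → ∀ (ω : ℕ → Bool) (τ : ℕ),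
        (RAM.run P I.encode ω τ).Halted → I.IsAnswer (RAM.run P I.encode ω τ).out) ∧
      (∀ I : SubsetSumInstance, I.FourDivides → I.Solvable →
        ∀ᵐ ω ∂ RAM.coinMeasure, ∃ τ : ℕ, (RAM.run P I.encode ω τ).Halted) ∧
      IsSoftO {I | I.FourDivides ∧ I.Solvable} (fun I => RAM.expectedTime P I.encode)
        (fun I => (I.ℓ : ℝ) ^ (3 / 2 : ℝ) * timeTerm I.n I.ℓ) ∧
      IsSoftO {I | I.FourDivides} (fun I => ⨆ ω, RAM.space P I.encode ω)
        (fun I => spaceTerm I.n I.ℓ)) ∧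
    -- the tradeoff curve, up to a polynomial factor
    (∃ K : ℝ, 0 < K ∧ ∀ n ℓ : ℕ, 4 ∣ n → 4 ∣ ℓ → 0 < ℓ → ℓ ≤ n →
      timeTerm n ℓ * spaceTerm n ℓ ^ 2 ≤ (n.choose ℓ : ℝ) ∧
      (n.choose ℓ : ℝ) ≤ K * (ℓ : ℝ) ^ (3 / 2 : ℝ) * (timeTerm n ℓ * spaceTerm n ℓ ^ 2)) := by
  -- The same coin-free program witnesses both versions; it always halts, so the almost sure
  -- statement holds for every outcome.
  refine ⟨⟨SubsetSum.program, RAM.Cmd.within.deterministic SubsetSum.program_within,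
    fun I hI ω => (SubsetSum.performs hI ω).answer, SubsetSum.isSoftO_time,
    SubsetSum.isSoftO_space⟩, ⟨SubsetSum.program,
    fun I hI ω τ h => SubsetSum.isAnswer_of_halted hI h, fun I hI _ => ?_,
    SubsetSum.isSoftO_expectedTime, SubsetSum.isSoftO_space⟩,
    81, by norm_num, fun n ℓ hn hℓ h0 h => SubsetSum.choose_tradeoff hn hℓ h0 h⟩
  exact Filter.Eventually.of_forall fun ω =>
    (SubsetSum.performs hI ω).answer.imp fun τ h => h.1
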